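/- Let $N\ge 2$, $m>0$, $\mu>0$, $\alpha\in\mathbb R$. Let $\hat f(k)=(2\pi)^{-d/2}\int_{\mathbb R^d} e^{-ik\cdot x}f(x)\,dx$ be the unitary Fourier transform on $L^2(\mathbb R^d)$. Write $H^s_{\rm as}(\mathbb R^{3(M+1)})$ for the functions in $H^s(\mathbb R^{3(M+1)})$ of variables $(x_0,x_1,\dots,x_M)$, $x_i\in\mathbb R^3$, that are antisymmetric under permutations of $x_1,\dots,x_M$. Put $$\mathcal G(k_0,\dots,k_N)=\Big(\tfrac1{2m}k_0^2+\tfrac12\sum_{i=1}^N k_i^2+\mu\Big)^{-1},$$ $$\mathcal L(k_0,\dots,k_{N-1})=2\pi^2\Big(\tfrac{2m}{m+1}\Big)^{3/2}\Big(\tfrac{k_0^2}{2(m+1)}+\tfrac12\sum_{i=1}^{N-1}k_i^2+\mu\Big)^{1/2}.$$ For $\xi\in H^{1/2}_{\rm as}(\mathbb R^{3N})$ let $\mathcal G\xi$ and $\tilde\Gamma\xi$ be given by $$\widehat{\mathcal G\xi}(k_0,\dots,k_N)=\mathcal G(k_0,\dots,k_N)\sum_{i=1}^N(-1)^{i+1}\hat\xi(k_0+k_i,k_1,\dots,k_{i-1},k_{i+1},\dots,k_N),$$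 $$\widehat{\tilde\Gamma\xi}(k_0,\dots,k_{N-1})=\mathcal L(k_0,\dots,k_{N-1})\,\hat\xi(k_0,\dots,k_{N-1})+\sum_{j=1}^{N-1}(-1)^{j+1}\int_{\mathbb R^3}\mathcal G(k_0-s,s,k_1,\dots,k_{N-1})\,\hat\xi(k_0+k_j-s,s,k_1,\dots,k_{j-1},k_{j+1},\dots,k_{N-1})\,ds .$$ The domain $D(\mathcal H_\alpha)$ consists of the $\psi\in L^2(\mathbb R^{3(N+1)})$ of the form $\psi=\phi+\mathcal G\xi$ with $\phi\in H^2_{\rm as}(\mathbb R^{3(N+1)})$, $\xi\in H^{1/2}_{\rm as}(\mathbb R^{3N})$ (the charge of $\psi$), $\tilde\Gamma\xi\in L^2(\mathbb R^{3N})$ and $$\phi\!\restriction_{x_N=x_0}=\frac{(-1)^{N+1}}{(2\pi)^{3/2}}\Big(\frac{2m\alpha}{m+1}+\tilde\Gamma\Big)\xi ,$$ where the left side is the $L^2$-trace, as a function of $(x_0,\dots,x_{N-1})$; and $$(\mathcal H_\alpha+\mu)\psi=\Big(-\tfrac1{2m}\Delta_{x_0}-\tfrac12\sum_{i=1}^N\Delta_{x_i}+\mu\Big)\phi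 .$$ Let $\psi\in D(\mathcal H_\alpha)$ with charge $\xi\in H^1(\mathbb R^{3N})$. Let $$n_\uparrow(k)=\int|\hat\psi(k,k_1,\dots,k_N)|^2\,dk_1\cdots dk_N,\qquad n_\downarrow(k)=N\int|\hat\psi(k_0,k,k_2,\dots,k_N)|^2\,dk_0\,dk_2\cdots dk_N,$$ $$C=\Big(\frac{2m}{m+1}\Big)^2N\,\|\xi\|_{L^2}^2,\qquad p_\uparrow=\frac{2m}{m+1}\,\|\xi\|_{L^2}^{-2}\int_{\mathbb R^{3N}} k_1\,|\hat\xi(k_1,\dots,k_N)|^2\,dk_1\cdots dk_N,\qquad p_\downarrow=\tfrac1m\,p_\uparrow$$ (with $p_\uparrow=p_\downarrow=0$ if $\xi=0$). Then $$k\mapsto k^2n_\uparrow(k)-\frac{C}{|k-p_\uparrow|^2}\in L^1(\mathbb R^3)\quad\text{and}\quad k\mapsto k^2n_\downarrow(k)-\frac{C}{|k-p_\downarrow|^2}\in L^1(\mathbb R^3),$$ and $$\langle\psi|\mathcal H_\alpha\psi\rangle=\int_{\mathbb R^3}\Big[\frac1{2m}\Big(k^2n_\uparrow(k)-\frac{C}{|k-p_\uparrow|^2}\Big)+\frac12\Big(k^2n_\downarrow(k)-\frac{C}{|k-p_\downarrow|^2}\Big)\Big]dk-\frac{m+1}{2m}\,C\,\alpha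 .$$ -/

import Mathlib

open MeasureTheory Filter Topology FourierTransform TemperedDistribution LineDeriv
open scoped SchwartzMap ENNReal

noncomputable section

namespace PointInteraction

/-- The one-particle space `ℝ³`. -/
abbrev E3 : Type := EuclideanSpace ℝ (Fin 3)

/-- Configurations (or momenta) `(x₀, x₁, …, x_M) ∈ ℝ^{3(M+1)}` of one distinguished particle,
with index `0`, and `M` further particles, with the Euclidean norm. -/
abbrev Conf (M : ℕ) : Type := PiLp 2 (fun _ : Fin (M + 1) => E3)

/-- The Hilbert space `L²(ℝ^{3(M+1)})`, with respect to Lebesgue measure. -/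
abbrev L2 (M : ℕ) : Type := Lp ℂ 2 (volume : Measure (Conf M))

/-- The point `(x₀, x₁, …, x_M)`. -/
def pt {M : ℕ} (x₀ : E3) (x : Fin M → E3) : Conf M :=
  WithLp.toLp 2 (Fin.cons x₀ x)

/-- The tuple `(x₁, …, x_M)` of a point `(x₀, x₁, …, x_M)`. -/
def rest {M : ℕ} (x : Conf M) : Fin M → E3 := fun i => x i.succ

/-- The unitary Fourier transform
`û(k) = (2π)^{-3(M+1)/2} ∫ e^{-i k·x} u(x) dx` on `L²`; Mathlib's `𝓕` has `e^{-2π i k·x}` and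
no prefactor. -/
def hat {M : ℕ} (u : L2 M) (k : Conf M) : ℂ :=
  (((2 * Real.pi) ^ (-(3 * ((M : ℝ) + 1)) / 2) : ℝ) : ℂ) *
    (𝓕 u : L2 M) ((2 * Real.pi)⁻¹ • k)

/-- Antisymmetry under permutations of the `M` particles with indices `1, …, M`. -/
def IsAntisymm {M : ℕ} (u : L2 M) : Prop :=
  ∀ σ : Equiv.Perm (Fin M), ∀ᵐ x : Conf M,
    u (pt (x 0) (fun i => rest x (σ i))) = ((Equiv.Perm.sign σ : ℤ) : ℂ) * u x

/-- `u ∈ H^s(ℝ^{3(M+1)})`, for `u ∈ L²`. -/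
def InSobolev {M : ℕ} (s : ℝ) (u : L2 M) : Prop :=
  MemSobolev s 2 (u : 𝓢'(Conf M, ℂ))

/-- The norm of `H^s`, `‖(1 + |k|²)^{s/2} û‖_{L²}`, with values in `[0, ∞]`. -/
def sobolevENorm {M : ℕ} (s : ℝ) (u : L2 M) : ℝ≥0∞ :=
  eLpNorm (fun k : Conf M => (((1 + ‖k‖ ^ 2) ^ (s / 2) : ℝ) : ℂ) * hat u k) 2 volume

/-- The point `(R, x₁, …, x_M, R)` of the plane on which the last particle sits at the position
of the distinguished one. -/
def coincidence {M : ℕ} (x : Conf M) : Conf (M + 1) :=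
  pt (x 0) (Fin.snoc (α := fun _ => E3) (rest x) (x 0))

/-- `g` is the `L²` trace of the `H²` function `φ` on the plane where the last particle meets the
distinguished one: the continuous extension of the restriction of Schwartz functions. -/
def IsTrace {M : ℕ} (φ : L2 (M + 1)) (g : L2 M) : Prop :=
  ∃ f : ℕ → 𝓢(Conf (M + 1), ℂ),
    Tendsto (fun j => sobolevENorm 2 ((f j).toLp 2 volume - φ)) atTop (𝓝 0) ∧
    Tendsto (fun j => eLpNorm (fun x : Conf M => f j (coincidence x) - g x) 2 volume)
      atTop (𝓝 0)

/-- The symbol `𝒢(k₀, …, k_M) = (k₀²/(2m) + ½ ∑ᵢ kᵢ² + μ)⁻¹`. -/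
def greenSymbol {M : ℕ} (m μ : ℝ) (k : Conf M) : ℝ :=
  (1 / (2 * m) * ‖k 0‖ ^ 2 + 1 / 2 * ∑ i, ‖rest k i‖ ^ 2 + μ)⁻¹

/-- The Fourier transform of `𝒢ξ`, where the `i`-th summand is
`± ξ̂(k₀ + kᵢ, k₁, …, kᵢ₋₁, kᵢ₊₁, …)`. The index `i` starts at `0` here. -/
def greenHat {M : ℕ} (m μ : ℝ) (ξ : L2 M) (k : Conf (M + 1)) : ℂ :=
  (greenSymbol m μ k : ℂ) *
    ∑ i : Fin (M + 1), (-1) ^ (i : ℕ) * hat ξ (pt (k 0 + rest k i) (i.removeNth (rest k)))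

/-- The symbol `ℒ(k₀, …, k_M) = 2π² (2m/(m+1))^{3/2} (k₀²/(2(m+1)) + ½ ∑ᵢ kᵢ² + μ)^{1/2}`. -/
def diagSymbol {M : ℕ} (m μ : ℝ) (k : Conf M) : ℝ :=
  2 * Real.pi ^ 2 * (2 * m / (m + 1)) ^ (3 / 2 : ℝ) *
    √(‖k 0‖ ^ 2 / (2 * (m + 1)) + 1 / 2 * ∑ i, ‖rest k i‖ ^ 2 + μ)

/-- The Fourier transform of `Γ ξ`, where `Γ` is the operator of the form
`𝒯_diag + 𝒯_off`. The index `j` starts at `0` here. -/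
def gammaHat {n : ℕ} (m μ : ℝ) (ξ : L2 (n + 1)) (k : Conf (n + 1)) : ℂ :=
  (diagSymbol m μ k : ℂ) * hat ξ k +
    ∑ j : Fin (n + 1), (-1) ^ (j : ℕ) *
      ∫ s : E3, (greenSymbol m μ (pt (k 0 - s) (Fin.cons s (rest k) : Fin (n + 2) → E3)) : ℂ) *
        hat ξ (pt (k 0 + rest k j - s)
          (Fin.cons s (j.removeNth (rest k)) : Fin (n + 1) → E3))

/-- `ψ` is in the domain of the Hamiltonian with parameter `α` for `N = n + 2` fermions of mass
`1` and one particle of mass `m`, with regular part `φ` and charge `ξ`: `ψ = φ + 𝒢ξ`, the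
function `Γξ` is in `L²`, and
`φ↾_{x_N = x₀} = (-1)^{N+1} (2π)^{-3/2} (2mα/(m+1) + Γ) ξ`. -/
structure IsDomainDecomposition {n : ℕ} (m α μ : ℝ) (ψ φ : L2 (n + 2)) (ξ : L2 (n + 1)) :
    Prop where
  regular_sobolev : InSobolev 2 φ
  regular_antisymm : IsAntisymm φ
  charge_sobolev : InSobolev (1 / 2) ξ
  charge_antisymm : IsAntisymm ξ
  decomposition : hat ψ =ᵐ[volume] fun k => hat φ k + greenHat m μ ξ k
  boundary : ∃ η : L2 (n + 1), hat η =ᵐ[volume] gammaHat m μ ξ ∧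
    IsTrace φ
      (((-1) ^ (n + 2 + 1) / (((2 * Real.pi) ^ (3 / 2 : ℝ) : ℝ) : ℂ)) •
        (((2 * m * α / (m + 1) : ℝ) : ℂ) • ξ + η))

/-- The `a`-th coordinate direction of particle `i`. -/
def dir {M : ℕ} (i : Fin (M + 1)) (a : Fin 3) : Conf M :=
  WithLp.toLp 2 (Pi.single i (EuclideanSpace.single a (1 : ℝ)))

/-- The Laplacian with respect to the position of particle `i`. -/
def particleLaplacian {M : ℕ} (i : Fin (M + 1)) (u : 𝓢'(Conf M, ℂ)) : 𝓢'(Conf M, ℂ) :=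
  ∑ a : Fin 3, ∂_{dir i a} (∂_{dir i a} u)

/-- The operator `-(2m)⁻¹ Δ_{x₀} - ½ ∑ᵢ Δ_{xᵢ}`, on tempered distributions. -/
def freeHamiltonian {M : ℕ} (m : ℝ) (u : 𝓢'(Conf M, ℂ)) : 𝓢'(Conf M, ℂ) :=
  -(((1 / (2 * m) : ℝ) : ℂ) • particleLaplacian 0 u)
    - ((1 / 2 : ℝ) : ℂ) • ∑ i : Fin M, particleLaplacian i.succ u

theorem memSobolev_sum {M : ℕ} {ι : Type*} (s : Finset ι) (f : ι → 𝓢'(Conf M, ℂ))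
    (h : ∀ i ∈ s, MemSobolev 0 2 (f i)) : MemSobolev 0 2 (∑ i ∈ s, f i) := by
  classical
  induction s using Finset.induction_on with
  | empty => exact memSobolev_fun_zero (E := Conf M) (F := ℂ) 0 2
  | insert a s ha ih =>
    rw [Finset.sum_insert ha]
    exact (h a (by simp)).add (ih fun i hi => h i (by simp [hi]))

theorem memSobolev_particleLaplacian {M : ℕ} (i : Fin (M + 1)) (u : 𝓢'(Conf M, ℂ))
    (h : MemSobolev 2 2 u) : MemSobolev 0 2 (particleLaplacian i u) := by
  refine memSobolev_sum _ _ fun a _ => ?_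
  have := (h.lineDerivOp (m := dir i a)).lineDerivOp (m := dir i a)
  norm_num at this
  exact this

/-- On `H²` the free Hamiltonian takes values in `L²`. -/
theorem exists_freeHamiltonian {M : ℕ} (m : ℝ) {φ : L2 M} (h : InSobolev 2 φ) :
    ∃ χ : L2 M, (χ : 𝓢'(Conf M, ℂ)) = freeHamiltonian m (φ : 𝓢'(Conf M, ℂ)) := by
  have h₁ := (memSobolev_particleLaplacian 0 _ h).smul ((1 / (2 * m) : ℝ) : ℂ)
  have h₂ := (memSobolev_sum Finset.univ _
    fun i _ => memSobolev_particleLaplacian (Fin.succ i) _ h).smul ((1 / 2 : ℝ) : ℂ)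
  have key : MemSobolev 0 2 (freeHamiltonian m (φ : 𝓢'(Conf M, ℂ))) := h₁.neg.sub h₂
  obtain ⟨χ, hχ⟩ := memSobolev_zero_iff.1 key
  exact ⟨χ, hχ.symm⟩

/-- The free Hamiltonian `H² → L²`. -/
def freeHamiltonianL2 {M : ℕ} (m : ℝ) (φ : L2 M) (h : InSobolev 2 φ) : L2 M :=
  (exists_freeHamiltonian m h).choose

/-- The value `H ψ` of the Hamiltonian at `ψ = φ + 𝒢ξ`, given by
`(H + μ) ψ = (-(2m)⁻¹ Δ_{x₀} - ½ ∑ᵢ Δ_{xᵢ} + μ) φ`. -/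
def hamiltonian {n : ℕ} {m α μ : ℝ} {ψ φ : L2 (n + 2)} {ξ : L2 (n + 1)}
    (h : IsDomainDecomposition m α μ ψ φ ξ) : L2 (n + 2) :=
  freeHamiltonianL2 m φ h.regular_sobolev + (μ : ℂ) • φ - (μ : ℂ) • ψ

/-- The momentum density of the particle of mass `m`. -/
def densityUp {M : ℕ} (ψ : L2 M) (k : E3) : ℝ :=
  ∫ q : Fin M → E3, ‖hat ψ (pt k q)‖ ^ 2

/-- The momentum density of the `N = M + 1` fermions:
`N ∫ |ψ̂(k₀, k, k₂, …, k_N)|² dk₀ dk₂ ⋯ dk_N`, where `q = (k₀, k₂, …, k_N)`. -/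
def densityDown {M : ℕ} (ψ : L2 (M + 1)) (k : E3) : ℝ :=
  ((M : ℝ) + 1) * ∫ q : Fin (M + 1) → E3,
    ‖hat ψ (pt (q 0) (Fin.cons k (Fin.tail q) : Fin (M + 1) → E3))‖ ^ 2

/-- The contact `C = (2m/(m+1))² N ‖ξ‖²`, for `N = M + 1` fermions. -/
def contact {M : ℕ} (m : ℝ) (ξ : L2 M) : ℝ :=
  (2 * m / (m + 1)) ^ 2 * ((M : ℝ) + 1) * ‖ξ‖ ^ 2

/-- `p_↑ = (2m/(m+1)) ‖ξ‖⁻² ∫ k₁ |ξ̂(k₁, …, k_N)|² dk₁ ⋯ dk_N`; the first variable of `ξ`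
has index `0` here. -/
def momentumUp {M : ℕ} (m : ℝ) (ξ : L2 M) : E3 :=
  (2 * m / (m + 1) * (‖ξ‖ ^ 2)⁻¹) • ∫ k : Conf M, ‖hat ξ k‖ ^ 2 • k 0

/-- `p_↓ = p_↑ / m`. -/
def momentumDown {M : ℕ} (m : ℝ) (ξ : L2 M) : E3 := (1 / m) • momentumUp m ξ

/-- `k² n_↑(k) - C / |k - p_↑|²`. -/
def tailUp {M : ℕ} (m : ℝ) (ψ : L2 (M + 1)) (ξ : L2 M) (k : E3) : ℝ :=
  ‖k‖ ^ 2 * densityUp ψ k - contact m ξ / ‖k - momentumUp m ξ‖ ^ 2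

/-- `k² n_↓(k) - C / |k - p_↓|²`. -/
def tailDown {M : ℕ} (m : ℝ) (ψ : L2 (M + 1)) (ξ : L2 M) (k : E3) : ℝ :=
  ‖k‖ ^ 2 * densityDown ψ k - contact m ξ / ‖k - momentumDown m ξ‖ ^ 2

end PointInteraction

end

noncomputable section

namespace PointInteraction

/-! ### Volume and coordinates on configuration space. -/

section

/-! Write X, Φ, Ψ for the transforms of ξ, φ, ψ, T for the kinetic symbol, G = (T+μ)⁻¹, and S = ∑ᵢ
Sᵢ for the signed sum of X over the pairs (`chargeSum`), so that Ψ = Φ + G S. The kinetic energy of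
ψ can diverge only through the diagonal terms G²|Sᵢ|²: Φ is in H², and products of different Sᵢ are
controlled by a Schur test (`integrable_green_chargeTerm_mul`).

The marginal of a diagonal term in the momentum x of one partner of the pair, times |x|², is a
constant times the |X(w)|²-average of |x|²/(|x−q|²+b²)², where q is a fixed fraction of the pair
momentum and the width b depends on w. This kernel differs from |x−2q|⁻² by an integrable function
with an elementary integral (`integral_diagKernel`). Replacing |x−2q|⁻² by |x−p|⁻² costs a function
of integral zero (`integral_shiftKernel`) and an odd term linear in 2q−p. Since p is the average of
2q, the odd term averages out for each fixed x (`integral_tailKernel_section`). The L¹ norms of the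
kernels grow at most quadratically in w, and ξ ∈ H¹ absorbs this.

For the value, `energy_identity` rewrites the regularised energy density pointwise; its diagonal
remainder and the tail integrals add up to −ℒ (`tailWeight_identity`). The boundary condition,
paired with ξ (`inner_trace`, `integral_conj_gammaHat_mul`), gives B = ∫ Φ̄ S = N(α/a)‖ξ‖² + N∫ℒ|X|²
− O, where a = (m+1)/(2m) and O is the integral of G against the off-diagonal part of |S|². With A =
∫ ((T+μ)|Φ|² − μ|Ψ|²), the tails integrate to A + 2B + O − N∫ℒ|X|² = A + B + N(α/a)‖ξ‖², while
(T+μ)G = 1 gives ⟨ψ|Hψ⟩ = A + B. The difference is the contact term. -/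

theorem measurePreserving_uncurry {ι κ : Type*} [Fintype ι] [Fintype κ] :
    MeasurePreserving (fun (f : ι → κ → ℝ) (p : ι × κ) => f p.1 p.2) := by
  refine ⟨by fun_prop, ?_⟩
  refine (Measure.pi_eq fun s hs => ?_).symm
  rw [Measure.map_apply (by fun_prop) (MeasurableSet.univ_pi hs)]
  have : (fun (f : ι → κ → ℝ) (p : ι × κ) => f p.1 p.2) ⁻¹' (Set.univ.pi s) =
      Set.univ.pi fun i => Set.univ.pi fun j => s (i, j) := by
    ext f
    simp [Set.mem_pi]
  rw [this, volume_pi_pi]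
  simp_rw [volume_pi_pi]
  rw [Fintype.prod_prod_type]

/-- The volume of `Conf M` is the product of the volumes of its factors. -/
theorem measurePreserving_toLp_conf (M : ℕ) :
    MeasurePreserving (WithLp.toLp 2 : (Fin (M + 1) → E3) → Conf M) := by
  have h₁ : MeasurePreserving
      (fun (f : Fin (M + 1) → E3) (i : Fin (M + 1)) => (f i).ofLp) :=
    volume_preserving_pi fun _ => PiLp.volume_preserving_ofLp (Fin 3)
  have h₂ := measurePreserving_uncurry (ι := Fin (M + 1)) (κ := Fin 3)
  have h₃ := PiLp.volume_preserving_toLp (Fin (M + 1) × Fin 3)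
  -- The volume of `Conf M` comes from its inner product, so any orthonormal basis transports it to
  -- Euclidean space; with the concatenated coordinate basis the composite is `toLp`.
  let b : OrthonormalBasis (Fin (M + 1) × Fin 3) ℝ (Conf M) :=
    (Pi.orthonormalBasis fun _ : Fin (M + 1) => EuclideanSpace.basisFun (Fin 3) ℝ).reindex
      (Equiv.sigmaEquivProd _ _)
  have h₄ := b.measurePreserving_repr_symm
  have key := h₄.comp (h₃.comp (h₂.comp h₁))
  have heq : (WithLp.toLp 2 : (Fin (M + 1) → E3) → Conf M) = b.repr.symm ∘
      WithLp.toLp 2 ∘ (fun f (p : Fin (M + 1) × Fin 3) => f p.1 p.2) ∘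
      fun (f : Fin (M + 1) → E3) i => (f i).ofLp := by
    funext f
    refine b.repr.injective ?_
    rw [Function.comp_apply, LinearIsometryEquiv.apply_symm_apply]
    ext p
    simp [b, OrthonormalBasis.repr_reindex]
  exact heq ▸ key

/-- The point `(x₀, x)` as a measurable equivalence. -/
def ptEquiv (M : ℕ) : E3 × (Fin M → E3) ≃ᵐ Conf M :=
  (MeasurableEquiv.piFinSuccAbove (fun _ : Fin (M + 1) => E3) 0).symm.trans
    (MeasurableEquiv.toLp 2 (Fin (M + 1) → E3))

theorem ptEquiv_apply {M : ℕ} (p : E3 × (Fin M → E3)) : ptEquiv M p = pt p.1 p.2 := by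
  simp [ptEquiv, pt, MeasurableEquiv.piFinSuccAbove, Fin.insertNthEquiv]

theorem measurePreserving_ptEquiv (M : ℕ) : MeasurePreserving (ptEquiv M) :=
  ((volume_preserving_piFinSuccAbove (fun _ : Fin (M + 1) => E3) 0).symm).trans
    (measurePreserving_toLp_conf M)

theorem measurePreserving_pt (M : ℕ) :
    MeasurePreserving (fun p : E3 × (Fin M → E3) => pt p.1 p.2) := by
  convert measurePreserving_ptEquiv M using 1
  ext1 p
  exact (ptEquiv_apply p).symm

@[simp] theorem pt_zero {M : ℕ} (x₀ : E3) (x : Fin M → E3) : pt x₀ x 0 = x₀ := rfl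

@[simp] theorem pt_succ {M : ℕ} (x₀ : E3) (x : Fin M → E3) (i : Fin M) : pt x₀ x i.succ = x i := rfl

@[simp] theorem rest_pt {M : ℕ} (x₀ : E3) (x : Fin M → E3) : rest (pt x₀ x) = x := rfl

@[simp] theorem pt_rest {M : ℕ} (x : Conf M) : pt (x 0) (rest x) = x := by
  ext i : 1
  refine Fin.cases ?_ (fun i => ?_) i <;> rfl

theorem ptEquiv_symm_apply {M : ℕ} (x : Conf M) : (ptEquiv M).symm x = (x 0, rest x) := by
  rw [MeasurableEquiv.symm_apply_eq, ptEquiv_apply, pt_rest]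

end

/-! ### The unitary Fourier transform: Plancherel, Sobolev weights, Laplacians, permutations. -/

section

variable {M : ℕ}

theorem finrank_conf (M : ℕ) : Module.finrank ℝ (Conf M) = 3 * (M + 1) := by
  rw [(WithLp.linearEquiv 2 ℝ (Fin (M + 1) → E3)).finrank_eq, Module.finrank_pi_fintype]
  simp [mul_comm]

theorem measurable_hat (u : L2 M) : Measurable (hat u) := by
  have h : Measurable (𝓕 u : L2 M) := (Lp.stronglyMeasurable _).measurable
  exact (h.comp (measurable_const_smul ((2 * Real.pi)⁻¹ : ℝ))).const_mul _

/-- Almost everywhere statements about `𝓕 u` carry over to `hat u`. -/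
theorem ae_comp_scale {p : Conf M → Prop} (h : ∀ᵐ k, p k) :
    ∀ᵐ k : Conf M, p ((2 * Real.pi)⁻¹ • k) :=
  (Measure.quasiMeasurePreserving_smul volume
    (inv_ne_zero (mul_ne_zero two_ne_zero Real.pi_ne_zero))).ae h

theorem hat_add (u v : L2 M) : hat (u + v) =ᵐ[volume] fun k => hat u k + hat v k := by
  have h : (𝓕 (u + v) : L2 M) = 𝓕 u + 𝓕 v := FourierAdd.fourier_add u v
  filter_upwards [ae_comp_scale (Lp.coeFn_add (𝓕 u : L2 M) (𝓕 v))] with k hk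
  simp only [hat, h, hk, Pi.add_apply, mul_add]

theorem hat_smul (c : ℂ) (u : L2 M) : hat (c • u) =ᵐ[volume] fun k => c * hat u k := by
  have h : (𝓕 (c • u) : L2 M) = c • 𝓕 u := FourierSMul.fourier_smul c u
  filter_upwards [ae_comp_scale (Lp.coeFn_smul c (𝓕 u : L2 M))] with k hk
  simp only [hat, h, hk, Pi.smul_apply, smul_eq_mul]
  ring

theorem hat_sub (u v : L2 M) : hat (u - v) =ᵐ[volume] fun k => hat u k - hat v k := by
  have h := hat_add u ((-1 : ℂ) • v)
  have h' := hat_smul (-1 : ℂ) v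
  rw [neg_one_smul, ← sub_eq_add_neg] at h
  rw [neg_one_smul] at h'
  filter_upwards [h, h'] with k hk hk'
  rw [hk, hk']; ring

/-- Plancherel for `𝓕`: the squared prefactor of `hat` cancels the Jacobian of the dilation by
(2π)⁻¹. -/
theorem inner_eq_integral (u v : L2 M) :
    inner ℂ u v = ∫ k, (starRingEnd ℂ) (hat u k) * hat v k := by
  have h₁ : inner ℂ (𝓕 u : L2 M) (𝓕 v) = inner ℂ u v := Lp.inner_fourier_eq u v
  rw [← h₁, MeasureTheory.L2.inner_def]
  have h₂ := Measure.integral_comp_smul (volume : Measure (Conf M))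
    (fun k => (starRingEnd ℂ) ((𝓕 u : L2 M) k) * (𝓕 v : L2 M) k) ((2 * Real.pi)⁻¹)
  have hp : (0 : ℝ) < 2 * Real.pi := by positivity
  have h₃ : ∀ k : Conf M, (starRingEnd ℂ) (hat u k) * hat v k =
      (((2 * Real.pi) ^ (-(3 * ((M : ℝ) + 1))) : ℝ) : ℂ) *
        ((starRingEnd ℂ) ((𝓕 u : L2 M) ((2 * Real.pi)⁻¹ • k)) *
          (𝓕 v : L2 M) ((2 * Real.pi)⁻¹ • k)) := by
    intro k
    have : (-(3 * ((M : ℝ) + 1))) = -(3 * ((M : ℝ) + 1)) / 2 + -(3 * ((M : ℝ) + 1)) / 2 := by ring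
    rw [this, Real.rpow_add hp]
    simp only [hat, map_mul, Complex.conj_ofReal, Complex.ofReal_mul]
    ring
  simp_rw [h₃]
  rw [integral_const_mul, h₂, finrank_conf, Complex.real_smul, ← mul_assoc, ← Complex.ofReal_mul]
  have : (2 * Real.pi) ^ (-(3 * ((M : ℝ) + 1))) * |(((2 * Real.pi)⁻¹ ^ (3 * (M + 1)))⁻¹)| = 1 := by
    rw [abs_of_pos (by positivity), inv_pow, inv_inv, ← Real.rpow_natCast, ← Real.rpow_add hp]
    push_cast
    simp
  rw [this]
  simp [RCLike.inner_apply, mul_comm]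

theorem memLp_comp_scale {f : Conf M → ℂ} (hf : MemLp f 2) :
    MemLp (fun k => f ((2 * Real.pi)⁻¹ • k)) 2 := by
  have hp : (2 * Real.pi)⁻¹ ≠ 0 := by positivity
  have hm := Measure.map_addHaar_smul (volume : Measure (Conf M)) hp
  have h2 : MemLp f 2 (Measure.map ((2 * Real.pi)⁻¹ • ·) (volume : Measure (Conf M))) := by
    rw [hm]
    exact hf.smul_measure ENNReal.ofReal_ne_top
  exact h2.comp_of_map (measurable_const_smul _).aemeasurable

theorem memLp_hat (u : L2 M) : MemLp (hat u) 2 :=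
  (memLp_comp_scale (Lp.memLp (𝓕 u : L2 M))).const_mul _

theorem integral_norm_sq_hat (u : L2 M) : ∫ k, ‖hat u k‖ ^ 2 = ‖u‖ ^ 2 := by
  have h := inner_eq_integral u u
  rw [inner_self_eq_norm_sq_to_K] at h
  have h₂ : ∀ k, (starRingEnd ℂ) (hat u k) * hat u k = ((‖hat u k‖ ^ 2 : ℝ) : ℂ) := by
    intro k
    rw [mul_comm, Complex.mul_conj, Complex.normSq_eq_norm_sq]
  simp_rw [h₂] at h
  rw [integral_complex_ofReal] at h
  exact Complex.ofReal_injective (by simpa using h.symm)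

/-- Two `L²` functions whose distributions differ by a temperate factor differ by this factor
almost everywhere. -/
theorem ae_eq_mul_of_smulLeftCLM_eq {g : Conf M → ℂ} (hg : g.HasTemperateGrowth) {u v : L2 M}
    (h : smulLeftCLM ℂ g (u : 𝓢'(Conf M, ℂ)) = (v : 𝓢'(Conf M, ℂ))) :
    v =ᵐ[volume] fun k => g k * u k := by
  have hu : LocallyIntegrable u := (Lp.memLp u).locallyIntegrable (by norm_num)
  have hv : LocallyIntegrable v := (Lp.memLp v).locallyIntegrable (by norm_num)
  have hgu : LocallyIntegrable fun k => g k * u k := by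
    have := hu.continuous_smul (𝕜 := ℂ) (g := g) hg.1.continuous
    simpa only [Pi.smul_apply', smul_eq_mul] using this
  refine ae_eq_of_integral_contDiff_smul_eq hv hgu fun f f_smooth f_cpt => ?_
  -- Real smooth test functions of compact support decide equality almost everywhere, and as complex
  -- Schwartz functions they can be inserted into both distributions.
  have hf₁ : HasCompactSupport (Complex.ofRealCLM ∘ f) := f_cpt.comp_left rfl
  have hf₂ : ContDiff ℝ (⊤ : ℕ∞) (Complex.ofRealCLM ∘ f) := by fun_prop
  have key := congrArg (fun T : 𝓢'(Conf M, ℂ) => T (hf₁.toSchwartzMap hf₂)) h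
  simp only [smulLeftCLM_apply_apply, Lp.toTemperedDistribution_apply,
    SchwartzMap.smulLeftCLM_apply_apply hg] at key
  simp only [HasCompactSupport.toSchwartzMap_toFun, Function.comp_apply, smul_eq_mul,
    Complex.ofRealCLM_apply] at key
  simp only [Complex.real_smul]
  rw [← key]
  refine integral_congr_ae (Eventually.of_forall fun k => ?_)
  simp only
  ring

/-- `MemSobolev` puts its weight on the variable of `𝓕`, which becomes 1 + |k/2π|² after rescaling.
As 2π ≥ 1 and s ≥ 0, the weight in k exceeds it at most by the factor (2π)^s. -/
theorem memLp_hat_of_inSobolev {s : ℝ} (hs : 0 ≤ s) {u : L2 M} (h : InSobolev s u) :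
    MemLp (fun k => (((1 + ‖k‖ ^ 2) ^ (s / 2) : ℝ) : ℂ) * hat u k) 2 := by
  obtain ⟨v, hv⟩ := memSobolev_iff_exists_smulLeftCLM_fourier.1 h
  rw [Lp.fourier_toTemperedDistribution_eq] at hv
  have hae := ae_eq_mul_of_smulLeftCLM_eq (by fun_prop) hv
  have h₁ : MemLp (fun k => ((2 * Real.pi) ^ s : ℝ) • (((2 * Real.pi) ^ (-(3 * ((M : ℝ) + 1)) / 2) : ℝ) : ℂ) *
      v ((2 * Real.pi)⁻¹ • k)) 2 := (memLp_comp_scale (Lp.memLp v)).const_mul _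
  refine h₁.mono ?_ ?_
  · refine Measurable.aestronglyMeasurable ?_
    exact (Complex.measurable_ofReal.comp (by fun_prop)).mul (measurable_hat u)
  · filter_upwards [ae_comp_scale hae] with k hk
    have hp : (1 : ℝ) ≤ 2 * Real.pi := by linarith [Real.pi_gt_three]
    have h₂ : (1 + ‖k‖ ^ 2) ^ (s / 2) ≤
        (2 * Real.pi) ^ s * (1 + ‖(2 * Real.pi)⁻¹ • k‖ ^ 2) ^ (s / 2) := by
      have : (2 * Real.pi) ^ s = ((2 * Real.pi) ^ 2) ^ (s / 2) := by
        rw [← Real.rpow_natCast, ← Real.rpow_mul (by positivity)]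
        congr 1
        push_cast
        ring
      rw [this, ← Real.mul_rpow (by positivity) (by positivity)]
      refine Real.rpow_le_rpow (by positivity) ?_ (by positivity)
      have h₃ : ‖(2 * Real.pi)⁻¹ • k‖ ^ 2 = ((2 * Real.pi) ^ 2)⁻¹ * ‖k‖ ^ 2 := by
        rw [norm_smul, Real.norm_of_nonneg (by positivity), mul_pow, inv_pow]
      rw [h₃, mul_add, ← mul_assoc, mul_inv_cancel₀ (by positivity)]
      nlinarith
    rw [hk]
    simp only [hat, norm_mul, norm_smul (_ : ℝ) (_ : ℂ), Complex.norm_real]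
    rw [Real.norm_of_nonneg (by positivity : 0 ≤ (1 + ‖k‖ ^ 2) ^ (s / 2)),
      Real.norm_of_nonneg (by positivity : 0 ≤ (1 + ‖(2 * Real.pi)⁻¹ • k‖ ^ 2) ^ (s / 2)),
      Real.norm_of_nonneg (by positivity : (0 : ℝ) ≤ (2 * Real.pi) ^ s)]
    calc _ ≤ (2 * Real.pi) ^ s * (1 + ‖(2 * Real.pi)⁻¹ • k‖ ^ 2) ^ (s / 2) * _ := by gcongr
      _ = _ := by ring

theorem inner_dir (k : Conf M) (i : Fin (M + 1)) (a : Fin 3) : inner ℝ k (dir i a) = k i a := by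
  rw [PiLp.inner_apply, Finset.sum_eq_single i]
  · have : (dir i a).ofLp i = EuclideanSpace.single a 1 := by simp [dir]
    rw [this, EuclideanSpace.inner_single_right]
    simp
  · intro j _ hj
    simp [dir, hj]
  · simp

theorem hasTemperateGrowth_coord (i : Fin (M + 1)) (a : Fin 3) :
    (fun k : Conf M => ((k i a : ℝ) : ℂ)).HasTemperateGrowth := by
  have h : (fun k : Conf M => ((inner ℝ k (dir i a) : ℝ) : ℂ)).HasTemperateGrowth := by fun_prop
  simpa only [inner_dir] using h

theorem hasTemperateGrowth_norm_sq (i : Fin (M + 1)) :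
    (fun k : Conf M => ((‖k i‖ ^ 2 : ℝ) : ℂ)).HasTemperateGrowth := by
  have : (fun k : Conf M => ((‖k i‖ ^ 2 : ℝ) : ℂ)) =
      fun k => ∑ a : Fin 3, ((k i a : ℝ) : ℂ) * ((k i a : ℝ) : ℂ) := by
    funext k
    rw [EuclideanSpace.norm_sq_eq]
    simp [sq, ← Complex.ofReal_mul]
  rw [this]
  exact Function.HasTemperateGrowth.sum fun a _ =>
    (hasTemperateGrowth_coord i a).mul (hasTemperateGrowth_coord i a)

theorem fourier_particleLaplacian (i : Fin (M + 1)) (u : 𝓢'(Conf M, ℂ)) :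
    𝓕 (particleLaplacian i u) =
      smulLeftCLM ℂ (fun k => ((-(2 * Real.pi) ^ 2 * ‖k i‖ ^ 2 : ℝ) : ℂ)) (𝓕 u) := by
  have h₁ : ∀ a : Fin 3, 𝓕 (∂_{dir i a} (∂_{dir i a} u)) =
      (-(2 * Real.pi) ^ 2 : ℂ) •
        smulLeftCLM ℂ (fun k : Conf M => ((k i a : ℝ) : ℂ) * ((k i a : ℝ) : ℂ)) (𝓕 u) := by
    intro a
    rw [fourier_lineDerivOp_eq, fourier_lineDerivOp_eq]
    simp only [inner_dir]
    rw [map_smul, smulLeftCLM_smulLeftCLM_apply (hasTemperateGrowth_coord i a)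
      (hasTemperateGrowth_coord i a), smul_smul]
    congr 1
    rw [mul_mul_mul_comm, Complex.I_mul_I]
    ring
  have h₂ : 𝓕 (particleLaplacian i u) = ∑ a : Fin 3, 𝓕 (∂_{dir i a} (∂_{dir i a} u)) :=
    map_sum (fourierCLM ℂ 𝓢'(Conf M, ℂ)) _ _
  have h₃ : (fun k : Conf M => ((-(2 * Real.pi) ^ 2 * ‖k i‖ ^ 2 : ℝ) : ℂ)) =
      (-(2 * Real.pi) ^ 2 : ℂ) •
        fun k => ∑ a ∈ (Finset.univ : Finset (Fin 3)), ((k i a : ℝ) : ℂ) * ((k i a : ℝ) : ℂ) := by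
    funext k
    rw [EuclideanSpace.norm_sq_eq]
    simp [sq]
  have ht : ∀ a ∈ (Finset.univ : Finset (Fin 3)),
      (fun k : Conf M => ((k i a : ℝ) : ℂ) * ((k i a : ℝ) : ℂ)).HasTemperateGrowth :=
    fun a _ => (hasTemperateGrowth_coord i a).mul (hasTemperateGrowth_coord i a)
  rw [h₂, h₃, smulLeftCLM_smul (Function.HasTemperateGrowth.sum ht), smulLeftCLM_sum ht]
  simp only [h₁]
  rw [← Finset.smul_sum, smul_apply, sum_apply]

/-- The kinetic energy `k₀²/(2m) + ½ ∑ᵢ kᵢ²`. -/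
def kinetic (m : ℝ) (k : Conf M) : ℝ :=
  1 / (2 * m) * ‖k 0‖ ^ 2 + 1 / 2 * ∑ i, ‖rest k i‖ ^ 2

theorem fourier_freeHamiltonian (m : ℝ) (u : 𝓢'(Conf M, ℂ)) :
    𝓕 (freeHamiltonian m u) =
      smulLeftCLM ℂ (fun k => (((2 * Real.pi) ^ 2 * kinetic m k : ℝ) : ℂ)) (𝓕 u) := by
  have h₁ : 𝓕 (freeHamiltonian m u) =
      -(((1 / (2 * m) : ℝ) : ℂ) • 𝓕 (particleLaplacian 0 u))
        - ((1 / 2 : ℝ) : ℂ) • ∑ i : Fin M, 𝓕 (particleLaplacian i.succ u) := by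
    have : 𝓕 (freeHamiltonian m u) = fourierCLM ℂ 𝓢'(Conf M, ℂ) (freeHamiltonian m u) := rfl
    rw [this, freeHamiltonian, map_sub, map_neg, map_smul, map_smul, map_sum]
    rfl
  ext f
  have hk : (fun k : Conf M => (((2 * Real.pi) ^ 2 * kinetic m k : ℝ) : ℂ)) =
      -(((1 / (2 * m) : ℝ) : ℂ) • (fun k : Conf M => ((-(2 * Real.pi) ^ 2 * ‖k 0‖ ^ 2 : ℝ) : ℂ))) -
      ((1 / 2 : ℝ) : ℂ) • fun k => ∑ i ∈ (Finset.univ : Finset (Fin M)),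
        ((-(2 * Real.pi) ^ 2 * ‖k i.succ‖ ^ 2 : ℝ) : ℂ) := by
    funext k
    simp only [kinetic, rest, Pi.sub_apply, Pi.neg_apply, Pi.smul_apply, smul_eq_mul,
      Complex.ofReal_mul, ← Finset.mul_sum]
    push_cast
    ring
  have ht : ∀ i : Fin (M + 1),
      (fun k : Conf M => ((-(2 * Real.pi) ^ 2 * ‖k i‖ ^ 2 : ℝ) : ℂ)).HasTemperateGrowth := by
    intro i
    have := (Function.HasTemperateGrowth.const (E := Conf M)
      ((-(2 * Real.pi) ^ 2 : ℝ) : ℂ)).mul (hasTemperateGrowth_norm_sq i)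
    have h' : (fun k : Conf M => ((-(2 * Real.pi) ^ 2 * ‖k i‖ ^ 2 : ℝ) : ℂ)) =
        (fun _ : Conf M => ((-(2 * Real.pi) ^ 2 : ℝ) : ℂ)) * fun k => ((‖k i‖ ^ 2 : ℝ) : ℂ) := by
      funext k
      rw [Pi.mul_apply, Complex.ofReal_mul]
    rw [h']
    exact this
  have hts : ∀ i ∈ (Finset.univ : Finset (Fin M)),
      (fun k : Conf M => ((-(2 * Real.pi) ^ 2 * ‖k i.succ‖ ^ 2 : ℝ) : ℂ)).HasTemperateGrowth :=
    fun i _ => ht i.succ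
  have hg : ∀ i : Fin (M + 1), ∀ c : ℂ,
      (c • fun k : Conf M => ((-(2 * Real.pi) ^ 2 * ‖k i‖ ^ 2 : ℝ) : ℂ)).HasTemperateGrowth :=
    fun i c => (Function.HasTemperateGrowth.const c).smul (ht i)
  have hgs : (((1 / 2 : ℝ) : ℂ) • fun k : Conf M => ∑ i ∈ (Finset.univ : Finset (Fin M)),
      ((-(2 * Real.pi) ^ 2 * ‖k i.succ‖ ^ 2 : ℝ) : ℂ)).HasTemperateGrowth :=
    (Function.HasTemperateGrowth.const _).smul (Function.HasTemperateGrowth.sum hts)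
  rw [h₁, hk, smulLeftCLM_sub (hg 0 _).neg hgs,
    smulLeftCLM_neg (hg 0 _), smulLeftCLM_smul (ht 0),
    smulLeftCLM_smul (Function.HasTemperateGrowth.sum hts), smulLeftCLM_sum hts]
  simp only [fourier_particleLaplacian]
  rw [sub_apply, neg_apply, smul_apply, smul_apply, sum_apply]
  simp only [sub_apply, neg_apply, smul_apply, sum_apply]

theorem kinetic_smul (m c : ℝ) (k : Conf M) : kinetic m (c • k) = c ^ 2 * kinetic m k := by
  simp only [kinetic, rest, PiLp.smul_apply, norm_smul, mul_pow, Real.norm_eq_abs, sq_abs,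
    ← Finset.mul_sum]
  ring

theorem hasTemperateGrowth_kinetic (m : ℝ) :
    (fun k : Conf M => (((2 * Real.pi) ^ 2 * kinetic m k : ℝ) : ℂ)).HasTemperateGrowth := by
  have : (fun k : Conf M => (((2 * Real.pi) ^ 2 * kinetic m k : ℝ) : ℂ)) = fun k : Conf M =>
      (fun _ => (((2 * Real.pi) ^ 2 * (1 / (2 * m)) : ℝ) : ℂ)) k * ((‖k 0‖ ^ 2 : ℝ) : ℂ) +
      (fun _ => (((2 * Real.pi) ^ 2 * (1 / 2) : ℝ) : ℂ)) k *
        ∑ i ∈ (Finset.univ : Finset (Fin M)), ((‖k i.succ‖ ^ 2 : ℝ) : ℂ) := by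
    funext k
    simp only [kinetic, rest]
    push_cast
    ring
  rw [this]
  exact ((Function.HasTemperateGrowth.const _).mul (hasTemperateGrowth_norm_sq 0)).add
    ((Function.HasTemperateGrowth.const _).mul
      (Function.HasTemperateGrowth.sum fun i _ => hasTemperateGrowth_norm_sq i.succ))

theorem hat_freeHamiltonianL2 (m : ℝ) (φ : L2 M) (h : InSobolev 2 φ) :
    hat (freeHamiltonianL2 m φ h) =ᵐ[volume] fun k => (kinetic m k : ℂ) * hat φ k := by
  have hχ : ((freeHamiltonianL2 m φ h : L2 M) : 𝓢'(Conf M, ℂ)) = freeHamiltonian m (φ : 𝓢'(Conf M, ℂ)) :=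
    (exists_freeHamiltonian m h).choose_spec
  have h₁ := congrArg (fun T : 𝓢'(Conf M, ℂ) => 𝓕 T) hχ
  simp only [fourier_freeHamiltonian, Lp.fourier_toTemperedDistribution_eq] at h₁
  have h₂ := ae_eq_mul_of_smulLeftCLM_eq (hasTemperateGrowth_kinetic m) h₁.symm
  filter_upwards [ae_comp_scale h₂] with k hk
  rw [hat, hk, hat, kinetic_smul, ← mul_assoc ((2 * Real.pi) ^ 2), ← mul_pow,
    mul_inv_cancel₀ (by positivity)]
  push_cast
  ring

/-- The permutation of all particles that fixes the distinguished one. -/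
def extendPerm (σ : Equiv.Perm (Fin M)) : Equiv.Perm (Fin (M + 1)) :=
  Equiv.Perm.decomposeFin.symm (0, σ)

@[simp] theorem extendPerm_zero (σ : Equiv.Perm (Fin M)) : extendPerm σ 0 = 0 := by
  simp [extendPerm]

@[simp] theorem extendPerm_succ (σ : Equiv.Perm (Fin M)) (i : Fin M) :
    extendPerm σ i.succ = (σ i).succ := by
  simp [extendPerm]

/-- The permutation of the coordinates `(x₁, …, x_M)`. -/
def permConf (σ : Equiv.Perm (Fin M)) : Conf M ≃ₗᵢ[ℝ] Conf M :=
  LinearIsometryEquiv.piLpCongrLeft 2 ℝ E3 (extendPerm σ).symm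

theorem permConf_apply (σ : Equiv.Perm (Fin M)) (x : Conf M) :
    permConf σ x = pt (x 0) (fun i => rest x (σ i)) := by
  ext i : 1
  refine Fin.cases ?_ (fun i => ?_) i
  · simp [permConf, Equiv.piCongrLeft']
  · simp [permConf, Equiv.piCongrLeft', rest]

/-- Both sides are continuous in u, so Schwartz functions suffice; for these it is the pointwise
change of variables under an isometry. -/
theorem fourier_compMeasurePreserving (R : Conf M ≃ₗᵢ[ℝ] Conf M) (u : L2 M) :
    (𝓕 (Lp.compMeasurePreserving R R.measurePreserving u) : L2 M) =
      Lp.compMeasurePreserving R R.measurePreserving (𝓕 u) := by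
  have hc : Continuous fun u : L2 M => Lp.compMeasurePreserving R R.measurePreserving u :=
    (Lp.compMeasurePreservingₗᵢ ℂ R R.measurePreserving).continuous
  have hF : Continuous fun u : L2 M => (𝓕 u : L2 M) := (Lp.fourierTransformₗᵢ (Conf M) ℂ).continuous
  refine DenseRange.induction_on
    (p := fun u : L2 M => (𝓕 (Lp.compMeasurePreserving R R.measurePreserving u) : L2 M) =
      Lp.compMeasurePreserving R R.measurePreserving (𝓕 u))
    (SchwartzMap.denseRange_toLpCLM (p := 2) ENNReal.ofNat_ne_top) u
    (isClosed_eq (hF.comp hc) (hc.comp hF)) fun f => ?_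
  have h₁ : ∀ g : 𝓢(Conf M, ℂ), Lp.compMeasurePreserving R R.measurePreserving (g.toLp 2) =
      (SchwartzMap.compCLMOfContinuousLinearEquiv ℂ R.toContinuousLinearEquiv g).toLp 2 := by
    intro g
    refine Lp.ext ?_
    refine (Lp.coeFn_compMeasurePreserving _ _).trans ?_
    refine EventuallyEq.trans ?_ (SchwartzMap.coeFn_toLp _ 2 volume).symm
    exact R.measurePreserving.quasiMeasurePreserving.ae_eq_comp (SchwartzMap.coeFn_toLp g 2 volume)
  rw [SchwartzMap.toLpCLM_apply, h₁, SchwartzMap.toLp_fourier_eq, SchwartzMap.toLp_fourier_eq, h₁]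
  congr 1
  ext x
  simp only [SchwartzMap.fourier_coe]
  exact Real.fourier_comp_linearIsometry R f x

theorem hat_antisymm {u : L2 M} (h : IsAntisymm u) (σ : Equiv.Perm (Fin M)) :
    ∀ᵐ k : Conf M, hat u (permConf σ k) = ((Equiv.Perm.sign σ : ℤ) : ℂ) * hat u k := by
  set R := permConf σ
  have h₁ : Lp.compMeasurePreserving R R.measurePreserving u =
      ((Equiv.Perm.sign σ : ℤ) : ℂ) • u := by
    refine Lp.ext ?_
    refine (Lp.coeFn_compMeasurePreserving _ _).trans ?_
    filter_upwards [h σ, Lp.coeFn_smul ((Equiv.Perm.sign σ : ℤ) : ℂ) u] with x hx hx'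
    rw [hx', Function.comp_apply, permConf_apply, hx]
    rfl
  have h₂ := fourier_compMeasurePreserving R u
  rw [h₁] at h₂
  have h₃ : hat (((Equiv.Perm.sign σ : ℤ) : ℂ) • u) =ᵐ[volume] fun k => hat u (R k) := by
    have := (Lp.coeFn_compMeasurePreserving (𝓕 u : L2 M) R.measurePreserving)
    rw [← h₂] at this
    filter_upwards [ae_comp_scale this] with k hk
    rw [hat, hk, Function.comp_apply, hat, map_smul]
  filter_upwards [h₃, hat_smul ((Equiv.Perm.sign σ : ℤ) : ℂ) u] with k hk hk'
  rw [← hk, hk']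

end

/-! ### Explicit kernels on ℝ³ and their integrals. -/

section

/-- `f` is integrable with integral `a`. -/
def HasInt {α E : Type*} [MeasurableSpace α] [NormedAddCommGroup E] [NormedSpace ℝ E]
    (f : α → E) (μ : Measure α) (a : E) : Prop :=
  Integrable f μ ∧ ∫ x, f x ∂μ = a

namespace HasInt

variable {α β E : Type*} [MeasurableSpace α] [MeasurableSpace β] [NormedAddCommGroup E]
  [NormedSpace ℝ E] {f g : α → E} {μ : Measure α} {ν : Measure β} {a b : E}

theorem add (hf : HasInt f μ a) (hg : HasInt g μ b) : HasInt (fun x => f x + g x) μ (a + b) :=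
  ⟨hf.1.add hg.1, by rw [integral_add hf.1 hg.1, hf.2, hg.2]⟩

theorem sub (hf : HasInt f μ a) (hg : HasInt g μ b) : HasInt (fun x => f x - g x) μ (a - b) :=
  ⟨hf.1.sub hg.1, by rw [integral_sub hf.1 hg.1, hf.2, hg.2]⟩

theorem const_mul {f : α → ℝ} {a : ℝ} (c : ℝ) (hf : HasInt f μ a) :
    HasInt (fun x => c * f x) μ (c * a) :=
  ⟨hf.1.const_mul c, by rw [integral_const_mul, hf.2]⟩

theorem sum {ι : Type*} (s : Finset ι) {f : ι → α → E} {a : ι → E}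
    (h : ∀ i ∈ s, HasInt (f i) μ (a i)) : HasInt (fun x => ∑ i ∈ s, f i x) μ (∑ i ∈ s, a i) :=
  ⟨integrable_finsetSum s fun i hi => (h i hi).1, by
    rw [integral_finsetSum s fun i hi => (h i hi).1]
    exact Finset.sum_congr rfl fun i hi => (h i hi).2⟩

theorem congr (hf : HasInt f μ a) (h : f =ᵐ[μ] g) : HasInt g μ a :=
  ⟨hf.1.congr h, by rw [← integral_congr_ae h, hf.2]⟩

theorem congr_val (hf : HasInt f μ a) (h : a = b) : HasInt f μ b := h ▸ hf

theorem unique (hf : HasInt f μ a) (hf' : HasInt f μ b) : a = b := hf.2.symm.trans hf'.2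

theorem comp {F : β → E} {T : α → β} (hF : HasInt F ν a) (hT : MeasurePreserving T μ ν)
    (he : MeasurableEmbedding T) : HasInt (fun x => F (T x)) μ a :=
  ⟨(hT.integrable_comp_emb he).2 hF.1, by rw [hT.integral_comp he, hF.2]⟩

theorem comp_iff {F : β → E} {T : α → β} (hT : MeasurePreserving T μ ν)
    (he : MeasurableEmbedding T) : HasInt (fun x => F (T x)) μ a ↔ HasInt F ν a := by
  refine ⟨fun h => ⟨(hT.integrable_comp_emb he).1 h.1, ?_⟩, fun h => h.comp hT he⟩
  rw [← hT.integral_comp he, h.2]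

theorem comp_sub_right {f : E3 → E} (hf : HasInt f volume a) (u : E3) :
    HasInt (fun k => f (k - u)) volume a :=
  hf.comp (measurePreserving_sub_right volume u) (measurableEmbedding_subRight u)

theorem comp_add_right {f : E3 → E} (hf : HasInt f volume a) (u : E3) :
    HasInt (fun k => f (k + u)) volume a :=
  hf.comp (measurePreserving_add_right volume u) (measurableEmbedding_addRight u)

theorem comp_neg {f : E3 → E} (hf : HasInt f volume a) : HasInt (fun k => f (-k)) volume a :=
  hf.comp (Measure.measurePreserving_neg volume) (MeasurableEquiv.neg E3).measurableEmbedding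

end HasInt

theorem integral_radial (f : ℝ → ℝ) :
    ∫ k : E3, f ‖k‖ = 4 * Real.pi * ∫ r in Set.Ioi (0 : ℝ), r ^ 2 * f r := by
  rw [integral_fun_norm_addHaar, finrank_euclideanSpace, Fintype.card_fin, Measure.real,
    EuclideanSpace.volume_ball_fin_three]
  simp only [nsmul_eq_mul, smul_eq_mul, ENNReal.toReal_mul]
  rw [ENNReal.toReal_ofReal (by positivity), ENNReal.toReal_pow, ENNReal.toReal_ofReal one_pos.le]
  push_cast
  ring_nf

theorem integrable_radial_iff (f : ℝ → ℝ) :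
    Integrable (fun k : E3 => f ‖k‖) ↔ IntegrableOn (fun r : ℝ => r ^ 2 * f r) (Set.Ioi 0) := by
  rw [integrable_fun_norm_addHaar, finrank_euclideanSpace, Fintype.card_fin]
  simp only [smul_eq_mul]

/-- Because the radial density is nonnegative, a convergent antiderivative yields integrability
together with the value. -/
theorem radial_of_hasDerivAt {f g g' : ℝ → ℝ} {l : ℝ}
    (hf : ∀ r ∈ Set.Ioi (0 : ℝ), r ^ 2 * f r = g' r) (hg : ∀ r, HasDerivAt g (g' r) r)
    (hpos : ∀ r, 0 ≤ g' r) (hl : Tendsto g atTop (𝓝 l)) :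
    Integrable (fun k : E3 => f ‖k‖) ∧ ∫ k : E3, f ‖k‖ = 4 * Real.pi * (l - g 0) := by
  rw [integrable_radial_iff, integral_radial, integrableOn_congr_fun hf measurableSet_Ioi,
    setIntegral_congr_fun measurableSet_Ioi hf]
  exact ⟨integrableOn_Ioi_deriv_of_nonneg' (fun r _ => hg r) (fun r _ => hpos r) hl,
    by rw [integral_Ioi_of_hasDerivAt_of_nonneg' (fun r _ => hg r) (fun r _ => hpos r) hl]⟩

theorem tendsto_arctan_div {b : ℝ} (hb : 0 < b) :
    Tendsto (fun r : ℝ => Real.arctan (r / b)) atTop (𝓝 (Real.pi / 2)) :=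
  (Real.tendsto_arctan_atTop.mono_right nhdsWithin_le_nhds).comp
    (tendsto_id.atTop_div_const hb)

theorem hasDerivAt_arctan_div {b : ℝ} (hb : 0 < b) (r : ℝ) :
    HasDerivAt (fun r : ℝ => Real.arctan (r / b) / b) (r ^ 2 + b ^ 2)⁻¹ r := by
  have h := (((hasDerivAt_id r).div_const b).arctan).div_const b
  refine h.congr_deriv ?_
  simp only [id]
  have : r ^ 2 + b ^ 2 ≠ 0 := by positivity
  field_simp
  ring

/-- The Jacobian r² removes the singularity and leaves the derivative of an arctangent. All kernels
below are bounded by, or reduced to, this one and the next. -/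
theorem singular_kernel {b : ℝ} (hb : 0 < b) :
    HasInt (fun k : E3 => (‖k‖ ^ 2 * (‖k‖ ^ 2 + b ^ 2))⁻¹) volume (2 * Real.pi ^ 2 / b) := by
  have h := radial_of_hasDerivAt (f := fun r => (r ^ 2 * (r ^ 2 + b ^ 2))⁻¹)
    (fun r (hr : 0 < r) => by field_simp) (hasDerivAt_arctan_div hb) (fun r => by positivity)
    ((tendsto_arctan_div hb).div_const b)
  refine ⟨h.1, h.2.trans ?_⟩
  simp
  ring

theorem square_kernel {b : ℝ} (hb : 0 < b) :
    HasInt (fun k : E3 => ((‖k‖ ^ 2 + b ^ 2) ^ 2)⁻¹) volume (Real.pi ^ 2 / b) := by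
  have hd : ∀ r : ℝ, HasDerivAt
      (fun r : ℝ => (Real.arctan (r / b) / b - r / (r ^ 2 + b ^ 2)) / 2)
      (r ^ 2 * ((r ^ 2 + b ^ 2) ^ 2)⁻¹) r := by
    intro r
    have h0 : r ^ 2 + b ^ 2 ≠ 0 := by positivity
    have h := ((hasDerivAt_arctan_div hb r).sub
      ((hasDerivAt_id r).div (((hasDerivAt_id r).pow 2).add_const (b ^ 2)) h0)).div_const 2
    refine h.congr_deriv ?_
    simp only [id, Pi.pow_apply]
    field_simp
    ring
  have hl : Tendsto (fun r : ℝ => (Real.arctan (r / b) / b - r / (r ^ 2 + b ^ 2)) / 2) atTop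
      (𝓝 ((Real.pi / 2 / b - 0) / 2)) := by
    refine (((tendsto_arctan_div hb).div_const b).sub ?_).div_const 2
    refine squeeze_zero' (g := fun r : ℝ => r⁻¹) ?_ ?_ tendsto_inv_atTop_zero
    · filter_upwards [eventually_gt_atTop 0] with r hr
      positivity
    · filter_upwards [eventually_gt_atTop 0] with r hr
      rw [div_le_iff₀ (by positivity)]
      have : r⁻¹ * (r ^ 2 + b ^ 2) = r + b ^ 2 * r⁻¹ := by field_simp
      rw [this]
      have : 0 < b ^ 2 * r⁻¹ := by positivity
      linarith
  have h := radial_of_hasDerivAt (f := fun r => ((r ^ 2 + b ^ 2) ^ 2)⁻¹)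
    (fun r _ => rfl) hd (fun r => by positivity) hl
  refine ⟨h.1, h.2.trans ?_⟩
  simp
  ring

theorem ae_ne (u : E3) : ∀ᵐ k : E3, k ≠ u := by
  simp [ae_iff, measure_singleton]

/-- `1/|k-u|² - 1/|k|²` up to its leading order for large `k`, which is odd. -/
def shiftKernel (u k : E3) : ℝ :=
  (‖k - u‖ ^ 2)⁻¹ - (‖k‖ ^ 2)⁻¹ - 2 * inner ℝ k u / (‖k‖ ^ 2 + 1) ^ 2

/-- Read K = |k|², U = |u|², s = k·u, and let A, B be the two denominators. Once the first-order
term is removed, the numerator over A²B is of second order in u, and Cauchy–Schwarz bounds it by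
U(8A+B). The inequality 8A ≤ 4B + 4A²/B separates the mixed term 8/(AB) into A⁻² and B⁻². -/
theorem abs_resolvent_remainder_le {K U s : ℝ} (hK : 0 ≤ K) (hU : 0 ≤ U) (hs : s ^ 2 ≤ K * U)
    (hB : 0 ≤ K - 2 * s + U) :
    |(K - 2 * s + U + 1)⁻¹ - (K + 1)⁻¹ - 2 * s / (K + 1) ^ 2| ≤
      U * (5 * ((K + 1) ^ 2)⁻¹ + 4 * ((K - 2 * s + U + 1) ^ 2)⁻¹) := by
  set A := K + 1 with hA
  set B := K - 2 * s + U + 1 with hBd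
  have hA0 : 0 < A := by positivity
  have hB0 : 0 < B := by linarith
  have h₁ : B⁻¹ - A⁻¹ - 2 * s / A ^ 2 = (4 * s ^ 2 - U * A - 2 * s * U) / (A ^ 2 * B) := by
    have : A - B = 2 * s - U := by rw [hA, hBd]; ring
    have h2 : A = B + 2 * s - U := by linarith
    field_simp
    rw [h2]
    ring
  have habs : 2 * |s| ≤ 3 * A + B := by
    rcases le_total s 0 with h | h
    · rw [abs_of_nonpos h]
      linarith
    · have : 4 * s ≤ 4 * K + U :=
        abs_le_of_sq_le_sq' (by nlinarith [sq_nonneg (4 * K - U)]) (by positivity) |>.2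
      rw [abs_of_nonneg h]
      linarith
  have h₂ : |4 * s ^ 2 - U * A - 2 * s * U| ≤ U * (8 * A + B) := by
    have e1 : 4 * s ^ 2 ≤ 4 * A * U := by nlinarith
    have e2 : |2 * s * U| ≤ U * (3 * A + B) := by
      rw [abs_mul, abs_mul, abs_of_nonneg hU, abs_two]
      nlinarith
    rw [abs_le] at e2 ⊢
    constructor <;> nlinarith [sq_nonneg s]
  rw [h₁, abs_div, abs_of_pos (show 0 < A ^ 2 * B by positivity), div_le_iff₀ (by positivity)]
  refine h₂.trans ?_
  rw [mul_assoc]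
  refine mul_le_mul_of_nonneg_left ?_ hU
  have : (5 * (A ^ 2)⁻¹ + 4 * (B ^ 2)⁻¹) * (A ^ 2 * B) = 5 * B + 4 * A ^ 2 / B := by
    field_simp
  rw [this]
  have : 8 * A ≤ 4 * B + 4 * A ^ 2 / B := by
    rw [← sub_nonneg]
    have : 4 * B + 4 * A ^ 2 / B - 8 * A = 4 * (A - B) ^ 2 / B := by field_simp; ring
    rw [this]; positivity
  linarith

theorem norm_sub_sq_E3 (k u : E3) : ‖k - u‖ ^ 2 = ‖k‖ ^ 2 - 2 * inner ℝ k u + ‖u‖ ^ 2 :=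
  norm_sub_sq_real k u

theorem norm_add_sq_E3 (k u : E3) : ‖k + u‖ ^ 2 = ‖k‖ ^ 2 + 2 * inner ℝ k u + ‖u‖ ^ 2 :=
  norm_add_sq_real k u

theorem inner_sq_le (k u : E3) : inner ℝ k u ^ 2 ≤ ‖k‖ ^ 2 * ‖u‖ ^ 2 := by
  have h := abs_real_inner_le_norm k u
  rw [← mul_pow, ← sq_abs]
  exact pow_le_pow_left₀ (abs_nonneg _) h 2

/-- The splitting 1/x² = 1/(x²(x²+1)) + 1/(x²+1) separates the local singularities, which are
integrable as they stand, from the tails, where the cancellation of `abs_resolvent_remainder_le` is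
needed. -/
theorem abs_shiftKernel_le (u : E3) {k : E3} (h0 : k ≠ 0) (hu : k ≠ u) :
    |shiftKernel u k| ≤ (‖k - u‖ ^ 2 * (‖k - u‖ ^ 2 + 1))⁻¹ + (‖k‖ ^ 2 * (‖k‖ ^ 2 + 1))⁻¹ +
      ‖u‖ ^ 2 * (5 * ((‖k‖ ^ 2 + 1) ^ 2)⁻¹ + 4 * ((‖k - u‖ ^ 2 + 1) ^ 2)⁻¹) := by
  have hk : 0 < ‖k‖ := norm_pos_iff.2 h0
  have hku : 0 < ‖k - u‖ := norm_pos_iff.2 (sub_ne_zero.2 hu)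
  have hd : ∀ x : ℝ, 0 < x → (x ^ 2)⁻¹ = (x ^ 2 * (x ^ 2 + 1))⁻¹ + (x ^ 2 + 1)⁻¹ := by
    intro x hx
    field_simp
    ring
  have hr := abs_resolvent_remainder_le (sq_nonneg ‖k‖) (sq_nonneg ‖u‖) (inner_sq_le k u)
    (by rw [← norm_sub_sq_E3]; positivity)
  rw [← norm_sub_sq_E3] at hr
  have : shiftKernel u k = (‖k - u‖ ^ 2 * (‖k - u‖ ^ 2 + 1))⁻¹ - (‖k‖ ^ 2 * (‖k‖ ^ 2 + 1))⁻¹ +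
      ((‖k - u‖ ^ 2 + 1)⁻¹ - (‖k‖ ^ 2 + 1)⁻¹ - 2 * inner ℝ k u / (‖k‖ ^ 2 + 1) ^ 2) := by
    rw [shiftKernel, hd _ hk, hd _ hku]
    ring
  rw [this]
  have p₁ : 0 ≤ (‖k - u‖ ^ 2 * (‖k - u‖ ^ 2 + 1))⁻¹ := by positivity
  have p₂ : 0 ≤ (‖k‖ ^ 2 * (‖k‖ ^ 2 + 1))⁻¹ := by positivity
  rw [abs_le] at hr ⊢
  constructor <;> linarith [hr.1, hr.2]

theorem measurable_shiftKernel : Measurable fun p : E3 × E3 => shiftKernel p.1 p.2 := by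
  unfold shiftKernel
  fun_prop

/-- The bound is quadratic in the shift, which the weight 1 + |w|² of an H¹ charge can absorb. -/
theorem shiftKernel_integrable_and_bound (u : E3) :
    Integrable (shiftKernel u) ∧ ∫ k, |shiftKernel u k| ≤ Real.pi ^ 2 * (4 + 9 * ‖u‖ ^ 2) := by
  have s₀ := singular_kernel one_pos
  have t₀ := square_kernel one_pos
  simp only [one_pow, div_one] at s₀ t₀
  have hi := ((s₀.comp_sub_right u).add s₀).add
    (((t₀.const_mul 5).add ((t₀.comp_sub_right u).const_mul 4)).const_mul (‖u‖ ^ 2))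
  have hb : ∀ᵐ k : E3, |shiftKernel u k| ≤ (‖k - u‖ ^ 2 * (‖k - u‖ ^ 2 + 1))⁻¹ +
      (‖k‖ ^ 2 * (‖k‖ ^ 2 + 1))⁻¹ +
      ‖u‖ ^ 2 * (5 * ((‖k‖ ^ 2 + 1) ^ 2)⁻¹ + 4 * ((‖k - u‖ ^ 2 + 1) ^ 2)⁻¹) := by
    filter_upwards [ae_ne 0, ae_ne u] with k h0 hu using abs_shiftKernel_le u h0 hu
  have hint : Integrable (shiftKernel u) :=
    hi.1.mono' (measurable_shiftKernel.comp measurable_prodMk_left).aestronglyMeasurable hb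
  refine ⟨hint, (integral_mono_ae hint.abs hi.1 hb).trans (le_of_eq ?_)⟩
  rw [hi.2]
  ring

/-- The second difference of `1/|k|²`. -/
def secondDifference (u k : E3) : ℝ := (‖k - u‖ ^ 2)⁻¹ + (‖k + u‖ ^ 2)⁻¹ - 2 * (‖k‖ ^ 2)⁻¹

theorem secondDifference_eq (u k : E3) :
    secondDifference u k = shiftKernel u k + shiftKernel (-u) k := by
  simp only [secondDifference, shiftKernel, sub_neg_eq_add, inner_neg_right]
  ring

theorem integrable_secondDifference (u : E3) : Integrable (secondDifference u) := by
  have := (shiftKernel_integrable_and_bound u).1.add (shiftKernel_integrable_and_bound (-u)).1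
  exact this.congr (Eventually.of_forall fun k => (secondDifference_eq u k).symm)

/-- The integral of the second difference of `1/|k|²` vanishes: it is homogeneous of degree one in
the shift, and quadruples when the shift is doubled. -/
theorem integral_secondDifference (u : E3) : ∫ k, secondDifference u k = 0 := by
  have h := integrable_secondDifference u
  have h₁ : ∫ k, secondDifference ((2 : ℝ) • u) k = 4 * ∫ k, secondDifference u k := by
    have e : ∀ k, secondDifference ((2 : ℝ) • u) k =
        secondDifference u (k + u) + 2 * secondDifference u k + secondDifference u (k - u) := by
      intro k
      have e₁ : k - (2 : ℝ) • u = k - u - u := by rw [two_smul]; abel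
      have e₂ : k + (2 : ℝ) • u = k + u + u := by rw [two_smul]; abel
      simp only [secondDifference, e₁, e₂, add_sub_cancel_right, sub_add_cancel]
      ring
    have hv : HasInt (secondDifference u) volume (∫ k, secondDifference u k) := ⟨h, rfl⟩
    simp_rw [e]
    rw [(((hv.comp_add_right u).add (hv.const_mul 2)).add (hv.comp_sub_right u)).2]
    ring
  have h₂ : ∫ k, secondDifference ((2 : ℝ) • u) k = 2 * ∫ k, secondDifference u k := by
    have hs := Measure.integral_comp_smul (volume : Measure E3)
      (fun k => secondDifference ((2 : ℝ) • u) k) 2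
    -- Homogeneity of degree −2 gives 1/4, which against the Jacobian 2³ leaves the factor 2.
    have e : ∀ k, secondDifference ((2 : ℝ) • u) ((2 : ℝ) • k) = 4⁻¹ * secondDifference u k := by
      intro k
      simp only [secondDifference, ← smul_sub, ← smul_add, norm_smul, mul_pow, mul_inv]
      norm_num
      ring
    simp_rw [e] at hs
    rw [integral_const_mul, finrank_euclideanSpace, Fintype.card_fin, smul_eq_mul,
      abs_of_pos (by norm_num)] at hs
    linarith
  linarith

/-- Reflection of k shows that the shifts u and −u give equal integrals, and their sum is the
integral of the second difference. -/
theorem integral_shiftKernel (u : E3) : ∫ k, shiftKernel u k = 0 := by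
  have h₁ : ∫ k, shiftKernel (-u) k = ∫ k, shiftKernel u k := by
    rw [← integral_neg_eq_self]
    refine integral_congr_ae (Eventually.of_forall fun k => ?_)
    have : -k - -u = -(k - u) := by abel
    simp only [shiftKernel, this, norm_neg, inner_neg_neg]
  have h₂ := integral_secondDifference u
  simp_rw [secondDifference_eq] at h₂
  rw [integral_add (shiftKernel_integrable_and_bound u).1 (shiftKernel_integrable_and_bound (-u)).1,
    h₁] at h₂
  linarith

/-- The difference between `|k|²/(|k-q|²+b²)²` and its leading behaviour `1/|k-2q|²`. -/
def diagKernel (q : E3) (b : ℝ) (k : E3) : ℝ :=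
  ‖k‖ ^ 2 / (‖k - q‖ ^ 2 + b ^ 2) ^ 2 - (‖k - (2 : ℝ) • q‖ ^ 2)⁻¹

theorem measurable_diagKernel :
    Measurable fun p : E3 × ℝ × E3 => diagKernel p.1 p.2.1 p.2.2 := by
  unfold diagKernel
  fun_prop

/-- Read L = |k−q|², Q = |q|², s = (k−q)·q, so that the numerator is |k|² and Y = |k−2q|². The
product |k|²Y = (L+Q)² − 4s² has the same leading term L² as (L+b²)²; this is why 2q is the right
centre, and what remains is of order 1/(AY). A partial fraction in A and Y + b² makes this
integrable. -/
theorem abs_diagKernel_scalar_le {L Q s b c : ℝ} (hL : 0 ≤ L) (hQ : 0 ≤ Q) (hb : 0 < b)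
    (hs : s ^ 2 ≤ L * Q) (hY : 0 < L - 2 * s + Q) (hc : 0 ≤ c) (hQc : Q ≤ c * b ^ 2) :
    |(L + 2 * s + Q) / (L + b ^ 2) ^ 2 - (L - 2 * s + Q)⁻¹| ≤
      6 * (1 + c) ^ 2 * b ^ 2 * (((L - 2 * s + Q) * (L - 2 * s + Q + b ^ 2))⁻¹ +
        1 / 2 * (((L + b ^ 2) ^ 2)⁻¹ + ((L - 2 * s + Q + b ^ 2) ^ 2)⁻¹)) := by
  set Y := L - 2 * s + Q with hYd
  set A := L + b ^ 2 with hA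
  have hA0 : 0 < A := by positivity
  have hb2 : 0 < b ^ 2 := by positivity
  have h₁ : (L + 2 * s + Q) / A ^ 2 - Y⁻¹ =
      (2 * L * (Q - b ^ 2) + Q ^ 2 - b ^ 4 - 4 * s ^ 2) / (A ^ 2 * Y) := by
    field_simp
    rw [hYd, hA]
    ring
  have h₂ : |2 * L * (Q - b ^ 2) + Q ^ 2 - b ^ 4 - 4 * s ^ 2| ≤ 6 * (1 + c) ^ 2 * b ^ 2 * A := by
    have e₁ : |2 * L * (Q - b ^ 2) + Q ^ 2 - b ^ 4 - 4 * s ^ 2| ≤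
        6 * (Q + b ^ 2) * (L + Q + b ^ 2) := by
      rw [abs_le]
      constructor <;> nlinarith [mul_nonneg hL hQ, mul_nonneg hL hb2.le, mul_nonneg hQ hb2.le,
        sq_nonneg s, sq_nonneg Q, sq_nonneg (b ^ 2)]
    have e₂ : Q + b ^ 2 ≤ (1 + c) * b ^ 2 := by linarith
    have e₃ : L + Q + b ^ 2 ≤ (1 + c) * A := by nlinarith
    calc _ ≤ 6 * (Q + b ^ 2) * (L + Q + b ^ 2) := e₁
      _ ≤ 6 * ((1 + c) * b ^ 2) * ((1 + c) * A) := by gcongr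
      _ = _ := by ring
  rw [h₁, abs_div, abs_of_pos (show 0 < A ^ 2 * Y by positivity)]
  have h₃ : (A * Y)⁻¹ ≤ (Y * (Y + b ^ 2))⁻¹ + 1 / 2 * ((A ^ 2)⁻¹ + ((Y + b ^ 2) ^ 2)⁻¹) := by
    have e₁ : (A * Y)⁻¹ = b ^ 2 / A * (Y * (Y + b ^ 2))⁻¹ + A⁻¹ * (Y + b ^ 2)⁻¹ := by
      field_simp
      ring
    have e₂ : b ^ 2 / A ≤ 1 := by rw [div_le_one hA0]; linarith
    have e₃ : b ^ 2 / A * (Y * (Y + b ^ 2))⁻¹ ≤ 1 * (Y * (Y + b ^ 2))⁻¹ := by gcongr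
    rw [e₁, ← inv_pow, ← inv_pow]
    nlinarith [sq_nonneg (A⁻¹ - (Y + b ^ 2)⁻¹)]
  calc _ ≤ 6 * (1 + c) ^ 2 * b ^ 2 * A / (A ^ 2 * Y) := by gcongr
    _ = 6 * (1 + c) ^ 2 * b ^ 2 * (A * Y)⁻¹ := by field_simp
    _ ≤ _ := by gcongr

/-- With |q|² ≤ c b² the estimate is uniform in q and linear in b: the prefactor b² meets integrals
of order 1/b. -/
theorem diagKernel_integrable_and_bound (q : E3) {b c : ℝ} (hb : 0 < b) (hc : 0 ≤ c)
    (hq : ‖q‖ ^ 2 ≤ c * b ^ 2) :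
    Integrable (diagKernel q b) ∧
      ∫ k, |diagKernel q b k| ≤ 18 * (1 + c) ^ 2 * Real.pi ^ 2 * b := by
  have s₀ := singular_kernel hb
  have t₀ := square_kernel hb
  have hi := ((s₀.comp_sub_right ((2 : ℝ) • q)).add
    (((t₀.comp_sub_right q).add (t₀.comp_sub_right ((2 : ℝ) • q))).const_mul (1 / 2))).const_mul
      (6 * (1 + c) ^ 2 * b ^ 2)
  let bound : E3 → ℝ := fun k => 6 * (1 + c) ^ 2 * b ^ 2 *
    ((‖k - (2 : ℝ) • q‖ ^ 2 * (‖k - (2 : ℝ) • q‖ ^ 2 + b ^ 2))⁻¹ +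
      1 / 2 * (((‖k - q‖ ^ 2 + b ^ 2) ^ 2)⁻¹ + ((‖k - (2 : ℝ) • q‖ ^ 2 + b ^ 2) ^ 2)⁻¹))
  have hbound : ∀ᵐ k : E3, |diagKernel q b k| ≤ bound k := by
    filter_upwards [ae_ne ((2 : ℝ) • q)] with k hk
    have hY : 0 < ‖k - (2 : ℝ) • q‖ ^ 2 := by
      have : 0 < ‖k - (2 : ℝ) • q‖ := norm_pos_iff.2 (sub_ne_zero.2 hk)
      positivity
    have e₁ : ‖k - (2 : ℝ) • q‖ ^ 2 = ‖k - q‖ ^ 2 - 2 * inner ℝ (k - q) q + ‖q‖ ^ 2 := by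
      rw [← norm_sub_sq_E3]; congr 2; rw [two_smul]; abel
    have e₂ : ‖k‖ ^ 2 = ‖k - q‖ ^ 2 + 2 * inner ℝ (k - q) q + ‖q‖ ^ 2 := by
      rw [← norm_add_sq_E3]; congr 2; abel
    rw [e₁] at hY
    have := abs_diagKernel_scalar_le (sq_nonneg ‖k - q‖) (sq_nonneg ‖q‖) hb
      (inner_sq_le (k - q) q) hY hc hq
    rw [← e₁, ← e₂] at this
    exact this
  have hint : Integrable (diagKernel q b) := by
    refine hi.1.mono' (Measurable.aestronglyMeasurable ?_) hbound
    unfold diagKernel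
    fun_prop
  refine ⟨hint, (integral_mono_ae hint.abs hi.1 hbound).trans (le_of_eq ?_)⟩
  rw [hi.2]
  field_simp
  ring

/-- Symmetrising about q makes the cross term of |k+q|² cancel and turns the subtracted poles into a
second difference of integral zero plus 2/|k|². What is left combines `singular_kernel` and
`square_kernel`. -/
theorem integral_diagKernel (q : E3) {b : ℝ} (hb : 0 < b) :
    ∫ k, diagKernel q b k = -3 * Real.pi ^ 2 * b + Real.pi ^ 2 * ‖q‖ ^ 2 / b := by
  have hint : Integrable (diagKernel q b) :=
    (diagKernel_integrable_and_bound q (c := ‖q‖ ^ 2 / b ^ 2) hb (by positivity)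
      (by field_simp; rfl)).1
  have s₀ := singular_kernel hb
  have t₀ := square_kernel hb
  have h₁ : ∫ k, diagKernel q b (k + q) = ∫ k, diagKernel q b k := integral_add_right_eq_self _ _
  have h₂ : ∫ k, diagKernel q b (-k + q) = ∫ k, diagKernel q b k := by
    rw [integral_neg_eq_self (fun k => diagKernel q b (k + q)), h₁]
  have i₁ : Integrable fun k => diagKernel q b (k + q) := hint.comp_add_right q
  have i₂ : Integrable fun k => diagKernel q b (-k + q) := i₁.comp_neg
  have h₃ : ∫ k, (diagKernel q b (k + q) + diagKernel q b (-k + q)) =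
      ∫ k, (2 * (-b ^ 2 * (‖k‖ ^ 2 * (‖k‖ ^ 2 + b ^ 2))⁻¹ +
        (‖q‖ ^ 2 - b ^ 2) * ((‖k‖ ^ 2 + b ^ 2) ^ 2)⁻¹) - secondDifference q k) := by
    refine integral_congr_ae ?_
    filter_upwards [ae_ne 0] with k hk
    have hk0 : 0 < ‖k‖ := norm_pos_iff.2 hk
    have e₁ : k + q - (2 : ℝ) • q = k - q := by rw [two_smul]; abel
    have e₂ : -k + q - (2 : ℝ) • q = -(k + q) := by rw [two_smul]; abel
    have e₃ : -k + q = -(k - q) := by abel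
    simp only [diagKernel, secondDifference, e₁, e₂, add_sub_cancel_right]
    rw [e₃, norm_neg, norm_neg, norm_neg, norm_add_sq_E3 k q, norm_sub_sq_E3 k q]
    have : (‖k‖ ^ 2)⁻¹ = (‖k‖ ^ 2 + b ^ 2)⁻¹ + b ^ 2 * (‖k‖ ^ 2 * (‖k‖ ^ 2 + b ^ 2))⁻¹ := by
      field_simp
    rw [this]
    generalize (‖k‖ ^ 2 - 2 * inner ℝ k q + ‖q‖ ^ 2)⁻¹ = y₁
    generalize (‖k‖ ^ 2 + 2 * inner ℝ k q + ‖q‖ ^ 2)⁻¹ = y₂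
    field_simp
    ring
  have hv := (((s₀.const_mul (-b ^ 2)).add (t₀.const_mul (‖q‖ ^ 2 - b ^ 2))).const_mul 2).sub
    ⟨integrable_secondDifference q, integral_secondDifference q⟩
  rw [integral_add i₁ i₂, h₁, h₂, hv.2] at h₃
  have : 2 * (-b ^ 2 * (2 * Real.pi ^ 2 / b) + (‖q‖ ^ 2 - b ^ 2) * (Real.pi ^ 2 / b)) =
      2 * (-3 * Real.pi ^ 2 * b + Real.pi ^ 2 * ‖q‖ ^ 2 / b) := by
    field_simp
    ring
  linarith

end

/-! ### Pair coordinates and the antisymmetry of the charge sum. -/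

section

variable {M : ℕ}

theorem measurable_pt : Measurable fun p : E3 × (Fin M → E3) => pt p.1 p.2 :=
  (measurePreserving_pt M).measurable

theorem continuous_pt : Continuous fun p : E3 × (Fin M → E3) => pt p.1 p.2 := by
  unfold pt
  refine (PiLp.continuous_toLp 2 _).comp (continuous_pi fun i => ?_)
  refine Fin.cases ?_ (fun i => ?_) i
  · exact continuous_fst
  · exact (continuous_apply i).comp continuous_snd

theorem continuous_rest : Continuous fun x : Conf M => rest x :=
  continuous_pi fun i => by unfold rest; fun_prop

theorem continuous_removeNth (i : Fin (M + 1)) :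
    Continuous fun q : Fin (M + 1) → E3 => i.removeNth q :=
  continuous_pi fun j => continuous_apply (i.succAbove j)

/-- The point `(k₀ + kᵢ, k₁, …, kᵢ₋₁, kᵢ₊₁, …)`. -/
def pairMap (i : Fin (M + 1)) (k : Conf (M + 1)) : Conf M :=
  pt (k 0 + rest k i) (i.removeNth (rest k))

theorem pairMap_pt (i : Fin (M + 1)) (x : E3) (q : Fin (M + 1) → E3) :
    pairMap i (pt x q) = pt (x + q i) (i.removeNth q) := rfl

@[simp] theorem pairMap_zero (i : Fin (M + 1)) (k : Conf (M + 1)) :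
    pairMap i k 0 = k 0 + rest k i := rfl

@[simp] theorem rest_pairMap (i : Fin (M + 1)) (k : Conf (M + 1)) (j : Fin M) :
    rest (pairMap i k) j = rest k (i.succAbove j) := rfl

theorem continuous_pairMap (i : Fin (M + 1)) : Continuous (pairMap (M := M) i) := by
  have h₁ : Continuous fun k : Conf (M + 1) => k 0 + rest k i := by unfold rest; fun_prop
  exact continuous_pt.comp (h₁.prodMk ((continuous_removeNth i).comp continuous_rest))

/-- For fixed momentum of the distinguished particle, passing to the total momentum of a pair
preserves the volume. -/
theorem measurePreserving_pair_section (i : Fin (M + 1)) (x : E3) :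
    MeasurePreserving (fun q : Fin (M + 1) → E3 => pt (x + q i) (i.removeNth q)) := by
  have h₁ := volume_preserving_piFinSuccAbove (fun _ : Fin (M + 1) => E3) i
  have h₂ : MeasurePreserving (Prod.map (fun y : E3 => x + y) (id : (Fin M → E3) → (Fin M → E3))) :=
    (measurePreserving_add_left volume x).prod (MeasurePreserving.id volume)
  exact (measurePreserving_pt M).comp (h₂.comp h₁)

theorem measurableEmbedding_pair_section (i : Fin (M + 1)) (x : E3) :
    MeasurableEmbedding (fun q : Fin (M + 1) → E3 => pt (x + q i) (i.removeNth q)) := by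
  refine (measurePreserving_pair_section i x).measurable.measurableEmbedding fun q q' h => ?_
  have h₀ : x + q i = x + q' i := congrArg (fun w : Conf M => w 0) h
  have h₁ : i.removeNth q = i.removeNth q' := congrArg rest h
  funext j
  refine Fin.succAboveCases i ?_ (fun j => ?_) j
  · exact add_left_cancel h₀
  · exact congrFun h₁ j

theorem pt_injective {x x' : E3} {q q' : Fin M → E3} (h : pt x q = pt x' q') : x = x' ∧ q = q' :=
  ⟨congrArg (fun w : Conf M => w 0) h, congrArg rest h⟩

/-- The momentum of the distinguished particle and the momenta after pairing it with particle `i`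
as coordinates. -/
def splitMap (i : Fin (M + 1)) (k : Conf (M + 1)) : E3 × Conf M := (k 0, pairMap i k)

theorem measurePreserving_splitMap (i : Fin (M + 1)) :
    MeasurePreserving (splitMap (M := M) i) volume (volume.prod volume) := by
  have h₁ : MeasurePreserving (ptEquiv (M + 1)).symm := (measurePreserving_ptEquiv (M + 1)).symm
  have hm : Measurable (Function.uncurry fun (x : E3) (q : Fin (M + 1) → E3) =>
      pt (x + q i) (i.removeNth q)) :=
    measurable_pt.comp ((by fun_prop : Measurable fun p : E3 × (Fin (M + 1) → E3) =>
      p.1 + p.2 i).prodMk ((continuous_removeNth i).measurable.comp measurable_snd))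
  have h₂ : MeasurePreserving (fun p : E3 × (Fin (M + 1) → E3) =>
      (id p.1, pt (p.1 + p.2 i) (i.removeNth p.2))) (volume.prod volume) (volume.prod volume) :=
    MeasurePreserving.skew_product
      (g := fun (x : E3) (q : Fin (M + 1) → E3) => pt (x + q i) (i.removeNth q))
      (MeasurePreserving.id volume) hm
      (Eventually.of_forall fun x => (measurePreserving_pair_section i x).map_eq)
  have h₃ := h₂.comp h₁
  have : splitMap (M := M) i = (fun p : E3 × (Fin (M + 1) → E3) =>
      (id p.1, pt (p.1 + p.2 i) (i.removeNth p.2))) ∘ (ptEquiv (M + 1)).symm := by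
    funext k
    rw [Function.comp_apply, ptEquiv_symm_apply]
    rfl
  rw [this]
  exact h₃

theorem measurableEmbedding_splitMap (i : Fin (M + 1)) :
    MeasurableEmbedding (splitMap (M := M) i) := by
  refine (measurePreserving_splitMap i).measurable.measurableEmbedding fun k k' h => ?_
  have h₀ : k 0 = k' 0 := congrArg Prod.fst h
  have h₁ := pt_injective (congrArg Prod.snd h)
  rw [h₀] at h₁
  rw [← pt_rest k, ← pt_rest k', h₀]
  congr 1
  funext j
  refine Fin.succAboveCases i ?_ (fun j => ?_) j
  · exact add_left_cancel h₁.1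
  · exact congrFun h₁.2 j

/-- `pairMap` lowers the dimension, so it can only pull null sets back to null sets; this carries
the antisymmetry of the charge, valid almost everywhere, to all momenta. -/
theorem quasiMeasurePreserving_pairMap (i : Fin (M + 1)) :
    Measure.QuasiMeasurePreserving (pairMap (M := M) i) :=
  Measure.quasiMeasurePreserving_snd.comp (measurePreserving_splitMap i).quasiMeasurePreserving

theorem measurePreserving_permConf (σ : Equiv.Perm (Fin M)) : MeasurePreserving (permConf σ) :=
  (permConf σ).measurePreserving

theorem measurableEmbedding_permConf (σ : Equiv.Perm (Fin M)) : MeasurableEmbedding (permConf σ) :=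
  (permConf σ).toHomeomorph.measurableEmbedding

@[simp] theorem permConf_zero (σ : Equiv.Perm (Fin M)) (k : Conf M) : permConf σ k 0 = k 0 := by
  rw [permConf_apply, pt_zero]

@[simp] theorem rest_permConf (σ : Equiv.Perm (Fin M)) (k : Conf M) (i : Fin M) :
    rest (permConf σ k) i = rest k (σ i) := by
  rw [permConf_apply, rest_pt]

theorem permConf_permConf (σ τ : Equiv.Perm (Fin M)) (k : Conf M) :
    permConf σ (permConf τ k) = permConf (τ * σ) k := by
  rw [permConf_apply, permConf_apply (τ * σ)]
  simp

theorem pairMap_permConf_extendPerm (ρ : Equiv.Perm (Fin M)) (k : Conf (M + 1)) :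
    pairMap 0 (permConf (extendPerm ρ) k) = permConf ρ (pairMap 0 k) := by
  rw [permConf_apply ρ, pairMap]
  simp only [permConf_zero, rest_permConf, extendPerm_zero, pairMap_zero]
  congr 1

/-- The inverse cycle brings particle i to the first place and keeps the order of the others. Its
signature is exactly the alternating sign of the charge sum. -/
theorem pairMap_eq_permConf (i : Fin (M + 1)) (k : Conf (M + 1)) :
    pairMap i k = pairMap 0 (permConf i.cycleRange.symm k) := by
  rw [pairMap, pairMap]
  simp only [permConf_zero, rest_permConf, Fin.cycleRange_symm_zero]
  congr 1
  funext j
  simp [Fin.removeNth]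

theorem sign_cycleRange_symm (i : Fin (M + 1)) :
    ((Equiv.Perm.sign i.cycleRange.symm : ℤ) : ℂ) = (-1) ^ (i : ℕ) := by
  rw [Equiv.Perm.sign_symm, Fin.sign_cycleRange]
  simp

theorem sign_extendPerm (ρ : Equiv.Perm (Fin M)) :
    Equiv.Perm.sign (extendPerm ρ) = Equiv.Perm.sign ρ := by
  simp [extendPerm]

theorem exists_extendPerm {π : Equiv.Perm (Fin (M + 1))} (h : π 0 = 0) :
    ∃ ρ, π = extendPerm ρ := by
  refine ⟨(Equiv.Perm.decomposeFin π).2, ?_⟩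
  have h₁ : (Equiv.Perm.decomposeFin π).1 = 0 := by
    rw [← h]
    conv_rhs => rw [← Equiv.symm_apply_apply Equiv.Perm.decomposeFin π]
    rw [← Prod.mk.eta (p := Equiv.Perm.decomposeFin π), Equiv.Perm.decomposeFin_symm_apply_zero]
  rw [extendPerm, ← h₁, Prod.mk.eta, Equiv.symm_apply_apply]

/-- Antisymmetry of a function of momenta. -/
def AEAntisymm (X : Conf M → ℂ) : Prop :=
  ∀ σ : Equiv.Perm (Fin M), ∀ᵐ k : Conf M, X (permConf σ k) = ((Equiv.Perm.sign σ : ℤ) : ℂ) * X k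

/-- The summand of the charge sum that belongs to particle `i`. -/
def chargeTerm (X : Conf M → ℂ) (i : Fin (M + 1)) (k : Conf (M + 1)) : ℂ :=
  (-1) ^ (i : ℕ) * X (pairMap i k)

/-- The sum `∑ᵢ ± X(k₀ + kᵢ, …)`. -/
def chargeSum (X : Conf M → ℂ) (k : Conf (M + 1)) : ℂ := ∑ i, chargeTerm X i k

theorem chargeTerm_eq_permConf (X : Conf M → ℂ) (i : Fin (M + 1)) (k : Conf (M + 1)) :
    chargeTerm X i k = ((Equiv.Perm.sign i.cycleRange.symm : ℤ) : ℂ) *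
      chargeTerm X 0 (permConf i.cycleRange.symm k) := by
  rw [chargeTerm, chargeTerm, pairMap_eq_permConf, sign_cycleRange_symm]
  simp

theorem norm_chargeTerm (X : Conf M → ℂ) (i : Fin (M + 1)) (k : Conf (M + 1)) :
    ‖chargeTerm X i k‖ = ‖X (pairMap i k)‖ := by
  simp [chargeTerm]

theorem measurable_chargeTerm {X : Conf M → ℂ} (hX : Measurable X) (i : Fin (M + 1)) :
    Measurable (chargeTerm X i) :=
  (hX.comp (continuous_pairMap i).measurable).const_mul _

theorem sign_mul_self_complex {ι : Type*} [Fintype ι] [DecidableEq ι] (σ : Equiv.Perm ι) :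
    ((Equiv.Perm.sign σ : ℤ) : ℂ) * ((Equiv.Perm.sign σ : ℤ) : ℂ) = 1 := by
  rw [← Int.cast_mul, ← Units.val_mul, Int.units_mul_self]
  simp

/-- The cycle of i followed by τ and the cycle of τ i both send the first place to τ i. They differ
by a permutation fixing it, which acts only on the spectators and is absorbed by the antisymmetry of
X. -/
theorem AEAntisymm.chargeTerm_permConf {X : Conf M → ℂ} (hX : AEAntisymm X)
    (τ : Equiv.Perm (Fin (M + 1))) (i : Fin (M + 1)) :
    ∀ᵐ k, chargeTerm X i (permConf τ k) =
      ((Equiv.Perm.sign τ : ℤ) : ℂ) * chargeTerm X (τ i) k := by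
  have h0 : (((τ i).cycleRange.symm)⁻¹ * (τ * i.cycleRange.symm)) 0 = 0 := by
    simp [Equiv.Perm.inv_def]
  obtain ⟨ρ, hρ⟩ := exists_extendPerm h0
  have hmul : τ * i.cycleRange.symm = (τ i).cycleRange.symm * extendPerm ρ := by
    rw [← hρ, mul_inv_cancel_left]
  have hq : Measure.QuasiMeasurePreserving (pairMap (M := M) (τ i)) :=
    quasiMeasurePreserving_pairMap (τ i)
  filter_upwards [hq.ae (hX ρ)] with k hk
  rw [chargeTerm_eq_permConf, permConf_permConf, hmul, ← permConf_permConf, chargeTerm,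
    pairMap_permConf_extendPerm, ← pairMap_eq_permConf, hk, chargeTerm]
  have hs : Equiv.Perm.sign τ * Equiv.Perm.sign i.cycleRange.symm =
      Equiv.Perm.sign (τ i).cycleRange.symm * Equiv.Perm.sign ρ := by
    rw [← Equiv.Perm.sign_mul, hmul, Equiv.Perm.sign_mul, sign_extendPerm]
  have hs' : ((Equiv.Perm.sign τ : ℤ) : ℂ) * ((Equiv.Perm.sign i.cycleRange.symm : ℤ) : ℂ) =
      ((Equiv.Perm.sign (τ i).cycleRange.symm : ℤ) : ℂ) * ((Equiv.Perm.sign ρ : ℤ) : ℂ) := by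
    exact_mod_cast congrArg (fun u : ℤˣ => (u : ℤ)) hs
  rw [← sign_cycleRange_symm (τ i)]
  have e₁ := sign_mul_self_complex i.cycleRange.symm
  have e₂ := sign_mul_self_complex (τ i).cycleRange.symm
  simp only [Fin.val_zero, pow_zero, one_mul]
  generalize ((Equiv.Perm.sign τ : ℤ) : ℂ) = t at *
  generalize ((Equiv.Perm.sign i.cycleRange.symm : ℤ) : ℂ) = s at *
  generalize ((Equiv.Perm.sign (τ i).cycleRange.symm : ℤ) : ℂ) = s' at *
  generalize ((Equiv.Perm.sign ρ : ℤ) : ℂ) = r at *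
  have : s * r = t * s' := by
    linear_combination (t * s') * e₁ - s * s' * hs' + (-s * r) * e₂
  rw [← mul_assoc, ← mul_assoc, this]

theorem AEAntisymm.chargeSum {X : Conf M → ℂ} (hX : AEAntisymm X) : AEAntisymm (chargeSum X) := by
  intro τ
  filter_upwards [ae_all_iff.2 fun i => hX.chargeTerm_permConf τ i] with k hk
  simp only [PointInteraction.chargeSum, hk, ← Finset.mul_sum]
  rw [Equiv.sum_comp τ fun i => chargeTerm X i k]

end

/-! ### The pair resolvent in the relative momentum, and the tail of a diagonal term. -/

section

variable {M : ℕ}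

theorem norm_sq_conf (w : Conf M) : ‖w‖ ^ 2 = ‖w 0‖ ^ 2 + ∑ i, ‖rest w i‖ ^ 2 := by
  rw [PiLp.norm_sq_eq_of_L2, Fin.sum_univ_succ]
  rfl

/-- The factor `(m+1)/(2m)` of the relative momentum of a pair. -/
def pairFactor (m : ℝ) : ℝ := (m + 1) / (2 * m)

theorem pairFactor_pos {m : ℝ} (hm : 0 < m) : 0 < pairFactor m := by
  unfold pairFactor
  positivity

/-- The energy, shifted by `μ`, where `w` holds the total momentum of a pair and the other momenta,
and `x` is the momentum of the distinguished particle. -/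
def pairDenom (m μ : ℝ) (x : E3) (w : Conf M) : ℝ :=
  1 / (2 * m) * ‖x‖ ^ 2 + 1 / 2 * ‖w 0 - x‖ ^ 2 + 1 / 2 * ∑ i, ‖rest w i‖ ^ 2 + μ

/-- The part of the energy, shifted by `μ`, that does not depend on the relative momentum. -/
def pairRest (m μ : ℝ) (w : Conf M) : ℝ :=
  ‖w 0‖ ^ 2 / (2 * (m + 1)) + 1 / 2 * ∑ i, ‖rest w i‖ ^ 2 + μ

/-- The width of the pair resolvent in the relative momentum. -/
def pairWidth (m μ : ℝ) (w : Conf M) : ℝ := √(pairRest m μ w / pairFactor m)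

theorem continuous_pairRest (m μ : ℝ) : Continuous (pairRest (M := M) m μ) := by
  unfold pairRest rest
  fun_prop

theorem continuous_pairWidth (m μ : ℝ) : Continuous (pairWidth (M := M) m μ) :=
  ((continuous_pairRest m μ).div_const _).sqrt

theorem continuous_pairDenom (m μ : ℝ) :
    Continuous fun p : E3 × Conf M => pairDenom m μ p.1 p.2 := by
  unfold pairDenom rest
  fun_prop

variable {m μ : ℝ}

theorem le_pairRest (hm : 0 < m) (w : Conf M) : μ ≤ pairRest m μ w := by
  have : 0 ≤ ‖w 0‖ ^ 2 / (2 * (m + 1)) + 1 / 2 * ∑ i, ‖rest w i‖ ^ 2 := by positivity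
  unfold pairRest
  linarith

theorem pairRest_pos (hm : 0 < m) (hμ : 0 < μ) (w : Conf M) : 0 < pairRest m μ w :=
  hμ.trans_le (le_pairRest hm w)

theorem pairRest_le (hm : 0 < m) (hμ : 0 < μ) (w : Conf M) :
    pairRest m μ w ≤ (1 + μ) * (1 + ‖w‖ ^ 2) := by
  have h₁ : ∀ t : ℝ, 0 ≤ t → t / (2 * (m + 1)) ≤ t := fun t ht => div_le_self ht (by linarith)
  have h₂ : 0 ≤ ∑ i, ‖rest w i‖ ^ 2 := by positivity
  have h₃ := h₁ (‖w 0‖ ^ 2) (sq_nonneg _)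
  rw [norm_sq_conf, pairRest]
  generalize ‖w 0‖ ^ 2 / (2 * (m + 1)) = u at *
  generalize (∑ i, ‖rest w i‖ ^ 2) = v at *
  nlinarith [sq_nonneg ‖w 0‖]

theorem pairWidth_pos (hm : 0 < m) (hμ : 0 < μ) (w : Conf M) : 0 < pairWidth m μ w :=
  Real.sqrt_pos.2 (div_pos (pairRest_pos hm hμ w) (pairFactor_pos hm))

theorem pairWidth_sq (hm : 0 < m) (hμ : 0 < μ) (w : Conf M) :
    pairFactor m * pairWidth m μ w ^ 2 = pairRest m μ w := by
  rw [pairWidth, Real.sq_sqrt (div_pos (pairRest_pos hm hμ w) (pairFactor_pos hm)).le,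
    mul_div_cancel₀ _ (pairFactor_pos hm).ne']

theorem pairWidth_sq' (hm : 0 < m) (hμ : 0 < μ) (w : Conf M) :
    pairWidth m μ w ^ 2 = pairRest m μ w / pairFactor m := by
  rw [pairWidth, Real.sq_sqrt (div_pos (pairRest_pos hm hμ w) (pairFactor_pos hm)).le]

/-- A lower bound of all widths. -/
def minWidth (m μ : ℝ) : ℝ := √(μ / pairFactor m)

theorem minWidth_pos (hm : 0 < m) (hμ : 0 < μ) : 0 < minWidth m μ :=
  Real.sqrt_pos.2 (div_pos hμ (pairFactor_pos hm))

theorem minWidth_le (hm : 0 < m) (w : Conf M) : minWidth m μ ≤ pairWidth m μ w :=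
  Real.sqrt_le_sqrt (div_le_div_of_nonneg_right (le_pairRest hm w) (pairFactor_pos hm).le)

theorem exists_pairWidth_le (hm : 0 < m) (hμ : 0 < μ) :
    ∃ C : ℝ, 0 ≤ C ∧ ∀ w : Conf M, pairWidth m μ w ≤ C * (1 + ‖w‖ ^ 2) := by
  refine ⟨1 + (1 + μ) / pairFactor m, ?_, fun w => ?_⟩
  · have := pairFactor_pos hm
    positivity
  have h₁ : pairWidth m μ w ^ 2 ≤ (1 + μ) / pairFactor m * (1 + ‖w‖ ^ 2) := by
    rw [pairWidth_sq' hm hμ, div_mul_eq_mul_div]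
    exact div_le_div_of_nonneg_right (pairRest_le hm hμ w) (pairFactor_pos hm).le
  nlinarith [sq_nonneg (pairWidth m μ w - 1), sq_nonneg ‖w‖]

/-- Completing the square: the distinguished particle carries the fraction m/(m+1) of the pair
momentum, its partner, in the next lemma, the fraction 1/(m+1). -/
theorem pairDenom_eq (hm : 0 < m) (hμ : 0 < μ) (x : E3) (w : Conf M) :
    pairDenom m μ x w =
      pairFactor m * (‖x - (m / (m + 1)) • w 0‖ ^ 2 + pairWidth m μ w ^ 2) := by
  rw [mul_add, pairWidth_sq hm hμ, pairDenom, pairRest, norm_sub_sq_E3, norm_sub_sq_E3,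
    inner_smul_right, norm_smul, real_inner_comm, Real.norm_of_nonneg (by positivity), pairFactor]
  field_simp
  ring

theorem pairDenom_sub_eq (hm : 0 < m) (hμ : 0 < μ) (y : E3) (w : Conf M) :
    pairDenom m μ (w 0 - y) w =
      pairFactor m * (‖y - (1 / (m + 1)) • w 0‖ ^ 2 + pairWidth m μ w ^ 2) := by
  rw [mul_add, pairWidth_sq hm hμ, pairDenom, pairRest, sub_sub_cancel, norm_sub_sq_E3,
    norm_sub_sq_E3, inner_smul_right, norm_smul, real_inner_comm,
    Real.norm_of_nonneg (by positivity), pairFactor]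
  field_simp
  ring

theorem pairDenom_pos (hm : 0 < m) (hμ : 0 < μ) (x : E3) (w : Conf M) : 0 < pairDenom m μ x w := by
  unfold pairDenom
  positivity

/-- The centre of the pair resolvent is controlled by its width, as
`diagKernel_integrable_and_bound` requires. For the fractions m/(m+1) and 1/(m+1) the ratio of the
squares is at most m and 1/m. -/
theorem sq_le_pairWidth (hm : 0 < m) (hμ : 0 < μ) (w : Conf M) :
    m / (m + 1) ^ 2 * ‖w 0‖ ^ 2 ≤ pairWidth m μ w ^ 2 := by
  rw [pairWidth_sq' hm hμ, le_div_iff₀ (pairFactor_pos hm)]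
  have : m / (m + 1) ^ 2 * ‖w 0‖ ^ 2 * pairFactor m = ‖w 0‖ ^ 2 / (2 * (m + 1)) := by
    rw [pairFactor]
    field_simp
  rw [this, pairRest]
  have : 0 ≤ 1 / 2 * ∑ i, ‖rest w i‖ ^ 2 := by positivity
  linarith

theorem greenSymbol_eq_kinetic (k : Conf M) : greenSymbol m μ k = (kinetic m k + μ)⁻¹ := rfl

theorem kinetic_nonneg (hm : 0 < m) (k : Conf M) : 0 ≤ kinetic m k := by
  unfold kinetic
  positivity

theorem greenSymbol_pos (hm : 0 < m) (hμ : 0 < μ) (k : Conf M) : 0 < greenSymbol m μ k :=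
  inv_pos.2 (add_pos_of_nonneg_of_pos (kinetic_nonneg hm k) hμ)

theorem continuous_kinetic : Continuous (kinetic (M := M) m) := by
  unfold kinetic rest
  fun_prop

theorem measurable_greenSymbol : Measurable (greenSymbol (M := M) m μ) :=
  (continuous_kinetic.add_const μ).measurable.inv

theorem greenSymbol_eq_pair (i : Fin (M + 1)) (k : Conf (M + 1)) :
    greenSymbol m μ k = (pairDenom m μ (k 0) (pairMap i k))⁻¹ := by
  rw [greenSymbol, pairDenom, Fin.sum_univ_succAbove _ i]
  simp only [pairMap_zero, rest_pairMap, add_sub_cancel_left]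
  ring

/-- Multiplying `|X|²` with a kernel whose `L¹` norm is bounded by a quadratic weight. -/
theorem hasInt_weighted {X : Conf M → ℂ} (hXm : Measurable X)
    (hX : Integrable fun w => (1 + ‖w‖ ^ 2) * ‖X w‖ ^ 2) {K : E3 → Conf M → ℝ}
    (hK : Measurable (Function.uncurry K)) {C : ℝ} (hint : ∀ w, Integrable fun x => K x w)
    (hb : ∀ w, ∫ x, |K x w| ≤ C * (1 + ‖w‖ ^ 2)) :
    HasInt (fun p : E3 × Conf M => ‖X p.2‖ ^ 2 * K p.1 p.2) (volume.prod volume)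
      (∫ w, ‖X w‖ ^ 2 * ∫ x, K x w) ∧
    Integrable (fun w => ‖X w‖ ^ 2 * ∫ x, K x w) := by
  have hm : Measurable fun p : E3 × Conf M => ‖X p.2‖ ^ 2 * K p.1 p.2 :=
    ((hXm.comp measurable_snd).norm.pow_const 2).mul hK
  have hi : Integrable (fun p : E3 × Conf M => ‖X p.2‖ ^ 2 * K p.1 p.2)
      (volume.prod volume) := by
    rw [integrable_prod_iff' hm.aestronglyMeasurable]
    refine ⟨Eventually.of_forall fun w => (hint w).const_mul (‖X w‖ ^ 2), ?_⟩
    refine (hX.const_mul C).mono' (hm.norm.stronglyMeasurable.integral_prod_left').aestronglyMeasurable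
      (Eventually.of_forall fun w => ?_)
    simp only [norm_mul, norm_pow, Real.norm_eq_abs, abs_norm]
    rw [integral_const_mul, abs_mul, abs_pow, abs_norm,
      abs_of_nonneg (integral_nonneg fun x => abs_nonneg (K x w))]
    calc _ ≤ ‖X w‖ ^ 2 * (C * (1 + ‖w‖ ^ 2)) :=
          mul_le_mul_of_nonneg_left (hb w) (sq_nonneg _)
      _ = _ := by ring
  refine ⟨⟨hi, ?_⟩, ?_⟩
  · rw [integral_prod_symm _ hi]
    simp only [integral_const_mul]
  · simpa only [integral_const_mul] using hi.integral_prod_right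

theorem HasInt.of_integrable {α E : Type*} [MeasurableSpace α] [NormedAddCommGroup E]
    [NormedSpace ℝ E] {μ : Measure α} {f : α → E} (h : Integrable f μ) :
    HasInt f μ (∫ x, f x ∂μ) :=
  ⟨h, rfl⟩

theorem HasInt.marginal {α β E : Type*} [MeasurableSpace α] [MeasurableSpace β]
    [NormedAddCommGroup E] [NormedSpace ℝ E] {μ : Measure α} {ν : Measure β} [SFinite μ] [SFinite ν]
    {f : α × β → E} {a : E} (h : HasInt f (μ.prod ν) a) :
    HasInt (fun x => ∫ y, f (x, y) ∂ν) μ a :=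
  ⟨h.1.integral_prod_left, by rw [← integral_prod _ h.1, h.2]⟩

/-- `hasInt_weighted` in the momenta of all particles. -/
theorem hasInt_weighted_split {X : Conf M → ℂ} (hXm : Measurable X)
    (hX : Integrable fun w => (1 + ‖w‖ ^ 2) * ‖X w‖ ^ 2) {K : E3 → Conf M → ℝ}
    (hK : Measurable (Function.uncurry K)) {C : ℝ} (hint : ∀ w, Integrable fun x => K x w)
    (hb : ∀ w, ∫ x, |K x w| ≤ C * (1 + ‖w‖ ^ 2)) (i : Fin (M + 1)) :
    HasInt (fun k : Conf (M + 1) => ‖chargeTerm X i k‖ ^ 2 * K (k 0) (pairMap i k)) volume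
      (∫ w, ‖X w‖ ^ 2 * ∫ x, K x w) := by
  have h := HasInt.comp (T := splitMap i) (hasInt_weighted hXm hX hK hint hb).1
    (measurePreserving_splitMap i) (measurableEmbedding_splitMap i)
  refine h.congr (Eventually.of_forall fun k => ?_)
  simp only [norm_chargeTerm, splitMap]

theorem hasInt_pairDenom_sq (hm : 0 < m) (hμ : 0 < μ) (w : Conf M) :
    HasInt (fun x => (pairDenom m μ x w ^ 2)⁻¹) volume
      ((pairFactor m ^ 2)⁻¹ * (Real.pi ^ 2 / pairWidth m μ w)) := by
  have h := ((square_kernel (pairWidth_pos hm hμ w)).comp_sub_right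
    ((m / (m + 1)) • w 0)).const_mul (pairFactor m ^ 2)⁻¹
  refine h.congr (Eventually.of_forall fun x => ?_)
  simp only [pairDenom_eq hm hμ, mul_pow, mul_inv]

/-- The weight V depends only on the pair momentum and the spectators, so the relative momentum
integrates out by `square_kernel`. It serves with V = 1, with the square of one spectator momentum,
and with the spectator energy. -/
theorem hasInt_green_sq_chargeTerm (hm : 0 < m) (hμ : 0 < μ) {X : Conf M → ℂ} (hXm : Measurable X)
    (hX : Integrable fun w => (1 + ‖w‖ ^ 2) * ‖X w‖ ^ 2) {V : Conf M → ℝ} (hV : Continuous V)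
    {C : ℝ} (hC : ∀ w, |V w| ≤ C * (1 + ‖w‖ ^ 2)) (i : Fin (M + 1)) :
    HasInt (fun k : Conf (M + 1) => V (pairMap i k) * greenSymbol m μ k ^ 2 * ‖chargeTerm X i k‖ ^ 2)
      volume (∫ w, ‖X w‖ ^ 2 *
        (V w * ((pairFactor m ^ 2)⁻¹ * (Real.pi ^ 2 / pairWidth m μ w)))) := by
  have hp := pairFactor_pos hm
  have hK : Measurable (Function.uncurry fun (x : E3) (w : Conf M) =>
      V w * (pairDenom m μ x w ^ 2)⁻¹) :=
    (hV.measurable.comp measurable_snd).mul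
      ((continuous_pairDenom m μ).measurable.pow_const 2).inv
  have h := hasInt_weighted_split hXm hX hK
    (C := (pairFactor m ^ 2)⁻¹ * (Real.pi ^ 2 / minWidth m μ) * C)
    (fun w => (hasInt_pairDenom_sq hm hμ w).1.const_mul _) (fun w => ?_) i
  · simp only [integral_const_mul, (hasInt_pairDenom_sq hm hμ _).2] at h
    refine h.congr (Eventually.of_forall fun k => ?_)
    simp only
    rw [greenSymbol_eq_pair i, inv_pow]
    ring
  · have hw := minWidth_pos hm hμ
    simp only [abs_mul, integral_const_mul]
    have : ∀ x, |(pairDenom m μ x w ^ 2)⁻¹| = (pairDenom m μ x w ^ 2)⁻¹ := fun x =>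
      abs_of_nonneg (by positivity)
    simp only [this, (hasInt_pairDenom_sq hm hμ w).2]
    calc |V w| * ((pairFactor m ^ 2)⁻¹ * (Real.pi ^ 2 / pairWidth m μ w))
        ≤ (C * (1 + ‖w‖ ^ 2)) * ((pairFactor m ^ 2)⁻¹ * (Real.pi ^ 2 / minWidth m μ)) := by
          have h₁ := hC w
          have h₂ := (abs_nonneg _).trans h₁
          have h₃ := minWidth_le (μ := μ) hm w
          have h₄ := pairWidth_pos hm hμ w
          gcongr
      _ = _ := by ring

/-- The kernel `|x|²/(|x-q|²+b²)² - 1/|x-p|²` after subtraction of an odd function that is linear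
in `2q - p`. -/
def tailKernel (q : E3) (b : ℝ) (p x : E3) : ℝ :=
  diagKernel q b x + shiftKernel ((2 : ℝ) • q) x - shiftKernel p x

/-- The poles at 2q and at 0 cancel; only those at p and the odd correction remain. -/
theorem tailKernel_eq (q : E3) (b : ℝ) (p x : E3) :
    tailKernel q b p x = ‖x‖ ^ 2 / (‖x - q‖ ^ 2 + b ^ 2) ^ 2 - (‖x - p‖ ^ 2)⁻¹ -
      2 * inner ℝ x ((2 : ℝ) • q - p) / (‖x‖ ^ 2 + 1) ^ 2 := by
  simp only [tailKernel, diagKernel, shiftKernel, inner_sub_right]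
  ring

theorem hasInt_tailKernel (q : E3) {b : ℝ} (hb : 0 < b) (p : E3) :
    HasInt (tailKernel q b p) volume (-3 * Real.pi ^ 2 * b + Real.pi ^ 2 * ‖q‖ ^ 2 / b) := by
  have hint := (diagKernel_integrable_and_bound q (c := ‖q‖ ^ 2 / b ^ 2) hb (by positivity)
    (by field_simp; rfl)).1
  have h₁ : HasInt (diagKernel q b) volume _ := ⟨hint, integral_diagKernel q hb⟩
  have h₂ : ∀ u, HasInt (shiftKernel u) volume 0 := fun u =>
    ⟨(shiftKernel_integrable_and_bound u).1, integral_shiftKernel u⟩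
  exact ((h₁.add (h₂ ((2 : ℝ) • q))).sub (h₂ p)).congr_val (by ring)

theorem integral_abs_tailKernel_le {q : E3} {b c : ℝ} (hb : 0 < b) (hc : 0 ≤ c)
    (hq : ‖q‖ ^ 2 ≤ c * b ^ 2) (p : E3) :
    ∫ x, |tailKernel q b p x| ≤ 18 * (1 + c) ^ 2 * Real.pi ^ 2 * b +
      Real.pi ^ 2 * (4 + 9 * ‖(2 : ℝ) • q‖ ^ 2) + Real.pi ^ 2 * (4 + 9 * ‖p‖ ^ 2) := by
  have h₁ := diagKernel_integrable_and_bound q hb hc hq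
  have h₂ := shiftKernel_integrable_and_bound ((2 : ℝ) • q)
  have h₃ := shiftKernel_integrable_and_bound p
  have hs := ((HasInt.of_integrable h₁.1.abs).add (HasInt.of_integrable h₂.1.abs)).add
    (HasInt.of_integrable h₃.1.abs)
  refine (integral_mono (hasInt_tailKernel q hb p).1.abs hs.1 fun x => ?_).trans ?_
  · simp only [tailKernel]
    exact (abs_sub _ _).trans (add_le_add_left (abs_add_le _ _) _)
  · rw [hs.2]
    linarith [h₁.2, h₂.2, h₃.2]

theorem integrable_norm_sq_of_weighted {X : Conf M → ℂ} (hXm : Measurable X)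
    (hX : Integrable fun w => (1 + ‖w‖ ^ 2) * ‖X w‖ ^ 2) : Integrable fun w => ‖X w‖ ^ 2 := by
  refine hX.mono' (hXm.norm.pow_const 2).aestronglyMeasurable (Eventually.of_forall fun w => ?_)
  rw [Real.norm_of_nonneg (sq_nonneg _), one_add_mul]
  exact le_add_of_nonneg_right (mul_nonneg (sq_nonneg _) (sq_nonneg _))

theorem norm_coord_sq_le (w : Conf M) : ‖w 0‖ ^ 2 ≤ ‖w‖ ^ 2 := by
  rw [norm_sq_conf w]
  have : 0 ≤ ∑ i, ‖rest w i‖ ^ 2 := by positivity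
  linarith

theorem integrable_first_moment {X : Conf M → ℂ} (hXm : Measurable X)
    (hX : Integrable fun w => (1 + ‖w‖ ^ 2) * ‖X w‖ ^ 2) :
    Integrable fun w : Conf M => ‖X w‖ ^ 2 • w 0 := by
  have hc : Continuous fun w : Conf M => w 0 := by fun_prop
  refine hX.mono' ((hXm.norm.pow_const 2).smul hc.measurable).aestronglyMeasurable
    (Eventually.of_forall fun w => ?_)
  rw [norm_smul, Real.norm_of_nonneg (sq_nonneg _), mul_comm]
  refine mul_le_mul_of_nonneg_right ?_ (sq_nonneg _)
  nlinarith [norm_coord_sq_le w, sq_nonneg (‖w 0‖ - 1)]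

theorem measurable_tailKernel (c : ℝ) (p : E3) :
    Measurable (Function.uncurry fun (x : E3) (w : Conf M) =>
      tailKernel (c • w 0) (pairWidth m μ w) p x) := by
  have e₀ : Measurable fun w : Conf M => c • w 0 :=
    (by fun_prop : Continuous fun w : Conf M => c • w 0).measurable
  have e₁ : Measurable fun w : Conf M => (2 : ℝ) • c • w 0 :=
    (by fun_prop : Continuous fun w : Conf M => (2 : ℝ) • c • w 0).measurable
  have e : Measurable fun w : Conf M => pairWidth m μ w := (continuous_pairWidth m μ).measurable
  have f₁ : Measurable fun z : E3 × Conf M =>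
      ((c • z.2 0, pairWidth m μ z.2, z.1) : E3 × ℝ × E3) :=
    (e₀.comp measurable_snd).prodMk ((e.comp measurable_snd).prodMk measurable_fst)
  have f₂ : Measurable fun z : E3 × Conf M => (((2 : ℝ) • c • z.2 0, z.1) : E3 × E3) :=
    (e₁.comp measurable_snd).prodMk measurable_fst
  have f₃ : Measurable fun z : E3 × Conf M => (p, z.1) :=
    measurable_const.prodMk measurable_fst
  have g₁ : Measurable fun z : E3 × Conf M => diagKernel (c • z.2 0) (pairWidth m μ z.2) z.1 := by
    simpa only [Function.comp_def] using measurable_diagKernel.comp f₁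
  have g₂ : Measurable fun z : E3 × Conf M => shiftKernel ((2 : ℝ) • c • z.2 0) z.1 := by
    simpa only [Function.comp_def] using measurable_shiftKernel.comp f₂
  have g₃ : Measurable fun z : E3 × Conf M => shiftKernel p z.1 := by
    simpa only [Function.comp_def] using measurable_shiftKernel.comp f₃
  simp only [Function.uncurry_def, tailKernel]
  exact (g₁.add g₂).sub g₃

theorem norm_smul_coord_sq_le (hm : 0 < m) (hμ : 0 < μ) {c d : ℝ} (hd : 0 ≤ d)
    (hc : c ^ 2 ≤ d * (m / (m + 1) ^ 2)) (w : Conf M) :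
    ‖c • w 0‖ ^ 2 ≤ d * pairWidth m μ w ^ 2 := by
  rw [norm_smul, mul_pow, Real.norm_eq_abs, sq_abs]
  calc c ^ 2 * ‖w 0‖ ^ 2 ≤ d * (m / (m + 1) ^ 2) * ‖w 0‖ ^ 2 :=
        mul_le_mul_of_nonneg_right hc (sq_nonneg _)
    _ = d * (m / (m + 1) ^ 2 * ‖w 0‖ ^ 2) := by ring
    _ ≤ _ := mul_le_mul_of_nonneg_left (sq_le_pairWidth hm hμ w) hd

theorem exists_integral_abs_tailKernel_le (hm : 0 < m) (hμ : 0 < μ) {c d : ℝ} (hd : 0 ≤ d)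
    (hc : c ^ 2 ≤ d * (m / (m + 1) ^ 2)) (p : E3) :
    ∃ C : ℝ, ∀ w : Conf M,
      ∫ x, |tailKernel (c • w 0) (pairWidth m μ w) p x| ≤ C * (1 + ‖w‖ ^ 2) := by
  obtain ⟨C, hC0, hC⟩ := exists_pairWidth_le (M := M) hm hμ
  refine ⟨18 * (1 + d) ^ 2 * Real.pi ^ 2 * C + Real.pi ^ 2 * (4 + 36 * c ^ 2) +
      Real.pi ^ 2 * (4 + 9 * ‖p‖ ^ 2), fun w => ?_⟩
  refine (integral_abs_tailKernel_le (pairWidth_pos hm hμ w) hd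
    (norm_smul_coord_sq_le hm hμ hd hc w) p).trans ?_
  have e₁ := hC w
  have e₂ : ‖(2 : ℝ) • c • w 0‖ ^ 2 ≤ 4 * c ^ 2 * ‖w‖ ^ 2 := by
    rw [norm_smul, norm_smul, mul_pow, mul_pow, Real.norm_eq_abs, Real.norm_eq_abs, sq_abs, sq_abs]
    have := mul_le_mul_of_nonneg_left (norm_coord_sq_le w) (by positivity : 0 ≤ 4 * c ^ 2)
    linarith
  have hw : 0 ≤ ‖w‖ ^ 2 := sq_nonneg _
  generalize ‖(2 : ℝ) • c • w 0‖ ^ 2 = t at *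
  generalize ‖w‖ ^ 2 = u at *
  generalize pairWidth m μ w = v at *
  have e₃ : 18 * (1 + d) ^ 2 * Real.pi ^ 2 * v ≤
      18 * (1 + d) ^ 2 * Real.pi ^ 2 * (C * (1 + u)) :=
    mul_le_mul_of_nonneg_left e₁ (by positivity)
  have e₄ : Real.pi ^ 2 * (4 + 9 * t) ≤ Real.pi ^ 2 * ((4 + 36 * c ^ 2) * (1 + u)) :=
    mul_le_mul_of_nonneg_left (by nlinarith [sq_nonneg c]) (by positivity)
  have e₅ : Real.pi ^ 2 * (4 + 9 * ‖p‖ ^ 2) ≤ Real.pi ^ 2 * (4 + 9 * ‖p‖ ^ 2) * (1 + u) :=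
    le_mul_of_one_le_right (by positivity) (by linarith)
  linarith

theorem integrable_diag_section {X : Conf M → ℂ} (hXm : Measurable X)
    (hX : Integrable fun w => (1 + ‖w‖ ^ 2) * ‖X w‖ ^ 2) (hm : 0 < m) (hμ : 0 < μ) (c : ℝ)
    (x : E3) : Integrable fun w : Conf M => ‖X w‖ ^ 2 *
      (‖x‖ ^ 2 / (‖x - c • w 0‖ ^ 2 + pairWidth m μ w ^ 2) ^ 2) := by
  have hX0 := integrable_norm_sq_of_weighted hXm hX
  have hw := minWidth_pos hm hμ
  refine (hX0.mul_const (‖x‖ ^ 2 / (minWidth m μ ^ 2) ^ 2)).mono'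
    (Measurable.aestronglyMeasurable ?_) (Eventually.of_forall fun w => ?_)
  · have hc : Continuous fun w : Conf M =>
        (‖x - c • w 0‖ ^ 2 + pairWidth m μ w ^ 2) ^ 2 :=
      (((continuous_const.sub ((by fun_prop : Continuous fun w : Conf M => w 0).const_smul
        c)).norm.pow 2).add ((continuous_pairWidth m μ).pow 2)).pow 2
    exact (hXm.norm.pow_const 2).mul (measurable_const.div hc.measurable)
  · have h₁ : minWidth m μ ^ 2 ≤ ‖x - c • w 0‖ ^ 2 + pairWidth m μ w ^ 2 :=
      (pow_le_pow_left₀ hw.le (minWidth_le hm w) 2).trans (le_add_of_nonneg_left (sq_nonneg _))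
    rw [Real.norm_of_nonneg (by positivity)]
    refine mul_le_mul_of_nonneg_left ?_ (sq_nonneg _)
    exact div_le_div_of_nonneg_left (sq_nonneg _) (by positivity)
      (pow_le_pow_left₀ (sq_nonneg _) h₁ 2)

/-- The odd correction makes each kernel integrable in x but is absent from the claim. It is linear
in 2c w₀ − p, whose |X|²-average is zero by `hp`, so it vanishes at fixed x. -/
theorem integral_tailKernel_section {X : Conf M → ℂ} (hXm : Measurable X)
    (hX : Integrable fun w => (1 + ‖w‖ ^ 2) * ‖X w‖ ^ 2) (hm : 0 < m) (hμ : 0 < μ) {c : ℝ} {p : E3}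
    (hp : ((2 : ℝ) * c) • ∫ w, ‖X w‖ ^ 2 • w 0 = (∫ w, ‖X w‖ ^ 2) • p) (x : E3) :
    ∫ w, ‖X w‖ ^ 2 * tailKernel (c • w 0) (pairWidth m μ w) p x =
      (∫ w, ‖X w‖ ^ 2 * (‖x‖ ^ 2 / (‖x - c • w 0‖ ^ 2 + pairWidth m μ w ^ 2) ^ 2)) -
        (∫ w, ‖X w‖ ^ 2) * (‖x - p‖ ^ 2)⁻¹ := by
  have hX0 := integrable_norm_sq_of_weighted hXm hX
  have hX1 := integrable_first_moment hXm hX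
  have h₁ : HasInt (fun w : Conf M => ((2 : ℝ) * c) • (‖X w‖ ^ 2 • w 0)) volume
      (((2 : ℝ) * c) • ∫ w, ‖X w‖ ^ 2 • w 0) := ⟨hX1.smul ((2 : ℝ) * c), integral_smul _ _⟩
  have h₂ : HasInt (fun w : Conf M => ‖X w‖ ^ 2 • p) volume ((∫ w, ‖X w‖ ^ 2) • p) :=
    ⟨hX0.smul_const p, integral_smul_const _ _⟩
  have h₃ := (h₁.sub h₂).congr_val (b := 0) (by rw [hp, sub_self])
  have h₄ : HasInt (fun w : Conf M => inner ℝ x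
      (((2 : ℝ) * c) • (‖X w‖ ^ 2 • w 0) - ‖X w‖ ^ 2 • p)) volume 0 :=
    ⟨h₃.1.const_inner x, by rw [integral_inner h₃.1, h₃.2, inner_zero_right]⟩
  have hlin := (h₄.const_mul (2 / (‖x‖ ^ 2 + 1) ^ 2)).congr_val (mul_zero _)
  have hm1 : HasInt (fun w : Conf M => ‖X w‖ ^ 2 * (‖x - p‖ ^ 2)⁻¹) volume
      ((∫ w, ‖X w‖ ^ 2) * (‖x - p‖ ^ 2)⁻¹) :=
    ⟨hX0.mul_const _, integral_mul_const _ _⟩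
  have htot := ((HasInt.of_integrable (integrable_diag_section hXm hX hm hμ c x)).sub hm1).sub hlin
  rw [sub_zero] at htot
  rw [← htot.2]
  refine integral_congr_ae (Eventually.of_forall fun w => ?_)
  simp only [tailKernel_eq, inner_sub_right, inner_smul_right]
  ring

/-- The marginal of the diagonal part, with its leading behaviour subtracted. -/
theorem hasInt_tail {X : Conf M → ℂ} (hXm : Measurable X)
    (hX : Integrable fun w => (1 + ‖w‖ ^ 2) * ‖X w‖ ^ 2) (hm : 0 < m) (hμ : 0 < μ) {c d : ℝ}
    (hd : 0 ≤ d) (hc : c ^ 2 ≤ d * (m / (m + 1) ^ 2)) {p : E3}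
    (hp : ((2 : ℝ) * c) • ∫ w, ‖X w‖ ^ 2 • w 0 = (∫ w, ‖X w‖ ^ 2) • p) :
    HasInt (fun x => (∫ w, ‖X w‖ ^ 2 * (‖x‖ ^ 2 / (‖x - c • w 0‖ ^ 2 + pairWidth m μ w ^ 2) ^ 2)) -
        (∫ w, ‖X w‖ ^ 2) * (‖x - p‖ ^ 2)⁻¹) volume
      (∫ w, ‖X w‖ ^ 2 * (-3 * Real.pi ^ 2 * pairWidth m μ w +
        Real.pi ^ 2 * ‖c • w 0‖ ^ 2 / pairWidth m μ w)) ∧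
    Integrable (fun w => ‖X w‖ ^ 2 * (-3 * Real.pi ^ 2 * pairWidth m μ w +
        Real.pi ^ 2 * ‖c • w 0‖ ^ 2 / pairWidth m μ w)) := by
  obtain ⟨C, hC⟩ := exists_integral_abs_tailKernel_le (M := M) hm hμ hd hc p
  have h := hasInt_weighted hXm hX (measurable_tailKernel c p)
    (fun w => (hasInt_tailKernel _ (pairWidth_pos hm hμ w) p).1) hC
  simp only [(hasInt_tailKernel _ (pairWidth_pos hm hμ _) p).2] at h
  exact ⟨h.1.marginal.congr (Eventually.of_forall fun x =>
    integral_tailKernel_section hXm hX hm hμ hp x), h.2⟩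

end

/-! ### Off-diagonal products of charge terms: the Schur test. -/

section

variable {M : ℕ} {m μ : ℝ}

theorem HasInt.comp_sub_left {E : Type*} [NormedAddCommGroup E] [NormedSpace ℝ E] {f : E3 → E}
    {a : E} (hf : HasInt f volume a) (u : E3) : HasInt (fun k => f (u - k)) volume a := by
  refine (hf.comp_sub_right (-u)).comp_neg.congr (Eventually.of_forall fun k => ?_)
  simp only
  congr 1
  abel

theorem ae_rest_ne_zero (i : Fin M) : ∀ᵐ k : Conf M, rest k i ≠ 0 := by
  have h₁ : Measure.QuasiMeasurePreserving (fun k : Conf M => k.ofLp) :=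
    (MeasurePreserving.symm (MeasurableEquiv.toLp 2 (Fin (M + 1) → E3))
      (measurePreserving_toLp_conf M)).quasiMeasurePreserving
  have h₂ : Measure.QuasiMeasurePreserving (Function.eval i.succ : (Fin (M + 1) → E3) → E3) :=
    Measure.quasiMeasurePreserving_eval (fun _ => volume) i.succ
  exact (h₂.comp h₁).ae (ae_ne 0)

theorem pairDenom_ge (hm : 0 < m) (x : E3) (w : Conf M) (j : Fin M) :
    1 / 2 * (‖w 0 - x‖ ^ 2 + (‖rest w j‖ ^ 2 + 2 * μ)) ≤ pairDenom m μ x w := by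
  have h₁ : ‖rest w j‖ ^ 2 ≤ ∑ i, ‖rest w i‖ ^ 2 :=
    Finset.single_le_sum (f := fun i => ‖rest w i‖ ^ 2) (fun i _ => sq_nonneg _)
      (Finset.mem_univ j)
  have h₂ : 0 ≤ 1 / (2 * m) * ‖x‖ ^ 2 := by positivity
  unfold pairDenom
  linarith

/-- The kernel of the Schur test for two different charge terms. -/
def schurKernel (m μ : ℝ) (j : Fin M) (x : E3) (w : Conf M) : ℝ :=
  ‖rest w j‖ ^ 2 / ‖w 0 - x‖ ^ 2 * (pairDenom m μ x w)⁻¹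

theorem measurable_schurKernel (j : Fin M) :
    Measurable (Function.uncurry (schurKernel (M := M) m μ j)) := by
  have h₁ : Continuous fun z : E3 × Conf M => ‖rest z.2 j‖ ^ 2 := by unfold rest; fun_prop
  have h₂ : Continuous fun z : E3 × Conf M => ‖z.2 0 - z.1‖ ^ 2 := by fun_prop
  exact (h₁.measurable.div h₂.measurable).mul (continuous_pairDenom m μ).measurable.inv

theorem schurKernel_nonneg (hm : 0 < m) (hμ : 0 < μ) (j : Fin M) (x : E3) (w : Conf M) :
    0 ≤ schurKernel m μ j x w := by
  have := pairDenom_pos hm hμ x w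
  unfold schurKernel
  positivity

/-- Here w₀ − x is the momentum of the paired fermion. Keeping only its energy, that of spectator j
and μ leaves `singular_kernel` with width at least √(2μ). -/
theorem schurKernel_integrable_and_bound (hm : 0 < m) (hμ : 0 < μ) (j : Fin M) (w : Conf M) :
    Integrable (fun x => schurKernel m μ j x w) ∧
      ∫ x, |schurKernel m μ j x w| ≤ 4 * Real.pi ^ 2 / √(2 * μ) * (1 + ‖w‖ ^ 2) := by
  have hβ : 0 < √(‖rest w j‖ ^ 2 + 2 * μ) := by positivity
  have h := ((singular_kernel hβ).comp_sub_left (w 0)).const_mul (2 * ‖rest w j‖ ^ 2)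
  rw [Real.sq_sqrt (by positivity)] at h
  have hle : ∀ x, schurKernel m μ j x w ≤ 2 * ‖rest w j‖ ^ 2 *
      (‖w 0 - x‖ ^ 2 * (‖w 0 - x‖ ^ 2 + (‖rest w j‖ ^ 2 + 2 * μ)))⁻¹ := fun x => by
    have h₁ : (pairDenom m μ x w)⁻¹ ≤
        (1 / 2 * (‖w 0 - x‖ ^ 2 + (‖rest w j‖ ^ 2 + 2 * μ)))⁻¹ :=
      inv_anti₀ (by positivity) (pairDenom_ge hm x w j)
    calc schurKernel m μ j x w ≤ ‖rest w j‖ ^ 2 / ‖w 0 - x‖ ^ 2 *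
          (1 / 2 * (‖w 0 - x‖ ^ 2 + (‖rest w j‖ ^ 2 + 2 * μ)))⁻¹ :=
          mul_le_mul_of_nonneg_left h₁ (by positivity)
      _ = _ := by rw [mul_inv, mul_inv, div_eq_mul_inv]; ring
  have hmeas : Measurable fun x => schurKernel m μ j x w :=
    (measurable_schurKernel j).of_uncurry_right
  have hi : Integrable fun x => schurKernel m μ j x w :=
    h.1.mono' hmeas.aestronglyMeasurable (Eventually.of_forall fun x => by
      rw [Real.norm_of_nonneg (schurKernel_nonneg hm hμ j x w)]
      exact hle x)
  refine ⟨hi, ?_⟩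
  simp only [abs_of_nonneg (schurKernel_nonneg hm hμ j _ w)]
  refine (integral_mono hi h.1 hle).trans ?_
  rw [h.2]
  have h₁ : ‖rest w j‖ ^ 2 ≤ 1 + ‖w‖ ^ 2 := by
    rw [norm_sq_conf w]
    have : ‖rest w j‖ ^ 2 ≤ ∑ i, ‖rest w i‖ ^ 2 :=
      Finset.single_le_sum (f := fun i => ‖rest w i‖ ^ 2) (fun i _ => sq_nonneg _)
        (Finset.mem_univ j)
    nlinarith [sq_nonneg ‖w 0‖]
  have h₂ : √(2 * μ) ≤ √(‖rest w j‖ ^ 2 + 2 * μ) :=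
    Real.sqrt_le_sqrt (by linarith [sq_nonneg ‖rest w j‖])
  have h₃ : 0 < √(2 * μ) := by positivity
  calc 2 * ‖rest w j‖ ^ 2 * (2 * Real.pi ^ 2 / √(‖rest w j‖ ^ 2 + 2 * μ))
      ≤ 2 * (1 + ‖w‖ ^ 2) * (2 * Real.pi ^ 2 / √(2 * μ)) := by gcongr
    _ = _ := by ring

theorem integrable_schur_half (hm : 0 < m) (hμ : 0 < μ) {X : Conf M → ℂ} (hXm : Measurable X)
    (hX : Integrable fun w => (1 + ‖w‖ ^ 2) * ‖X w‖ ^ 2) (i : Fin (M + 1)) (j : Fin M) :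
    Integrable fun k : Conf (M + 1) => ‖chargeTerm X i k‖ ^ 2 *
      (‖rest k (i.succAbove j)‖ ^ 2 / ‖rest k i‖ ^ 2 * greenSymbol m μ k) := by
  have h := (hasInt_weighted_split hXm hX (measurable_schurKernel (m := m) (μ := μ) j)
    (fun w => (schurKernel_integrable_and_bound hm hμ j w).1)
    (fun w => (schurKernel_integrable_and_bound hm hμ j w).2) i).1
  refine h.congr (Eventually.of_forall fun k => ?_)
  simp only [schurKernel, greenSymbol_eq_pair i, pairMap_zero, rest_pairMap, add_sub_cancel_left]

/-- Schur test with the weight |kⱼ|/|kᵢ|: the product is split as (|Sᵢ||kⱼ|/|kᵢ|)(|Sⱼ||kᵢ|/|kⱼ|). In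
each square the momentum in the denominator belongs to the pair and the one in the numerator to a
spectator, so the pair momentum can be held fixed while the relative one is integrated. -/
theorem integrable_green_chargeTerm_mul (hm : 0 < m) (hμ : 0 < μ) {X : Conf M → ℂ}
    (hXm : Measurable X) (hX : Integrable fun w => (1 + ‖w‖ ^ 2) * ‖X w‖ ^ 2) {i j : Fin (M + 1)}
    (hij : i ≠ j) :
    Integrable fun k : Conf (M + 1) =>
      greenSymbol m μ k * (‖chargeTerm X i k‖ * ‖chargeTerm X j k‖) := by
  obtain ⟨j', rfl⟩ := Fin.exists_succAbove_eq hij.symm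
  obtain ⟨i', hi'⟩ := Fin.exists_succAbove_eq hij
  have h₁ := integrable_schur_half hm hμ hXm hX i j'
  have h₂ := integrable_schur_half hm hμ hXm hX (i.succAbove j') i'
  rw [hi'] at h₂
  refine ((h₁.add h₂).const_mul (1 / 2)).mono' ?_ ?_
  · exact (measurable_greenSymbol.mul ((measurable_chargeTerm hXm i).norm.mul
      (measurable_chargeTerm hXm _).norm)).aestronglyMeasurable
  · filter_upwards [ae_rest_ne_zero i, ae_rest_ne_zero (i.succAbove j')] with k hk hk'
    have hG := greenSymbol_pos hm hμ k
    rw [Real.norm_of_nonneg (by positivity), Pi.add_apply]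
    have ha : 0 < ‖rest k i‖ := norm_pos_iff.2 hk
    have hb : 0 < ‖rest k (i.succAbove j')‖ := norm_pos_iff.2 hk'
    generalize ‖rest k i‖ = a at *
    generalize ‖rest k (i.succAbove j')‖ = b at *
    generalize ‖chargeTerm X i k‖ = s
    generalize ‖chargeTerm X (i.succAbove j') k‖ = t
    have : s * t ≤ 1 / 2 * (s ^ 2 * (b ^ 2 / a ^ 2) + t ^ 2 * (a ^ 2 / b ^ 2)) := by
      have e : s * t = (s * (b / a)) * (t * (a / b)) := by field_simp
      rw [e, ← div_pow, ← div_pow, ← mul_pow, ← mul_pow]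
      nlinarith [sq_nonneg (s * (b / a) - t * (a / b))]
    calc greenSymbol m μ k * (s * t) ≤ greenSymbol m μ k *
          (1 / 2 * (s ^ 2 * (b ^ 2 / a ^ 2) + t ^ 2 * (a ^ 2 / b ^ 2))) :=
          mul_le_mul_of_nonneg_left this hG.le
      _ = _ := by ring

theorem integrable_conj_mul_of_memLp {f g : Conf M → ℂ} (hf : MemLp f 2) (hg : MemLp g 2) :
    Integrable fun k => (starRingEnd ℂ) (f k) * g k :=
  hf.star.integrable_mul hg

theorem memLp_of_integrable_norm_sq {f : Conf M → ℂ} (hf : Measurable f)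
    (h : Integrable fun k => ‖f k‖ ^ 2) : MemLp f 2 :=
  (memLp_two_iff_integrable_sq_norm hf.aestronglyMeasurable).2 h

theorem kinetic_add_le (hm : 0 < m) (hμ : 0 < μ) (k : Conf M) :
    kinetic m k + μ ≤ (1 / (2 * m) + 1 / 2 + μ) * (1 + ‖k‖ ^ 2) := by
  rw [norm_sq_conf, kinetic]
  have h₁ : 0 ≤ ∑ i, ‖rest k i‖ ^ 2 := by positivity
  have h₂ : 0 ≤ 1 / (2 * m) := by positivity
  generalize 1 / (2 * m) = c at *
  generalize (∑ i, ‖rest k i‖ ^ 2) = v at *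
  have h₃ := sq_nonneg ‖k 0‖
  generalize ‖k 0‖ ^ 2 = u at *
  nlinarith [mul_nonneg h₂ h₁, mul_nonneg h₂ h₃, mul_nonneg hμ.le h₁, mul_nonneg hμ.le h₃]

/-- The regularity of the regular part in momentum space. -/
theorem memLp_weight {Φ : Conf M → ℂ} (hΦm : Measurable Φ)
    (hΦ : MemLp (fun k => ((1 + ‖k‖ ^ 2 : ℝ) : ℂ) * Φ k) 2) {v : Conf M → ℝ} (hv : Measurable v)
    {C : ℝ} (hvC : ∀ k, |v k| ≤ C * (1 + ‖k‖ ^ 2)) : MemLp (fun k => (v k : ℂ) * Φ k) 2 := by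
  refine (hΦ.const_mul (C : ℂ)).mono
    ((Complex.measurable_ofReal.comp hv).mul hΦm).aestronglyMeasurable
    (Eventually.of_forall fun k => ?_)
  rw [norm_mul, norm_mul, norm_mul, Complex.norm_real, Complex.norm_real, Complex.norm_real,
    ← mul_assoc]
  refine mul_le_mul_of_nonneg_right ?_ (norm_nonneg _)
  refine (hvC k).trans ?_
  rw [← norm_mul]
  exact le_abs_self _

theorem memLp_green_chargeTerm (hm : 0 < m) (hμ : 0 < μ) {X : Conf M → ℂ} (hXm : Measurable X)
    (hX : Integrable fun w => (1 + ‖w‖ ^ 2) * ‖X w‖ ^ 2) (i : Fin (M + 1)) :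
    MemLp (fun k => (greenSymbol m μ k : ℂ) * chargeTerm X i k) 2 := by
  refine memLp_of_integrable_norm_sq ((Complex.measurable_ofReal.comp measurable_greenSymbol).mul
    (measurable_chargeTerm hXm i)) ?_
  refine (hasInt_green_sq_chargeTerm hm hμ hXm hX (V := fun _ => 1) continuous_const (C := 1)
    (fun w => ?_) i).1.congr (Eventually.of_forall fun k => ?_)
  · rw [abs_one]
    nlinarith [sq_nonneg ‖w‖]
  · simp only [norm_mul, mul_pow, Complex.norm_real, Real.norm_eq_abs, sq_abs, one_mul]

theorem memLp_green_chargeSum (hm : 0 < m) (hμ : 0 < μ) {X : Conf M → ℂ} (hXm : Measurable X)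
    (hX : Integrable fun w => (1 + ‖w‖ ^ 2) * ‖X w‖ ^ 2) :
    MemLp (fun k => (greenSymbol m μ k : ℂ) * chargeSum X k) 2 := by
  have := memLp_finsetSum Finset.univ fun i _ => memLp_green_chargeTerm hm hμ hXm hX i
  simpa only [chargeSum, Finset.mul_sum] using this

/-- For l ≠ i the momentum k_l is a spectator of pair i, so its square is a weight on X that H¹
allows. The excluded case l = i produces the tail. -/
theorem integrable_weight_green_sq_chargeTerm (hm : 0 < m) (hμ : 0 < μ) {X : Conf M → ℂ}
    (hXm : Measurable X) (hX : Integrable fun w => (1 + ‖w‖ ^ 2) * ‖X w‖ ^ 2)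
    {i l : Fin (M + 1)} (h : l ≠ i) :
    Integrable fun k => ‖rest k l‖ ^ 2 * greenSymbol m μ k ^ 2 * ‖chargeTerm X i k‖ ^ 2 := by
  obtain ⟨j, rfl⟩ := Fin.exists_succAbove_eq h
  refine (hasInt_green_sq_chargeTerm hm hμ hXm hX (V := fun w => ‖rest w j‖ ^ 2)
    (by unfold rest; fun_prop) (C := 1) (fun w => ?_) i).1
  have : ‖rest w j‖ ^ 2 ≤ ∑ i, ‖rest w i‖ ^ 2 :=
    Finset.single_le_sum (f := fun i => ‖rest w i‖ ^ 2) (fun i _ => sq_nonneg _)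
      (Finset.mem_univ j)
  rw [abs_of_nonneg (sq_nonneg _), norm_sq_conf]
  nlinarith [sq_nonneg ‖w 0‖]

/-- The real part of the sum over pairs of different charge terms. -/
def offSum (X : Conf M → ℂ) (k : Conf (M + 1)) : ℝ :=
  ∑ i, ∑ j ∈ Finset.univ.erase i, ((starRingEnd ℂ) (chargeTerm X i k) * chargeTerm X j k).re

theorem norm_sq_chargeSum (X : Conf M → ℂ) (k : Conf (M + 1)) :
    ‖chargeSum X k‖ ^ 2 = ∑ i, ‖chargeTerm X i k‖ ^ 2 + offSum X k := by
  have h₁ : ‖chargeSum X k‖ ^ 2 = ((starRingEnd ℂ) (chargeSum X k) * chargeSum X k).re := by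
    rw [mul_comm, Complex.mul_conj, Complex.normSq_eq_norm_sq, Complex.ofReal_re]
  have h₂ : ∀ i, ‖chargeTerm X i k‖ ^ 2 =
      ((starRingEnd ℂ) (chargeTerm X i k) * chargeTerm X i k).re := fun i => by
    rw [mul_comm, Complex.mul_conj, Complex.normSq_eq_norm_sq, Complex.ofReal_re]
  rw [h₁, chargeSum, map_sum, Finset.sum_mul_sum, Complex.re_sum, offSum, ← Finset.sum_add_distrib]
  refine Finset.sum_congr rfl fun i _ => ?_
  rw [h₂, Complex.re_sum, Finset.add_sum_erase Finset.univ
    (fun j => ((starRingEnd ℂ) (chargeTerm X i k) * chargeTerm X j k).re) (Finset.mem_univ i)]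

theorem integrable_green_conj_chargeTerm_mul (hm : 0 < m) (hμ : 0 < μ) {X : Conf M → ℂ}
    (hXm : Measurable X) (hX : Integrable fun w => (1 + ‖w‖ ^ 2) * ‖X w‖ ^ 2) {i j : Fin (M + 1)}
    (hij : i ≠ j) :
    Integrable fun k : Conf (M + 1) =>
      (greenSymbol m μ k : ℂ) * ((starRingEnd ℂ) (chargeTerm X i k) * chargeTerm X j k) := by
  refine (integrable_green_chargeTerm_mul hm hμ hXm hX hij).mono' ?_
    (Eventually.of_forall fun k => ?_)
  · exact ((Complex.measurable_ofReal.comp measurable_greenSymbol).mul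
      ((Complex.continuous_conj.measurable.comp (measurable_chargeTerm hXm i)).mul
        (measurable_chargeTerm hXm j))).aestronglyMeasurable
  · rw [norm_mul, norm_mul, Complex.norm_real, Complex.norm_conj,
      Real.norm_of_nonneg (greenSymbol_pos hm hμ k).le]

theorem integrable_green_offSum (hm : 0 < m) (hμ : 0 < μ) {X : Conf M → ℂ}
    (hXm : Measurable X) (hX : Integrable fun w => (1 + ‖w‖ ^ 2) * ‖X w‖ ^ 2) :
    Integrable fun k : Conf (M + 1) => greenSymbol m μ k * offSum X k := by
  have h : Integrable fun k : Conf (M + 1) => ∑ i, ∑ j ∈ Finset.univ.erase i,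
      ((greenSymbol m μ k : ℂ) *
        ((starRingEnd ℂ) (chargeTerm X i k) * chargeTerm X j k)).re :=
    integrable_finsetSum _ fun i _ => integrable_finsetSum _ fun j hj =>
      (integrable_green_conj_chargeTerm_mul hm hμ hXm hX (Finset.ne_of_mem_erase hj).symm).re
  refine h.congr (Eventually.of_forall fun k => ?_)
  simp only [offSum, Finset.mul_sum, Complex.re_ofReal_mul]

end

/-! ### Momentum densities: diagonal marginals and integrable remainders. -/

section

variable {M : ℕ} {m μ : ℝ}

/-- The point at which the first fermion has momentum `x` and `q = (k₀, k₂, …)`. -/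
def downPt (x : E3) (q : Fin (M + 1) → E3) : Conf (M + 1) :=
  pt (q 0) (Fin.cons x (Fin.tail q) : Fin (M + 1) → E3)

/-- As an exchange of two coordinates `downPt` differs from `pt` by an isometry, from which it
inherits preservation of volume and injectivity. -/
theorem downPt_eq (x : E3) (q : Fin (M + 1) → E3) :
    downPt x q = LinearIsometryEquiv.piLpCongrLeft 2 ℝ E3 (Equiv.swap 0 1) (pt x q) := by
  ext i : 1
  rw [LinearIsometryEquiv.piLpCongrLeft_apply]
  simp only [Equiv.piCongrLeft'_apply, Equiv.symm_swap]
  refine Fin.cases ?_ (fun i => ?_) i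
  · rw [Equiv.swap_apply_left]
    rfl
  refine Fin.cases ?_ (fun i => ?_) i
  · change _ = pt x q (Equiv.swap 0 1 1)
    rw [Equiv.swap_apply_right]
    rfl
  · have h : Equiv.swap (0 : Fin (M + 2)) 1 i.succ.succ = i.succ.succ :=
      Equiv.swap_apply_of_ne_of_ne (Fin.succ_ne_zero _)
        (fun h => Fin.succ_ne_zero i (Fin.succ_injective _ h))
    rw [h]
    rfl

theorem measurePreserving_downPt :
    MeasurePreserving (fun p : E3 × (Fin (M + 1) → E3) => downPt p.1 p.2) := by
  simp only [downPt_eq]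
  exact (LinearIsometryEquiv.measurePreserving _).comp (measurePreserving_pt (M + 1))

theorem measurableEmbedding_pt :
    MeasurableEmbedding (fun p : E3 × (Fin M → E3) => pt p.1 p.2) := by
  refine measurable_pt.measurableEmbedding fun p p' h => ?_
  obtain ⟨h₁, h₂⟩ := pt_injective h
  exact Prod.ext h₁ h₂

theorem measurableEmbedding_downPt :
    MeasurableEmbedding (fun p : E3 × (Fin (M + 1) → E3) => downPt p.1 p.2) := by
  refine measurePreserving_downPt.measurable.measurableEmbedding fun p p' h => ?_
  simp only [downPt_eq] at h
  obtain ⟨h₁, h₂⟩ := pt_injective ((LinearIsometryEquiv.injective _) h)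
  exact Prod.ext h₁ h₂

theorem pairMap_zero_downPt (x : E3) (q : Fin (M + 1) → E3) :
    pairMap 0 (downPt x q) = pt (x + q 0) ((0 : Fin (M + 1)).removeNth q) := by
  rw [downPt, pairMap_pt, Fin.cons_zero, add_comm]
  rfl

theorem rest_downPt_zero (x : E3) (q : Fin (M + 1) → E3) : rest (downPt x q) 0 = x := rfl

theorem hasInt_up_section {X : Conf M → ℂ} (hXm : Measurable X)
    (hX : Integrable fun w => (1 + ‖w‖ ^ 2) * ‖X w‖ ^ 2) (hm : 0 < m) (hμ : 0 < μ)
    (i : Fin (M + 1)) (x : E3) :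
    HasInt (fun q : Fin (M + 1) → E3 =>
        ‖x‖ ^ 2 * (greenSymbol m μ (pt x q) ^ 2 * ‖chargeTerm X i (pt x q)‖ ^ 2)) volume
      ((pairFactor m ^ 2)⁻¹ * ∫ w, ‖X w‖ ^ 2 *
        (‖x‖ ^ 2 / (‖x - (m / (m + 1)) • w 0‖ ^ 2 + pairWidth m μ w ^ 2) ^ 2)) := by
  refine (((HasInt.of_integrable (integrable_diag_section hXm hX hm hμ (m / (m + 1)) x)).const_mul
    (pairFactor m ^ 2)⁻¹).comp (measurePreserving_pair_section i x)
    (measurableEmbedding_pair_section i x)).congr (Eventually.of_forall fun q => ?_)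
  simp only [norm_chargeTerm]
  rw [greenSymbol_eq_pair i, pairMap_pt, pairDenom_eq hm hμ, inv_pow, mul_pow, mul_inv,
    div_eq_mul_inv]
  simp only [pt_zero]
  ring

/-- The total pair momentum is symmetric in the two partners; with the fermion momentum fixed, the
resolvent is centred at the fraction 1/(m+1). -/
theorem hasInt_down_section {X : Conf M → ℂ} (hXm : Measurable X)
    (hX : Integrable fun w => (1 + ‖w‖ ^ 2) * ‖X w‖ ^ 2) (hm : 0 < m) (hμ : 0 < μ) (x : E3) :
    HasInt (fun q : Fin (M + 1) → E3 =>
        ‖x‖ ^ 2 * (greenSymbol m μ (downPt x q) ^ 2 * ‖chargeTerm X 0 (downPt x q)‖ ^ 2)) volume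
      ((pairFactor m ^ 2)⁻¹ * ∫ w, ‖X w‖ ^ 2 *
        (‖x‖ ^ 2 / (‖x - (1 / (m + 1)) • w 0‖ ^ 2 + pairWidth m μ w ^ 2) ^ 2)) := by
  refine (((HasInt.of_integrable (integrable_diag_section hXm hX hm hμ (1 / (m + 1)) x)).const_mul
    (pairFactor m ^ 2)⁻¹).comp (measurePreserving_pair_section 0 x)
    (measurableEmbedding_pair_section 0 x)).congr (Eventually.of_forall fun q => ?_)
  simp only [norm_chargeTerm]
  have h : downPt x q 0 = pairMap 0 (downPt x q) 0 - x := by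
    rw [pairMap_zero, rest_downPt_zero, add_sub_cancel_right]
  rw [greenSymbol_eq_pair 0, h, pairDenom_sub_eq hm hμ, pairMap_zero_downPt, inv_pow, mul_pow,
    mul_inv, div_eq_mul_inv]
  ring

/-- The part of `k₀² |Ψ|²` that is integrable. -/
def regularUp (m μ : ℝ) (X : Conf M → ℂ) (Ψ : Conf (M + 1) → ℂ) (k : Conf (M + 1)) : ℝ :=
  ‖k 0‖ ^ 2 * (‖Ψ k‖ ^ 2 - ∑ i, greenSymbol m μ k ^ 2 * ‖chargeTerm X i k‖ ^ 2)

/-- The part of `k_l² |Ψ|²` that is integrable. -/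
def regularDown (m μ : ℝ) (X : Conf M → ℂ) (Ψ : Conf (M + 1) → ℂ) (l : Fin (M + 1))
    (k : Conf (M + 1)) : ℝ :=
  ‖rest k l‖ ^ 2 * (‖Ψ k‖ ^ 2 - greenSymbol m μ k ^ 2 * ‖chargeTerm X l k‖ ^ 2)

theorem density_up_eq {X : Conf M → ℂ} (hXm : Measurable X)
    (hX : Integrable fun w => (1 + ‖w‖ ^ 2) * ‖X w‖ ^ 2) (hm : 0 < m) (hμ : 0 < μ)
    {Ψ : Conf (M + 1) → ℂ} (h : Integrable (regularUp m μ X Ψ)) :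
    (fun x => ‖x‖ ^ 2 * ∫ q : Fin (M + 1) → E3, ‖Ψ (pt x q)‖ ^ 2) =ᵐ[volume] fun x =>
      (∫ q, regularUp m μ X Ψ (pt x q)) + (M + 1) * ((pairFactor m ^ 2)⁻¹ * ∫ w, ‖X w‖ ^ 2 *
        (‖x‖ ^ 2 / (‖x - (m / (m + 1)) • w 0‖ ^ 2 + pairWidth m μ w ^ 2) ^ 2)) := by
  have h₁ := ((measurePreserving_pt (M + 1)).integrable_comp_emb measurableEmbedding_pt).2 h
  filter_upwards [Integrable.prod_right_ae h₁] with x hx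
  have h₂ := (HasInt.of_integrable hx).add (HasInt.sum Finset.univ fun i _ =>
    hasInt_up_section hXm hX hm hμ i x)
  rw [← integral_const_mul]
  refine (h₂.congr (Eventually.of_forall fun q => ?_)).2.trans ?_
  · simp only [Function.comp_apply, regularUp, pt_zero, ← Finset.mul_sum]
    ring
  · simp only [Finset.sum_const, Finset.card_univ, Fintype.card_fin, nsmul_eq_mul,
      Function.comp_apply]
    push_cast
    rfl

/-- A fermion momentum has a slow tail only in the term where this fermion is paired, so a single
diagonal term is split off. The distinguished particle belongs to every pair, whence the factor M +
1 in `density_up_eq`. -/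
theorem density_down_eq {X : Conf M → ℂ} (hXm : Measurable X)
    (hX : Integrable fun w => (1 + ‖w‖ ^ 2) * ‖X w‖ ^ 2) (hm : 0 < m) (hμ : 0 < μ)
    {Ψ : Conf (M + 1) → ℂ} (h : Integrable (regularDown m μ X Ψ 0)) :
    (fun x => ‖x‖ ^ 2 * ∫ q : Fin (M + 1) → E3, ‖Ψ (downPt x q)‖ ^ 2) =ᵐ[volume] fun x =>
      (∫ q, regularDown m μ X Ψ 0 (downPt x q)) + (pairFactor m ^ 2)⁻¹ * ∫ w, ‖X w‖ ^ 2 *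
        (‖x‖ ^ 2 / (‖x - (1 / (m + 1)) • w 0‖ ^ 2 + pairWidth m μ w ^ 2) ^ 2) := by
  have h₁ := (measurePreserving_downPt.integrable_comp_emb measurableEmbedding_downPt).2 h
  filter_upwards [Integrable.prod_right_ae h₁] with x hx
  have h₂ := (HasInt.of_integrable hx).add (hasInt_down_section hXm hX hm hμ x)
  rw [← integral_const_mul]
  refine (h₂.congr (Eventually.of_forall fun q => ?_)).2
  simp only [Function.comp_apply, regularDown, rest_downPt_zero]
  ring

theorem kinetic_permConf (σ : Equiv.Perm (Fin M)) (k : Conf M) :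
    kinetic m (permConf σ k) = kinetic m k := by
  rw [kinetic, kinetic, permConf_zero]
  simp only [rest_permConf]
  rw [Equiv.sum_comp σ fun i => ‖rest k i‖ ^ 2]

theorem greenSymbol_permConf (σ : Equiv.Perm (Fin M)) (k : Conf M) :
    greenSymbol m μ (permConf σ k) = greenSymbol m μ k := by
  rw [greenSymbol_eq_kinetic, greenSymbol_eq_kinetic, kinetic_permConf]

theorem norm_intSign_mul {ι : Type*} [Fintype ι] [DecidableEq ι] (σ : Equiv.Perm ι) (z : ℂ) :
    ‖((Equiv.Perm.sign σ : ℤ) : ℂ) * z‖ = ‖z‖ := by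
  rcases Int.units_eq_one_or (Equiv.Perm.sign σ) with h | h <;> simp [h]

/-- The energy involves all fermions, the density only the first one; antisymmetry makes their
contributions equal. -/
theorem integral_regularDown_eq {X : Conf M → ℂ} (hX : AEAntisymm X) {Ψ : Conf (M + 1) → ℂ}
    (hΨ : AEAntisymm Ψ) (l : Fin (M + 1)) :
    ∫ k, regularDown m μ X Ψ l k = ∫ k, regularDown m μ X Ψ 0 k := by
  rw [← (measurePreserving_permConf (Equiv.swap 0 l)).integral_comp
    (measurableEmbedding_permConf (Equiv.swap 0 l)) (regularDown m μ X Ψ 0)]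
  refine integral_congr_ae ?_
  filter_upwards [hX.chargeTerm_permConf (Equiv.swap 0 l) 0, hΨ (Equiv.swap 0 l)] with k h₁ h₂
  simp only [regularDown, h₁, h₂, norm_intSign_mul, greenSymbol_permConf, rest_permConf,
    Equiv.swap_apply_left]

end

/-! ### Restriction to the coincidence plane on the Fourier side. -/

section

variable {M : ℕ} {m μ : ℝ}

/-- The point with momentum `x` of the distinguished particle and total momentum `w 0` of the pair
that it forms with the last particle. -/
def joinLast (x : E3) (w : Conf M) : Conf (M + 1) :=
  pt x (Fin.snoc (α := fun _ => E3) (rest w) (w 0 - x))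

theorem pairMap_joinLast (x : E3) (w : Conf M) : pairMap (Fin.last M) (joinLast x w) = w := by
  rw [joinLast, pairMap_pt, Fin.snoc_last, add_sub_cancel, Fin.removeNth_last, Fin.init_snoc,
    pt_rest]

theorem joinLast_pairMap (k : Conf (M + 1)) : joinLast (k 0) (pairMap (Fin.last M) k) = k := by
  have h : rest (pairMap (Fin.last M) k) = Fin.init (rest k) := by
    rw [pairMap, rest_pt, Fin.removeNth_last]
  rw [joinLast, h, pairMap_zero, add_sub_cancel_left, Fin.snoc_init_self, pt_rest]

theorem continuous_joinLast : Continuous fun p : E3 × Conf M => joinLast p.1 p.2 := by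
  refine continuous_pt.comp (continuous_fst.prodMk (continuous_pi fun i => ?_))
  refine Fin.lastCases ?_ (fun i => ?_) i
  · exact (by fun_prop : Continuous fun p : E3 × Conf M => p.2 0 - p.1).congr
      fun p => (Fin.snoc_last (α := fun _ => E3) (p.2 0 - p.1) (rest p.2)).symm
  · exact (by fun_prop : Continuous fun p : E3 × Conf M => p.2 i.succ).congr
      fun p => (Fin.snoc_castSucc (α := fun _ => E3) (p.2 0 - p.1) (rest p.2) i).symm

theorem integral_joinLast {G : Conf (M + 1) → ℂ} (hG : Integrable G) :
    HasInt (fun w => ∫ x, G (joinLast x w)) volume (∫ k, G k) := by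
  have h : HasInt (fun p : E3 × Conf M => G (joinLast p.1 p.2)) (volume.prod volume)
      (∫ k, G k) := by
    rw [← HasInt.comp_iff (measurePreserving_splitMap (Fin.last M))
      (measurableEmbedding_splitMap (Fin.last M))]
    simp only [splitMap, joinLast_pairMap]
    exact HasInt.of_integrable hG
  exact ⟨h.1.integral_prod_right, by rw [← integral_prod_symm _ h.1, h.2]⟩

theorem coincidence_zero (x : Conf M) : coincidence x 0 = x 0 := rfl

theorem coincidence_last (x : Conf M) : coincidence x (Fin.last M).succ = x 0 := by
  rw [coincidence, pt_succ, Fin.snoc_last]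

theorem coincidence_castSucc (x : Conf M) (i : Fin M) :
    coincidence x i.castSucc.succ = x i.succ := by
  rw [coincidence, pt_succ, Fin.snoc_castSucc]
  rfl

theorem conf_ext_last {x y : Conf (M + 1)} (h₀ : x 0 = y 0)
    (h₁ : x (Fin.last M).succ = y (Fin.last M).succ)
    (h₂ : ∀ i : Fin M, x i.castSucc.succ = y i.castSucc.succ) : x = y :=
  PiLp.ext fun i => Fin.cases h₀ (fun i => Fin.lastCases h₁ h₂ i) i

theorem coincidence_add (x y : Conf M) : coincidence (x + y) = coincidence x + coincidence y := by
  refine conf_ext_last rfl ?_ fun i => ?_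
  · rw [PiLp.add_apply, coincidence_last, coincidence_last, coincidence_last, PiLp.add_apply]
  · rw [PiLp.add_apply, coincidence_castSucc, coincidence_castSucc, coincidence_castSucc,
      PiLp.add_apply]

theorem coincidence_sub (x y : Conf M) : coincidence (x - y) = coincidence x - coincidence y := by
  rw [eq_sub_iff_add_eq, ← coincidence_add, sub_add_cancel]

theorem coincidence_smul (c : ℝ) (x : Conf M) : coincidence (c • x) = c • coincidence x := by
  refine conf_ext_last rfl ?_ fun i => ?_
  · rw [PiLp.smul_apply, coincidence_last, coincidence_last, PiLp.smul_apply]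
  · rw [PiLp.smul_apply, coincidence_castSucc, coincidence_castSucc, PiLp.smul_apply]

/-- The last pair map is the adjoint of the embedding of the plane; hence restriction in position is
integration along the fibres of `pairMap` in momentum. -/
theorem inner_pairMap_last (k : Conf (M + 1)) (y : Conf M) :
    inner ℝ (pairMap (Fin.last M) k) y = inner ℝ k (coincidence y) := by
  rw [PiLp.inner_apply, PiLp.inner_apply, Fin.sum_univ_succ, Fin.sum_univ_succ,
    Fin.sum_univ_castSucc (n := M)]
  have h₁ : ∀ i : Fin M, pairMap (Fin.last M) k i.succ = k i.castSucc.succ := fun i => by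
    change rest (pairMap (Fin.last M) k) i = _
    rw [rest_pairMap, Fin.succAbove_last]
    rfl
  simp only [h₁, coincidence_castSucc, coincidence_last, coincidence_zero]
  rw [pairMap_zero, inner_add_left]
  simp only [rest]
  ring

/-- The power 4 exceeds the dimension 3 of the fibres, so this bound dominates the fibre integrals.
-/
theorem exists_schwartz_bound (F : 𝓢(Conf M, ℂ)) :
    ∃ C : ℝ, ∀ k, ‖F k‖ ≤ C * (1 + ‖k‖) ^ (-(4 : ℝ)) := by
  obtain ⟨C₀, h₀, hC₀⟩ := F.decay 0 0
  obtain ⟨C₄, h₄, hC₄⟩ := F.decay 4 0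
  refine ⟨8 * (C₀ + C₄), fun k => ?_⟩
  have e₀ := hC₀ k
  have e₄ := hC₄ k
  rw [norm_iteratedFDeriv_zero] at e₀ e₄
  rw [pow_zero, one_mul] at e₀
  have hp : (0 : ℝ) < 1 + ‖k‖ := by positivity
  rw [Real.rpow_neg hp.le, ← div_eq_mul_inv, le_div_iff₀ (by positivity)]
  have e : (1 + ‖k‖) ^ (4 : ℝ) = (1 + ‖k‖) ^ (4 : ℕ) := by exact_mod_cast Real.rpow_natCast _ 4
  rw [e]
  have hle : (1 + ‖k‖) ^ 4 ≤ 8 * (1 + ‖k‖ ^ 4) := by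
    nlinarith [sq_nonneg (‖k‖ - 1), sq_nonneg (‖k‖ ^ 2 - 1), sq_nonneg (‖k‖ ^ 2 - ‖k‖),
      norm_nonneg k]
  nlinarith [mul_le_mul_of_nonneg_left hle (norm_nonneg (F k))]

theorem norm_le_norm_joinLast (x : E3) (w : Conf M) : ‖x‖ ≤ ‖joinLast x w‖ :=
  PiLp.norm_apply_le (joinLast x w) 0

theorem continuous_integral_joinLast (F : 𝓢(Conf (M + 1), ℂ)) :
    Continuous fun w => ∫ x, F (joinLast x w) := by
  obtain ⟨C, hC⟩ := exists_schwartz_bound F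
  have hC0 : 0 ≤ C := by
    have := (norm_nonneg _).trans (hC 0)
    simpa using this
  refine continuous_of_dominated (bound := fun x : E3 => C * (1 + ‖x‖) ^ (-(4 : ℝ)))
    (fun w => ?_) (fun w => Eventually.of_forall fun x => ?_) ?_
    (Eventually.of_forall fun x => ?_)
  · exact (F.continuous.comp (continuous_joinLast.comp
      (Continuous.prodMk_left w))).aestronglyMeasurable
  · refine (hC _).trans (mul_le_mul_of_nonneg_left ?_ hC0)
    exact Real.rpow_le_rpow_of_nonpos (by positivity)
      (by linarith [norm_le_norm_joinLast x w]) (by norm_num)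
  · refine Integrable.const_mul (integrable_one_add_norm ?_) C
    rw [finrank_euclideanSpace_fin]
    norm_num
  · exact F.continuous.comp (continuous_joinLast.comp (Continuous.prodMk_right x))

theorem isLinearMap_coincidence : IsLinearMap ℝ (coincidence (M := M)) :=
  ⟨coincidence_add, coincidence_smul⟩

theorem continuous_coincidence : Continuous (coincidence (M := M)) := by
  refine continuous_pt.comp (Continuous.prodMk (f := fun x : Conf M => x 0) (by fun_prop)
    (continuous_pi fun i => ?_))
  refine Fin.lastCases ?_ (fun i => ?_) i
  · exact (by fun_prop : Continuous fun x : Conf M => x 0).congr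
      fun x => (Fin.snoc_last (α := fun _ => E3) (x 0) (rest x)).symm
  · exact (by fun_prop : Continuous fun x : Conf M => x i.succ).congr
      fun x => (Fin.snoc_castSucc (α := fun _ => E3) (x 0) (rest x) i).symm

/-- The plane of coincidence, as a linear map. -/
def coincidenceCLM (M : ℕ) : Conf M →L[ℝ] Conf (M + 1) :=
  ⟨isLinearMap_coincidence.mk' coincidence, continuous_coincidence⟩

theorem coincidenceCLM_apply (x : Conf M) : coincidenceCLM M x = coincidence x := rfl

theorem norm_le_norm_coincidence (x : Conf M) : ‖x‖ ≤ ‖coincidence x‖ := by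
  refine le_of_sq_le_sq ?_ (norm_nonneg _)
  rw [norm_sq_conf, norm_sq_conf, Fin.sum_univ_castSucc (n := M), coincidence, rest_pt, pt_zero,
    Fin.snoc_last]
  simp only [Fin.snoc_castSucc]
  linarith [sq_nonneg ‖x 0‖]

theorem antilipschitz_coincidence : AntilipschitzWith 1 (coincidenceCLM M) := by
  refine AntilipschitzWith.of_le_mul_dist fun x y => ?_
  rw [NNReal.coe_one, one_mul, dist_eq_norm, dist_eq_norm, coincidenceCLM_apply,
    coincidenceCLM_apply, ← coincidence_sub]
  exact norm_le_norm_coincidence (x - y)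

/-- The restriction of a Schwartz function to the plane of coincidence. -/
def restrictSchwartz (f : 𝓢(Conf (M + 1), ℂ)) : 𝓢(Conf M, ℂ) :=
  SchwartzMap.compCLMOfAntilipschitz ℂ (coincidenceCLM M).hasTemperateGrowth
    antilipschitz_coincidence f

theorem restrictSchwartz_apply (f : 𝓢(Conf (M + 1), ℂ)) (x : Conf M) :
    restrictSchwartz f x = f (coincidence x) := rfl

/-- The inverse transform of the fibre integral h is the restriction, by Fubini and
`inner_pairMap_last`. Fourier inversion returns h itself, since h is continuous and both h and its
transform are integrable. -/
theorem fourier_restrictSchwartz (f : 𝓢(Conf (M + 1), ℂ)) (w : Conf M) :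
    𝓕 (restrictSchwartz f) w = ∫ x, (𝓕 f) (joinLast x w) := by
  set h : Conf M → ℂ := fun w => ∫ x, (𝓕 f) (joinLast x w) with hh
  have hi : Integrable h := (integral_joinLast (𝓕 f).integrable).1
  have hinv : 𝓕⁻ h = restrictSchwartz f := by
    funext y
    have h₁ : (𝓕⁻ (𝓕 f)) (coincidence y) = f (coincidence y) := by
      rw [FourierTransform.fourierInv_fourier_eq]
    rw [restrictSchwartz_apply, ← h₁, SchwartzMap.fourierInv_coe, Real.fourierInv_eq,
      Real.fourierInv_eq]
    have hint : Integrable fun k : Conf (M + 1) =>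
        Real.fourierChar (inner ℝ (pairMap (Fin.last M) k) y) • (𝓕 f) k := by
      refine (𝓕 f).integrable.mono ?_ (Eventually.of_forall fun k => ?_)
      · refine Continuous.aestronglyMeasurable ?_
        exact (Real.continuous_fourierChar.comp ((continuous_pairMap _).inner
          continuous_const)).smul (𝓕 f).continuous
      · rw [Circle.norm_smul]
    have e := (integral_joinLast hint).2
    simp only [pairMap_joinLast] at e
    simp only [inner_pairMap_last] at e
    rw [← e]
    refine integral_congr_ae (Eventually.of_forall fun v => ?_)
    simp only [hh, Circle.smul_def]
    rw [integral_smul]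
  have hc : Continuous h := continuous_integral_joinLast (𝓕 f)
  have hF : Integrable (𝓕 h) := by
    have : 𝓕 h = fun y => restrictSchwartz f (-y) := by
      funext y
      rw [← hinv, Real.fourierInv_eq_fourier_neg, neg_neg]
    rw [this]
    exact ((LinearIsometryEquiv.neg ℝ (E := Conf M)).measurePreserving.integrable_comp_emb
      (LinearIsometryEquiv.neg ℝ (E := Conf M)).toHomeomorph.measurableEmbedding).2
      (restrictSchwartz f).integrable
  have := hc.fourier_fourierInv_eq hi hF
  rw [hinv] at this
  rw [SchwartzMap.fourier_coe]
  exact congrFun this w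

end

/-! ### The trace of the regular part paired with the charge. -/

section

variable {M : ℕ} {m μ : ℝ}

theorem hat_toLp (f : 𝓢(Conf M, ℂ)) :
    hat (f.toLp 2 volume) =ᵐ[volume] fun k =>
      (((2 * Real.pi) ^ (-(3 * ((M : ℝ) + 1)) / 2) : ℝ) : ℂ) * (𝓕 f) ((2 * Real.pi)⁻¹ • k) := by
  have h : (𝓕 (f.toLp 2 volume) : L2 M) =ᵐ[volume] ((𝓕 f : 𝓢(Conf M, ℂ)) : Conf M → ℂ) := by
    rw [SchwartzMap.toLp_fourier_eq]
    exact SchwartzMap.coeFn_toLp _ _ _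
  filter_upwards [ae_comp_scale h] with k hk
  rw [hat, hk]

theorem joinLast_smul (s : ℝ) (x : E3) (w : Conf M) :
    joinLast (s • x) (s • w) = s • joinLast x w := by
  refine conf_ext_last rfl ?_ fun i => ?_
  · simp only [joinLast, PiLp.smul_apply, pt_succ, Fin.snoc_last, smul_sub]
  · simp only [joinLast, PiLp.smul_apply, pt_succ, Fin.snoc_castSucc]
    rfl

/-- Rescaling the fibre integral gives (2π)⁻³; with the two normalisations, whose exponents differ
by 3/2, this leaves (2π)^(−3/2), the constant of the boundary condition. -/
theorem hat_restrictSchwartz (f : 𝓢(Conf (M + 1), ℂ)) :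
    hat ((restrictSchwartz f).toLp 2 volume) =ᵐ[volume] fun w =>
      ((((2 * Real.pi) ^ (3 / 2 : ℝ))⁻¹ : ℝ) : ℂ) * ∫ x,
        (((2 * Real.pi) ^ (-(3 * (((M + 1 : ℕ) : ℝ) + 1)) / 2) : ℝ) : ℂ) *
          (𝓕 f) ((2 * Real.pi)⁻¹ • joinLast x w) := by
  have hπ : 0 < 2 * Real.pi := by positivity
  filter_upwards [hat_toLp (restrictSchwartz f)] with w hw
  have h₁ : ∫ x, (𝓕 f) (joinLast x ((2 * Real.pi)⁻¹ • w)) =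
      (((2 * Real.pi) ^ (-3 : ℝ) : ℝ) : ℂ) *
        ∫ x, (𝓕 f) ((2 * Real.pi)⁻¹ • joinLast x w) := by
    have e := Measure.integral_comp_smul (volume : Measure E3)
      (fun x => (𝓕 f) (joinLast x ((2 * Real.pi)⁻¹ • w))) (2 * Real.pi)⁻¹
    simp only [joinLast_smul] at e
    rw [e, finrank_euclideanSpace_fin, Complex.real_smul, ← mul_assoc, ← Complex.ofReal_mul,
      abs_of_pos (by positivity)]
    have : (2 * Real.pi) ^ (-3 : ℝ) * (((2 * Real.pi)⁻¹ ^ 3)⁻¹) = 1 := by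
      rw [inv_pow, inv_inv, ← Real.rpow_natCast, ← Real.rpow_add hπ]
      norm_num
    rw [this, Complex.ofReal_one, one_mul]
  rw [hw, fourier_restrictSchwartz, h₁, integral_const_mul, ← mul_assoc, ← mul_assoc,
    ← Complex.ofReal_mul, ← Complex.ofReal_mul, ← Real.rpow_neg hπ.le, ← Real.rpow_add hπ,
    ← Real.rpow_add hπ]
  have e : -(3 * ((M : ℝ) + 1)) / 2 + -3 =
      -(3 / 2) + -(3 * (((M + 1 : ℕ) : ℝ) + 1)) / 2 := by
    push_cast
    ring
  rw [e]

theorem inner_restrictSchwartz (f : 𝓢(Conf (M + 1), ℂ)) (ξ : L2 M)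
    (h : Integrable fun k => (starRingEnd ℂ) (hat (f.toLp 2 volume) k) *
      hat ξ (pairMap (Fin.last M) k)) :
    inner ℂ ((restrictSchwartz f).toLp 2 volume : L2 M) ξ =
      ((((2 * Real.pi) ^ (3 / 2 : ℝ))⁻¹ : ℝ) : ℂ) *
        ∫ k, (starRingEnd ℂ) (hat (f.toLp 2 volume) k) * hat ξ (pairMap (Fin.last M) k) := by
  have hae := hat_toLp f
  set H : Conf (M + 1) → ℂ := fun k =>
    (((2 * Real.pi) ^ (-(3 * (((M + 1 : ℕ) : ℝ) + 1)) / 2) : ℝ) : ℂ) *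
      (𝓕 f) ((2 * Real.pi)⁻¹ • k) with hH
  have hae' : (fun k => (starRingEnd ℂ) (hat (f.toLp 2 volume) k) *
      hat ξ (pairMap (Fin.last M) k)) =ᵐ[volume] fun k => (starRingEnd ℂ) (H k) *
      hat ξ (pairMap (Fin.last M) k) := by
    filter_upwards [hae] with k hk
    rw [hk]
  rw [inner_eq_integral, integral_congr_ae hae', ← (integral_joinLast (h.congr hae')).2,
    ← integral_const_mul]
  refine integral_congr_ae ?_
  filter_upwards [hat_restrictSchwartz f] with w hw
  simp only [pairMap_joinLast]
  rw [hw, integral_mul_const, integral_conj, map_mul, Complex.conj_ofReal, mul_assoc]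

/-- The Green symbol is at least a constant times (1+|k|²)⁻¹. Thus X ∘ `pairMap` pairs continuously
with H², although it need not be square integrable itself. -/
theorem memLp_weight_inv_pairMap (hm : 0 < m) (hμ : 0 < μ) {X : Conf M → ℂ} (hXm : Measurable X)
    (hX : Integrable fun w => (1 + ‖w‖ ^ 2) * ‖X w‖ ^ 2) (i : Fin (M + 1)) :
    MemLp (fun k => (((1 + ‖k‖ ^ 2)⁻¹ : ℝ) : ℂ) * X (pairMap i k)) 2 := by
  have hm1 : Measurable fun k : Conf (M + 1) => (((1 + ‖k‖ ^ 2)⁻¹ : ℝ) : ℂ) := by fun_prop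
  refine ((memLp_green_chargeTerm hm hμ hXm hX i).const_mul
    ((1 / (2 * m) + 1 / 2 + μ : ℝ) : ℂ)).mono
    (hm1.mul (hXm.comp (continuous_pairMap i).measurable)).aestronglyMeasurable
    (Eventually.of_forall fun k => ?_)
  have hG := greenSymbol_pos hm hμ k
  rw [norm_mul, norm_mul, norm_mul, norm_chargeTerm, ← mul_assoc, Complex.norm_real,
    Complex.norm_real, Complex.norm_real, Real.norm_of_nonneg (by positivity),
    Real.norm_of_nonneg (by positivity), Real.norm_of_nonneg hG.le]
  refine mul_le_mul_of_nonneg_right ?_ (norm_nonneg _)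
  have hk : 0 < kinetic m k + μ := add_pos_of_nonneg_of_pos (kinetic_nonneg hm k) hμ
  rw [greenSymbol_eq_kinetic, ← div_eq_mul_inv, le_div_iff₀ hk, inv_mul_le_iff₀ (by positivity),
    mul_comm (1 + ‖k‖ ^ 2)]
  exact kinetic_add_le hm hμ k

theorem sobolevENorm_two (u : L2 M) :
    sobolevENorm 2 u = eLpNorm (fun k => ((1 + ‖k‖ ^ 2 : ℝ) : ℂ) * hat u k) 2 volume := by
  rw [sobolevENorm]
  norm_num

theorem memLp_of_sobolevENorm_lt_top {u : L2 M} (h : sobolevENorm 2 u < ⊤) :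
    MemLp (fun k => ((1 + ‖k‖ ^ 2 : ℝ) : ℂ) * hat u k) 2 := by
  refine ⟨?_, sobolevENorm_two u ▸ h⟩
  have h₁ : Measurable fun k : Conf M => ((1 + ‖k‖ ^ 2 : ℝ) : ℂ) := by fun_prop
  exact (h₁.mul (measurable_hat u)).aestronglyMeasurable

theorem conj_mul_eq_weighted (u : L2 (M + 1)) (X : Conf M → ℂ) (i : Fin (M + 1))
    (k : Conf (M + 1)) :
    (starRingEnd ℂ) (hat u k) * X (pairMap i k) =
      (starRingEnd ℂ) (((1 + ‖k‖ ^ 2 : ℝ) : ℂ) * hat u k) *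
        ((((1 + ‖k‖ ^ 2)⁻¹ : ℝ) : ℂ) * X (pairMap i k)) := by
  have h : (((1 + ‖k‖ ^ 2 : ℝ) : ℂ)) * (((1 + ‖k‖ ^ 2)⁻¹ : ℝ) : ℂ) = 1 := by
    rw [← Complex.ofReal_mul, mul_inv_cancel₀ (by positivity), Complex.ofReal_one]
  rw [map_mul, Complex.conj_ofReal]
  linear_combination (-(starRingEnd ℂ) (hat u k) * X (pairMap i k)) * h

theorem integrable_conj_hat_mul_pairMap (hm : 0 < m) (hμ : 0 < μ) {X : Conf M → ℂ}
    (hXm : Measurable X) (hX : Integrable fun w => (1 + ‖w‖ ^ 2) * ‖X w‖ ^ 2) (i : Fin (M + 1))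
    {u : L2 (M + 1)} (hu : MemLp (fun k => ((1 + ‖k‖ ^ 2 : ℝ) : ℂ) * hat u k) 2) :
    Integrable fun k => (starRingEnd ℂ) (hat u k) * X (pairMap i k) := by
  simp only [conj_mul_eq_weighted]
  exact integrable_conj_mul_of_memLp hu (memLp_weight_inv_pairMap hm hμ hXm hX i)

theorem enorm_integral_conj_hat_mul_pairMap_le (hm : 0 < m) (hμ : 0 < μ) {X : Conf M → ℂ}
    (hXm : Measurable X) (hX : Integrable fun w => (1 + ‖w‖ ^ 2) * ‖X w‖ ^ 2) (i : Fin (M + 1))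
    (u : L2 (M + 1)) :
    ‖∫ k, (starRingEnd ℂ) (hat u k) * X (pairMap i k)‖ₑ ≤
      sobolevENorm 2 u * eLpNorm (fun k => (((1 + ‖k‖ ^ 2)⁻¹ : ℝ) : ℂ) * X (pairMap i k)) 2 := by
  have h₁ : Measurable fun k : Conf (M + 1) => ((1 + ‖k‖ ^ 2 : ℝ) : ℂ) := by fun_prop
  have h₂ : Measurable fun k : Conf (M + 1) =>
      (starRingEnd ℂ) (((1 + ‖k‖ ^ 2 : ℝ) : ℂ) * hat u k) :=
    Complex.continuous_conj.measurable.comp (h₁.mul (measurable_hat u))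
  have h := eLpNorm_smul_le_mul_eLpNorm (p := 2) (q := 2) (r := 1)
    (memLp_weight_inv_pairMap hm hμ hXm hX i).1 h₂.aestronglyMeasurable
  have h₃ : eLpNorm (fun k : Conf (M + 1) =>
      (starRingEnd ℂ) (((1 + ‖k‖ ^ 2 : ℝ) : ℂ) * hat u k)) 2 volume = sobolevENorm 2 u := by
    rw [sobolevENorm_two]
    exact eLpNorm_congr_norm_ae (Eventually.of_forall fun k => Complex.norm_conj _)
  rw [h₃] at h
  refine le_trans ?_ h
  rw [eLpNorm_one_eq_lintegral_enorm]
  simp only [conj_mul_eq_weighted]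
  exact enorm_integral_le_lintegral_enorm _

/-- The pairing of the trace with a function in `H¹`, in momentum space. -/
theorem inner_trace (hm : 0 < m) (hμ : 0 < μ) {φ : L2 (M + 1)} {g ξ : L2 M}
    (hφ : MemLp (fun k => ((1 + ‖k‖ ^ 2 : ℝ) : ℂ) * hat φ k) 2) (h : IsTrace φ g)
    (hX : Integrable fun w => (1 + ‖w‖ ^ 2) * ‖hat ξ w‖ ^ 2) :
    inner ℂ g ξ = ((((2 * Real.pi) ^ (3 / 2 : ℝ))⁻¹ : ℝ) : ℂ) *
      ∫ k, (starRingEnd ℂ) (hat φ k) * hat ξ (pairMap (Fin.last M) k) := by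
  obtain ⟨f, h₁, h₂⟩ := h
  have hXm := measurable_hat ξ
  have hφi := integrable_conj_hat_mul_pairMap hm hμ hXm hX (Fin.last M) hφ
  have hlim₁ : Tendsto (fun j => inner ℂ ((restrictSchwartz (f j)).toLp 2 volume : L2 M) ξ) atTop
      (𝓝 (inner ℂ g ξ)) := by
    refine Tendsto.inner ?_ tendsto_const_nhds
    rw [Lp.tendsto_Lp_iff_tendsto_eLpNorm']
    refine h₂.congr fun j => eLpNorm_congr_ae ?_
    filter_upwards [SchwartzMap.coeFn_toLp (restrictSchwartz (f j)) 2 volume] with x hx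
    rw [Pi.sub_apply, hx, restrictSchwartz_apply]
  -- Convergence in H² beats the functional, which is bounded by the dual weighted norm.
  have hlim₂ : Tendsto (fun j => ∫ k, (starRingEnd ℂ) (hat ((f j).toLp 2 volume - φ) k) *
      hat ξ (pairMap (Fin.last M) k)) atTop (𝓝 0) := by
    rw [tendsto_zero_iff_enorm_tendsto_zero]
    refine tendsto_of_tendsto_of_tendsto_of_le_of_le tendsto_const_nhds ?_ (fun _ => zero_le)
      fun j => enorm_integral_conj_hat_mul_pairMap_le hm hμ hXm hX (Fin.last M) _
    have := ENNReal.Tendsto.mul_const h₁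
      (Or.inr (memLp_weight_inv_pairMap hm hμ hXm hX (Fin.last M)).2.ne)
    rwa [zero_mul] at this
  have hlim₃ := (hlim₂.add_const (∫ k, (starRingEnd ℂ) (hat φ k) *
    hat ξ (pairMap (Fin.last M) k))).const_mul ((((2 * Real.pi) ^ (3 / 2 : ℝ))⁻¹ : ℝ) : ℂ)
  rw [zero_add] at hlim₃
  refine tendsto_nhds_unique hlim₁ (hlim₃.congr' ?_)
  -- The Sobolev norm takes values in [0, ∞]; only eventually is it finite, so that the differences
  -- can be integrated separately.
  filter_upwards [h₁.eventually (gt_mem_nhds ENNReal.zero_lt_top)] with j hj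
  have hd := integrable_conj_hat_mul_pairMap hm hμ hXm hX (Fin.last M)
    (memLp_of_sobolevENorm_lt_top hj)
  have hsum := ((HasInt.of_integrable hd).add (HasInt.of_integrable hφi)).congr
    (g := fun k => (starRingEnd ℂ) (hat ((f j).toLp 2 volume) k) *
      hat ξ (pairMap (Fin.last M) k)) (by
    filter_upwards [hat_sub ((f j).toLp 2 volume) φ] with k hk
    rw [hk, map_sub]
    ring)
  rw [inner_restrictSchwartz (f j) ξ hsum.1, hsum.2]

end

/-! ### The quadratic form of Γ. -/

section

variable {M n : ℕ} {m μ : ℝ}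

/-- The point with momentum `x` of the distinguished particle and total momentum `w 0` of the pair
that it forms with the first of the other particles. -/
def joinFirst (x : E3) (w : Conf M) : Conf (M + 1) :=
  pt x (Fin.cons (w 0 - x) (rest w) : Fin (M + 1) → E3)

theorem joinFirst_pairMap (k : Conf (M + 1)) : joinFirst (k 0) (pairMap 0 k) = k := by
  have h : rest (pairMap 0 k) = Fin.tail (rest k) := rfl
  rw [joinFirst, h, pairMap_zero, add_sub_cancel_left, Fin.cons_self_tail, pt_rest]

theorem integral_joinFirst {G : Conf (M + 1) → ℂ} (hG : Integrable G) :
    HasInt (fun w => ∫ s, G (pt (w 0 - s) (Fin.cons s (rest w) : Fin (M + 1) → E3))) volume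
      (∫ k, G k) := by
  have h : HasInt (fun p : E3 × Conf M => G (joinFirst p.1 p.2)) (volume.prod volume)
      (∫ k, G k) := by
    rw [← HasInt.comp_iff (measurePreserving_splitMap 0) (measurableEmbedding_splitMap 0)]
    simp only [splitMap, joinFirst_pairMap]
    exact HasInt.of_integrable hG
  have h' : HasInt (fun w => ∫ x, G (joinFirst x w)) volume (∫ k, G k) :=
    ⟨h.1.integral_prod_right, by rw [← integral_prod_symm _ h.1, h.2]⟩
  refine h'.congr (Eventually.of_forall fun w => ?_)
  simp only
  rw [← integral_sub_left_eq_self _ volume (w 0)]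
  refine integral_congr_ae (Eventually.of_forall fun s => ?_)
  simp only [joinFirst, sub_sub_cancel]

/-- The off-diagonal part of `gammaHat`. -/
def offGamma (m μ : ℝ) (X : Conf (n + 1) → ℂ) (k : Conf (n + 1)) : ℂ :=
  ∑ j : Fin (n + 1), (-1) ^ (j : ℕ) *
    ∫ s : E3, (greenSymbol m μ (pt (k 0 - s) (Fin.cons s (rest k) : Fin (n + 2) → E3)) : ℂ) *
      X (pt (k 0 + rest k j - s) (Fin.cons s (j.removeNth (rest k)) : Fin (n + 1) → E3))

theorem gammaHat_eq (ξ : L2 (n + 1)) (k : Conf (n + 1)) :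
    gammaHat m μ ξ k = (diagSymbol m μ k : ℂ) * hat ξ k + offGamma m μ (hat ξ) k := rfl

theorem pairMap_succ_cons (w : Conf (n + 1)) (s : E3) (j : Fin (n + 1)) :
    pairMap j.succ (pt (w 0 - s) (Fin.cons s (rest w) : Fin (n + 2) → E3)) =
      pt (w 0 + rest w j - s) (Fin.cons s (j.removeNth (rest w)) : Fin (n + 1) → E3) := by
  rw [pairMap_pt, Fin.cons_succ, sub_add_eq_add_sub]
  congr 1
  funext l
  refine Fin.cases ?_ (fun l => ?_) l
  · simp [Fin.removeNth]
  · simp [Fin.removeNth, Fin.succ_succAbove_succ]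

theorem pairMap_zero_cons (w : Conf M) (s : E3) :
    pairMap 0 (pt (w 0 - s) (Fin.cons s (rest w) : Fin (M + 1) → E3)) = w := by
  rw [pairMap_pt, Fin.cons_zero, sub_add_cancel]
  exact pt_rest w

/-- The j-th integral of Γ couples the pair 0 to the pair j + 1, whose charge term carries
(−1)^(j+1) instead of (−1)^j. This shift is the origin of the minus sign. -/
theorem offGamma_eq (X : Conf (n + 1) → ℂ) (w : Conf (n + 1)) :
    (starRingEnd ℂ) (X w) * offGamma m μ X w = ∑ j : Fin (n + 1), -∫ s : E3,
      (fun k : Conf (n + 2) => (greenSymbol m μ k : ℂ) *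
        ((starRingEnd ℂ) (chargeTerm X 0 k) * chargeTerm X j.succ k))
          (pt (w 0 - s) (Fin.cons s (rest w) : Fin (n + 2) → E3)) := by
  rw [offGamma, Finset.mul_sum]
  refine Finset.sum_congr rfl fun j _ => ?_
  rw [← mul_assoc, ← integral_const_mul, ← integral_neg]
  refine integral_congr_ae (Eventually.of_forall fun s => ?_)
  simp only [chargeTerm, pairMap_zero_cons, pairMap_succ_cons, Fin.val_succ, Fin.val_zero, pow_zero,
    one_mul, pow_succ]
  ring

theorem hasInt_conj_mul_offGamma (hm : 0 < m) (hμ : 0 < μ) {X : Conf (n + 1) → ℂ}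
    (hXm : Measurable X) (hX : Integrable fun w => (1 + ‖w‖ ^ 2) * ‖X w‖ ^ 2) :
    HasInt (fun w => (starRingEnd ℂ) (X w) * offGamma m μ X w) volume
      (-∑ j ∈ Finset.univ.erase 0, ∫ k : Conf (n + 2), (greenSymbol m μ k : ℂ) *
        ((starRingEnd ℂ) (chargeTerm X 0 k) * chargeTerm X j k)) := by
  simp only [offGamma_eq]
  have h := HasInt.sum Finset.univ fun (j : Fin (n + 1)) _ =>
    (⟨(integral_joinFirst (integrable_green_conj_chargeTerm_mul hm hμ hXm hX
      (Fin.succ_ne_zero j).symm)).1.neg, by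
        rw [integral_neg', (integral_joinFirst (integrable_green_conj_chargeTerm_mul hm hμ hXm hX
          (Fin.succ_ne_zero j).symm)).2]⟩ : HasInt _ volume (-∫ k : Conf (n + 2),
            (greenSymbol m μ k : ℂ) *
              ((starRingEnd ℂ) (chargeTerm X 0 k) * chargeTerm X j.succ k)))
  refine h.congr_val ?_
  rw [Finset.sum_neg_distrib, neg_inj]
  -- Adding the term j = 0 to both sides turns the sum over the erased set into a full sum, which
  -- splits off its head.
  refine add_left_cancel (a := ∫ k : Conf (n + 2), (greenSymbol m μ k : ℂ) *
    ((starRingEnd ℂ) (chargeTerm X 0 k) * chargeTerm X 0 k)) ?_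
  rw [Finset.add_sum_erase Finset.univ (fun j => ∫ k : Conf (n + 2), (greenSymbol m μ k : ℂ) *
    ((starRingEnd ℂ) (chargeTerm X 0 k) * chargeTerm X j k)) (Finset.mem_univ 0)]
  exact (Fin.sum_univ_succ fun j => ∫ k : Conf (n + 2), (greenSymbol m μ k : ℂ) *
    ((starRingEnd ℂ) (chargeTerm X 0 k) * chargeTerm X j k)).symm

theorem sum_conj_chargeTerm_mul (X : Conf M → ℂ) (k : Conf (M + 1)) :
    ∑ i, ∑ j ∈ Finset.univ.erase i, (starRingEnd ℂ) (chargeTerm X i k) * chargeTerm X j k =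
      (offSum X k : ℂ) := by
  have hsq : ∀ z : ℂ, (starRingEnd ℂ) z * z = ((‖z‖ ^ 2 : ℝ) : ℂ) := fun z => by
    rw [mul_comm, Complex.mul_conj, Complex.normSq_eq_norm_sq]
  have h₁ := hsq (chargeSum X k)
  rw [norm_sq_chargeSum, chargeSum, map_sum, Finset.sum_mul_sum, Complex.ofReal_add] at h₁
  have h₂ : ∀ i, ∑ j, (starRingEnd ℂ) (chargeTerm X i k) * chargeTerm X j k =
      ((‖chargeTerm X i k‖ ^ 2 : ℝ) : ℂ) + ∑ j ∈ Finset.univ.erase i,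
        (starRingEnd ℂ) (chargeTerm X i k) * chargeTerm X j k := fun i => by
    rw [← hsq, Finset.add_sum_erase Finset.univ
      (fun j => (starRingEnd ℂ) (chargeTerm X i k) * chargeTerm X j k) (Finset.mem_univ i)]
  simp only [h₂] at h₁
  rw [Finset.sum_add_distrib, Complex.ofReal_sum] at h₁
  exact add_left_cancel h₁

/-- Exchanging particles 0 and i multiplies both charge terms by the same sign, which squares to
one; every row of the double sum therefore equals the row of 0. -/
theorem integral_green_chargeTerm_swap {X : Conf M → ℂ} (hX : AEAntisymm X) (i : Fin (M + 1)) :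
    ∑ j ∈ Finset.univ.erase i, ∫ k : Conf (M + 1), (greenSymbol m μ k : ℂ) *
        ((starRingEnd ℂ) (chargeTerm X i k) * chargeTerm X j k) =
      ∑ j ∈ Finset.univ.erase 0, ∫ k : Conf (M + 1), (greenSymbol m μ k : ℂ) *
        ((starRingEnd ℂ) (chargeTerm X 0 k) * chargeTerm X j k) := by
  symm
  refine Finset.sum_equiv (Equiv.swap 0 i) (fun j => ?_) fun j _ => ?_
  · simp only [Finset.mem_erase, Finset.mem_univ, and_true, ne_eq]
    rw [Equiv.swap_apply_eq_iff, Equiv.swap_apply_right]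
  · rw [← (measurePreserving_permConf (Equiv.swap 0 i)).integral_comp
      (measurableEmbedding_permConf (Equiv.swap 0 i))]
    refine integral_congr_ae ?_
    filter_upwards [hX.chargeTerm_permConf (Equiv.swap 0 i) 0,
      hX.chargeTerm_permConf (Equiv.swap 0 i) j] with k h₁ h₂
    rw [h₁, h₂, greenSymbol_permConf, Equiv.swap_apply_left, map_mul, map_intCast]
    linear_combination (greenSymbol m μ k : ℂ) * (starRingEnd ℂ) (chargeTerm X i k) *
      chargeTerm X (Equiv.swap 0 i j) k * sign_mul_self_complex (Equiv.swap 0 i)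

theorem integral_green_offSum (hm : 0 < m) (hμ : 0 < μ) {X : Conf M → ℂ}
    (hXm : Measurable X) (hX : Integrable fun w => (1 + ‖w‖ ^ 2) * ‖X w‖ ^ 2)
    (hXa : AEAntisymm X) :
    ((∫ k : Conf (M + 1), greenSymbol m μ k * offSum X k : ℝ) : ℂ) =
      (M + 1) * ∑ j ∈ Finset.univ.erase 0, ∫ k : Conf (M + 1), (greenSymbol m μ k : ℂ) *
        ((starRingEnd ℂ) (chargeTerm X 0 k) * chargeTerm X j k) := by
  have h := HasInt.sum Finset.univ fun (i : Fin (M + 1)) _ =>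
    HasInt.sum (Finset.univ.erase i) fun j hj => HasInt.of_integrable
      (integrable_green_conj_chargeTerm_mul hm hμ hXm hX (Finset.ne_of_mem_erase hj).symm)
  rw [← integral_complex_ofReal]
  refine Eq.trans ?_ (h.2.trans ?_)
  · refine integral_congr_ae (Eventually.of_forall fun k => ?_)
    beta_reduce
    rw [Complex.ofReal_mul, ← sum_conj_chargeTerm_mul]
    simp only [Finset.mul_sum]
  · simp only [integral_green_chargeTerm_swap hXa, Finset.sum_const, Finset.card_univ,
      Fintype.card_fin, nsmul_eq_mul]
    push_cast
    rfl

/-- The square root in ℒ equals √a times the width, a = (m+1)/(2m), and reduces the power a^(−3/2)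
to 1/a. -/
theorem diagSymbol_eq (hm : 0 < m) (w : Conf M) :
    diagSymbol m μ w = 2 * Real.pi ^ 2 * pairWidth m μ w / pairFactor m := by
  have ha := pairFactor_pos hm
  have hi : 2 * m / (m + 1) = (pairFactor m)⁻¹ := by rw [pairFactor, inv_div]
  have h₁ : √(pairRest m μ w) = √(pairFactor m) * pairWidth m μ w := by
    rw [pairWidth, ← Real.sqrt_mul ha.le, mul_div_cancel₀ _ ha.ne']
  have h₂ : ((pairFactor m)⁻¹ : ℝ) ^ (3 / 2 : ℝ) = (pairFactor m)⁻¹ * (√(pairFactor m))⁻¹ := by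
    rw [show (3 / 2 : ℝ) = 1 + 1 / 2 by norm_num, Real.rpow_add (inv_pos.2 ha), Real.rpow_one,
      ← Real.sqrt_eq_rpow, Real.sqrt_inv]
  have h₃ : √(pairFactor m) ≠ 0 := (Real.sqrt_pos.2 ha).ne'
  have h₄ : diagSymbol m μ w =
      2 * Real.pi ^ 2 * (2 * m / (m + 1)) ^ (3 / 2 : ℝ) * √(pairRest m μ w) := rfl
  rw [h₄, hi, h₁, h₂]
  field_simp

theorem integrable_diagSymbol (hm : 0 < m) (hμ : 0 < μ) {X : Conf M → ℂ}
    (hXm : Measurable X) (hX : Integrable fun w => (1 + ‖w‖ ^ 2) * ‖X w‖ ^ 2) :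
    Integrable fun w => ‖X w‖ ^ 2 * diagSymbol m μ w := by
  obtain ⟨C, hC, h⟩ := exists_pairWidth_le (M := M) hm hμ
  have ha := pairFactor_pos hm
  simp only [diagSymbol_eq hm]
  refine (hX.const_mul (2 * Real.pi ^ 2 * C / pairFactor m)).mono' ?_
    (Eventually.of_forall fun w => ?_)
  · exact ((hXm.norm.pow_const 2).mul ((continuous_pairWidth m μ).measurable.const_mul
      (2 * Real.pi ^ 2) |>.div_const _)).aestronglyMeasurable
  · have hb := pairWidth_pos hm hμ w
    rw [Real.norm_of_nonneg (by positivity)]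
    calc ‖X w‖ ^ 2 * (2 * Real.pi ^ 2 * pairWidth m μ w / pairFactor m)
        ≤ ‖X w‖ ^ 2 * (2 * Real.pi ^ 2 * (C * (1 + ‖w‖ ^ 2)) / pairFactor m) := by
          gcongr
          exact h w
      _ = _ := by ring

/-- The quadratic form of `Γ`. -/
theorem integral_conj_gammaHat_mul (hm : 0 < m) (hμ : 0 < μ) {ξ : L2 (n + 1)}
    (hX : Integrable fun w => (1 + ‖w‖ ^ 2) * ‖hat ξ w‖ ^ 2) (hXa : AEAntisymm (hat ξ)) :
    ((n : ℂ) + 2) * ∫ w, (starRingEnd ℂ) (gammaHat m μ ξ w) * hat ξ w =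
      (((n + 2) * (∫ w, ‖hat ξ w‖ ^ 2 * diagSymbol m μ w) -
        ∫ k : Conf (n + 2), greenSymbol m μ k * offSum (hat ξ) k : ℝ) : ℂ) := by
  have hXm := measurable_hat ξ
  have h₁ := hasInt_conj_mul_offGamma hm hμ hXm hX
  have h₂ : HasInt (fun w => ((‖hat ξ w‖ ^ 2 * diagSymbol m μ w : ℝ) : ℂ)) volume
      ((∫ w, ‖hat ξ w‖ ^ 2 * diagSymbol m μ w : ℝ) : ℂ) :=
    ⟨(integrable_diagSymbol hm hμ hXm hX).ofReal, integral_complex_ofReal⟩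
  have h₃ := (h₂.add h₁).2
  have h₄ : (starRingEnd ℂ) (∫ w, (starRingEnd ℂ) (gammaHat m μ ξ w) * hat ξ w) =
      ∫ w, (((‖hat ξ w‖ ^ 2 * diagSymbol m μ w : ℝ) : ℂ) +
        (starRingEnd ℂ) (hat ξ w) * offGamma m μ (hat ξ) w) := by
    rw [← integral_conj]
    refine integral_congr_ae (Eventually.of_forall fun w => ?_)
    have hsq : (hat ξ w) * (starRingEnd ℂ) (hat ξ w) = ((‖hat ξ w‖ ^ 2 : ℝ) : ℂ) := by
      rw [Complex.mul_conj, Complex.normSq_eq_norm_sq]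
    simp only [map_mul, Complex.conj_conj, gammaHat_eq]
    rw [Complex.ofReal_mul, ← hsq]
    ring
  have h₅ := integral_green_offSum (m := m) hm hμ hXm hX hXa
  -- The available integrals have the charge in the conjugated slot; as the right side is real,
  -- conjugating costs nothing.
  apply (starRingEnd ℂ).injective
  rw [map_mul, h₄, h₃, Complex.conj_ofReal, map_add, Complex.conj_natCast, Complex.conj_ofNat,
    Complex.ofReal_sub, h₅]
  push_cast
  ring

end

/-! ### Integrable parts of the energy density and the pointwise energy identity. -/

section

variable {M n : ℕ} {m μ : ℝ}

theorem norm_sq_add_green_mul (Φ : Conf (M + 1) → ℂ) (X : Conf M → ℂ) (k : Conf (M + 1)) :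
    ‖Φ k + (greenSymbol m μ k : ℂ) * chargeSum X k‖ ^ 2 =
      ‖Φ k‖ ^ 2 + 2 * (greenSymbol m μ k * ((starRingEnd ℂ) (Φ k) * chargeSum X k).re) +
        greenSymbol m μ k ^ 2 * (∑ i, ‖chargeTerm X i k‖ ^ 2 + offSum X k) := by
  rw [← norm_sq_chargeSum, ← Complex.normSq_eq_norm_sq, ← Complex.normSq_eq_norm_sq,
    ← Complex.normSq_eq_norm_sq, Complex.normSq_apply, Complex.normSq_apply, Complex.normSq_apply]
  simp only [Complex.add_re, Complex.add_im, Complex.mul_re, Complex.mul_im, Complex.ofReal_re,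
    Complex.ofReal_im, Complex.conj_re, Complex.conj_im]
  ring

theorem memLp_of_weight {Φ : Conf M → ℂ} (hΦm : Measurable Φ)
    (hΦ : MemLp (fun k => ((1 + ‖k‖ ^ 2 : ℝ) : ℂ) * Φ k) 2) : MemLp Φ 2 := by
  have := memLp_weight hΦm hΦ (v := fun _ => 1) measurable_const (C := 1) fun k => by
    rw [abs_one]
    nlinarith [sq_nonneg ‖k‖]
  simpa using this

theorem memLp_weight_energy (hm : 0 < m) (hμ : 0 < μ) {Φ : Conf M → ℂ} (hΦm : Measurable Φ)
    (hΦ : MemLp (fun k => ((1 + ‖k‖ ^ 2 : ℝ) : ℂ) * Φ k) 2) {v : Conf M → ℝ} (hv : Measurable v)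
    {C : ℝ} (hC : 0 ≤ C) (hvC : ∀ k, |v k| ≤ C * (kinetic m k + μ)) :
    MemLp (fun k => (v k : ℂ) * Φ k) 2 := by
  refine memLp_weight hΦm hΦ hv (C := C * (1 / (2 * m) + 1 / 2 + μ)) fun k => ?_
  rw [mul_assoc]
  exact (hvC k).trans (mul_le_mul_of_nonneg_left (kinetic_add_le hm hμ k) hC)

/-- After subtraction of the diagonal terms, the density is integrable against the energy. -/
theorem integrable_energy_mul_regular (hm : 0 < m) (hμ : 0 < μ) {X : Conf M → ℂ}
    (hXm : Measurable X) (hX : Integrable fun w => (1 + ‖w‖ ^ 2) * ‖X w‖ ^ 2)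
    {Φ Ψ : Conf (M + 1) → ℂ} (hΦm : Measurable Φ)
    (hΦ : MemLp (fun k => ((1 + ‖k‖ ^ 2 : ℝ) : ℂ) * Φ k) 2)
    (hΨ : Ψ =ᵐ[volume] fun k => Φ k + (greenSymbol m μ k : ℂ) * chargeSum X k)
    {v : Conf (M + 1) → ℝ} (hv : Measurable v) {C : ℝ} (hC : 0 ≤ C)
    (hvC : ∀ k, |v k| ≤ C * (kinetic m k + μ)) :
    Integrable fun k => v k * (‖Ψ k‖ ^ 2 -
      ∑ i, greenSymbol m μ k ^ 2 * ‖chargeTerm X i k‖ ^ 2) := by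
  have hvΦ := memLp_weight_energy hm hμ hΦm hΦ hv hC hvC
  have h₁ := (integrable_conj_mul_of_memLp hvΦ (memLp_of_weight hΦm hΦ)).re
  have h₂ := (integrable_conj_mul_of_memLp hvΦ (memLp_green_chargeSum hm hμ hXm hX)).re.const_mul 2
  -- One factor G offsets the weight v, which grows at most like the energy; the other makes the
  -- off-diagonal sum integrable.
  have h₃ : Integrable fun k => (v k * greenSymbol m μ k) * (greenSymbol m μ k * offSum X k) := by
    refine (integrable_green_offSum hm hμ hXm hX).bdd_mul
      (hv.mul measurable_greenSymbol).aestronglyMeasurable (c := C)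
      (Eventually.of_forall fun k => ?_)
    have hk : 0 < kinetic m k + μ := add_pos_of_nonneg_of_pos (kinetic_nonneg hm k) hμ
    rw [norm_mul, Real.norm_of_nonneg (greenSymbol_pos hm hμ k).le, Real.norm_eq_abs,
      greenSymbol_eq_kinetic, ← div_eq_mul_inv, div_le_iff₀ hk]
    exact hvC k
  refine ((h₁.add h₂).add h₃).congr ?_
  filter_upwards [hΨ] with k hk
  rw [hk, norm_sq_add_green_mul, ← Finset.mul_sum, Pi.add_apply, Pi.add_apply]
  have e : ‖Φ k‖ ^ 2 = (Φ k).re * (Φ k).re + (Φ k).im * (Φ k).im := by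
    rw [← Complex.normSq_eq_norm_sq, Complex.normSq_apply]
  rw [e]
  simp only [RCLike.re_eq_complex_re, map_mul, Complex.conj_ofReal, Complex.mul_re,
    Complex.mul_im, Complex.ofReal_re, Complex.ofReal_im, Complex.conj_re, Complex.conj_im]
  ring

theorem norm_sq_zero_le_energy (hm : 0 < m) (hμ : 0 < μ) (k : Conf M) :
    ‖k 0‖ ^ 2 ≤ 2 * m * (kinetic m k + μ) := by
  have h : 2 * m * (1 / (2 * m) * ‖k 0‖ ^ 2) = ‖k 0‖ ^ 2 := by
    rw [← mul_assoc, mul_one_div_cancel (mul_pos two_pos hm).ne', one_mul]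
  have h₂ : 0 ≤ ∑ i, ‖rest k i‖ ^ 2 := Finset.sum_nonneg fun i _ => sq_nonneg _
  rw [kinetic, add_assoc, mul_add, h]
  have : 0 ≤ 2 * m * (1 / 2 * ∑ i, ‖rest k i‖ ^ 2 + μ) :=
    mul_nonneg (mul_pos two_pos hm).le (by linarith)
  linarith

theorem norm_sq_rest_le_energy (hm : 0 < m) (hμ : 0 < μ) (k : Conf M) (l : Fin M) :
    ‖rest k l‖ ^ 2 ≤ 2 * (kinetic m k + μ) := by
  have h : ‖rest k l‖ ^ 2 ≤ ∑ i, ‖rest k i‖ ^ 2 :=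
    Finset.single_le_sum (f := fun i => ‖rest k i‖ ^ 2) (fun i _ => sq_nonneg _)
      (Finset.mem_univ l)
  have h₂ : 0 ≤ 1 / (2 * m) * ‖k 0‖ ^ 2 := by positivity
  rw [kinetic]
  linarith

theorem integrable_regularUp (hm : 0 < m) (hμ : 0 < μ) {X : Conf M → ℂ}
    (hXm : Measurable X) (hX : Integrable fun w => (1 + ‖w‖ ^ 2) * ‖X w‖ ^ 2)
    {Φ Ψ : Conf (M + 1) → ℂ} (hΦm : Measurable Φ)
    (hΦ : MemLp (fun k => ((1 + ‖k‖ ^ 2 : ℝ) : ℂ) * Φ k) 2)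
    (hΨ : Ψ =ᵐ[volume] fun k => Φ k + (greenSymbol m μ k : ℂ) * chargeSum X k) :
    Integrable (regularUp m μ X Ψ) := by
  refine integrable_energy_mul_regular hm hμ hXm hX hΦm hΦ hΨ (v := fun k => ‖k 0‖ ^ 2)
    (by fun_prop) (C := 2 * m) (by positivity) fun k => ?_
  rw [abs_of_nonneg (sq_nonneg _)]
  exact norm_sq_zero_le_energy hm hμ k

/-- Compared with `integrable_energy_mul_regular`, the diagonal terms of the pairs not containing
fermion l are put back; for them k_l is a spectator momentum. -/
theorem integrable_regularDown (hm : 0 < m) (hμ : 0 < μ) {X : Conf M → ℂ}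
    (hXm : Measurable X) (hX : Integrable fun w => (1 + ‖w‖ ^ 2) * ‖X w‖ ^ 2)
    {Φ Ψ : Conf (M + 1) → ℂ} (hΦm : Measurable Φ)
    (hΦ : MemLp (fun k => ((1 + ‖k‖ ^ 2 : ℝ) : ℂ) * Φ k) 2)
    (hΨ : Ψ =ᵐ[volume] fun k => Φ k + (greenSymbol m μ k : ℂ) * chargeSum X k)
    (l : Fin (M + 1)) : Integrable (regularDown m μ X Ψ l) := by
  have h₁ := integrable_energy_mul_regular hm hμ hXm hX hΦm hΦ hΨ (v := fun k => ‖rest k l‖ ^ 2)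
    (by unfold rest; fun_prop) (C := 2) (by norm_num) fun k => by
      rw [abs_of_nonneg (sq_nonneg _)]
      exact norm_sq_rest_le_energy hm hμ k l
  have h₂ := integrable_finsetSum (Finset.univ.erase l) fun i hi =>
    integrable_weight_green_sq_chargeTerm hm hμ hXm hX (i := i) (Finset.ne_of_mem_erase hi).symm
  refine (h₁.add h₂).congr (Eventually.of_forall fun k => ?_)
  simp only [Pi.add_apply, regularDown]
  rw [← Finset.add_sum_erase Finset.univ
    (fun i => greenSymbol m μ k ^ 2 * ‖chargeTerm X i k‖ ^ 2) (Finset.mem_univ l)]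
  simp only [mul_assoc, ← Finset.mul_sum]
  ring

/-- The energy of the spectators of a pair. -/
def spectatorEnergy (μ : ℝ) (w : Conf M) : ℝ := 1 / 2 * ∑ j, ‖rest w j‖ ^ 2 + μ

/-- Multiply the expansion of |Ψ|² by T + μ and use G(T+μ) = 1 in the cross term and the
off-diagonal term. From the i-th diagonal term only the energies of the two partners of pair i were
subtracted, so it keeps the weight T + μ − k₀²/(2m) − kᵢ²/2, the spectator energy. -/
theorem energy_identity (hm : 0 < m) (hμ : 0 < μ) (X : Conf M → ℂ) (Φ : Conf (M + 1) → ℂ)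
    {Ψ : Conf (M + 1) → ℂ} {k : Conf (M + 1)}
    (hΨ : Ψ k = Φ k + (greenSymbol m μ k : ℂ) * chargeSum X k) :
    1 / (2 * m) * regularUp m μ X Ψ k + 1 / 2 * ∑ l, regularDown m μ X Ψ l k =
      (kinetic m k + μ) * ‖Φ k‖ ^ 2 + 2 * ((starRingEnd ℂ) (Φ k) * chargeSum X k).re +
        greenSymbol m μ k * offSum X k - μ * ‖Ψ k‖ ^ 2 +
        ∑ i, spectatorEnergy μ (pairMap i k) * greenSymbol m μ k ^ 2 * ‖chargeTerm X i k‖ ^ 2 := by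
  have hN := norm_sq_add_green_mul (m := m) (μ := μ) Φ X k
  rw [← hΨ] at hN
  have hG : greenSymbol m μ k * (kinetic m k + μ) = 1 := by
    rw [greenSymbol_eq_kinetic]
    exact inv_mul_cancel₀ (add_pos_of_nonneg_of_pos (kinetic_nonneg hm k) hμ).ne'
  have hs : ∀ i, spectatorEnergy μ (pairMap i k) =
      1 / 2 * ∑ l, ‖rest k l‖ ^ 2 + μ - 1 / 2 * ‖rest k i‖ ^ 2 := fun i => by
    rw [spectatorEnergy, Fin.sum_univ_succAbove (fun l => ‖rest k l‖ ^ 2) i]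
    simp only [rest_pairMap]
    ring
  have h₁ : ∑ i, spectatorEnergy μ (pairMap i k) * greenSymbol m μ k ^ 2 *
      ‖chargeTerm X i k‖ ^ 2 = (1 / 2 * ∑ l, ‖rest k l‖ ^ 2 + μ) *
        (greenSymbol m μ k ^ 2 * ∑ i, ‖chargeTerm X i k‖ ^ 2) -
        1 / 2 * (greenSymbol m μ k ^ 2 * ∑ i, ‖rest k i‖ ^ 2 * ‖chargeTerm X i k‖ ^ 2) := by
    simp only [hs]
    generalize 1 / 2 * ∑ l, ‖rest k l‖ ^ 2 + μ = A
    rw [Finset.mul_sum, Finset.mul_sum, Finset.mul_sum, Finset.mul_sum, ← Finset.sum_sub_distrib]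
    exact Finset.sum_congr rfl fun i _ => by ring
  have h₂ : ∑ l, regularDown m μ X Ψ l k = (∑ l, ‖rest k l‖ ^ 2) * ‖Ψ k‖ ^ 2 -
      greenSymbol m μ k ^ 2 * ∑ i, ‖rest k i‖ ^ 2 * ‖chargeTerm X i k‖ ^ 2 := by
    rw [Finset.sum_mul, Finset.mul_sum, ← Finset.sum_sub_distrib]
    exact Finset.sum_congr rfl fun i _ => by rw [regularDown]; ring
  rw [h₁, h₂, regularUp, ← Finset.mul_sum]
  have hk : kinetic m k = 1 / (2 * m) * ‖k 0‖ ^ 2 + 1 / 2 * ∑ i, ‖rest k i‖ ^ 2 := rfl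
  rw [hk] at hG ⊢
  generalize (1 / (2 * m)) = c at *
  linear_combination (c * ‖k 0‖ ^ 2 + 1 / 2 * ∑ i, ‖rest k i‖ ^ 2 + μ) * hN +
    (2 * ((starRingEnd ℂ) (Φ k) * chargeSum X k).re + greenSymbol m μ k * offSum X k) * hG

/-- By antisymmetry all pairs contribute equally. The last one is kept because the boundary
condition is imposed at x_N = x₀; its sign in the charge sum is (−1)^M. -/
theorem integral_conj_mul_chargeSum {X : Conf M → ℂ} (hXa : AEAntisymm X)
    {Φ : Conf (M + 1) → ℂ} (hΦa : AEAntisymm Φ)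
    (h : ∀ i, Integrable fun k => (starRingEnd ℂ) (Φ k) * X (pairMap i k)) :
    HasInt (fun k => (starRingEnd ℂ) (Φ k) * chargeSum X k) volume
      ((M + 1) * ((-1) ^ M * ∫ k, (starRingEnd ℂ) (Φ k) * X (pairMap (Fin.last M) k))) := by
  have h₀ : ∀ i, Integrable fun k => (starRingEnd ℂ) (Φ k) * chargeTerm X i k := fun i => by
    refine ((h i).const_mul ((-1) ^ (i : ℕ))).congr (Eventually.of_forall fun k => ?_)
    simp only [chargeTerm]
    ring
  have h₁ : ∀ i, ∫ k, (starRingEnd ℂ) (Φ k) * chargeTerm X i k =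
      ∫ k, (starRingEnd ℂ) (Φ k) * chargeTerm X (Fin.last M) k := fun i => by
    rw [← (measurePreserving_permConf (Equiv.swap i (Fin.last M))).integral_comp
      (measurableEmbedding_permConf (Equiv.swap i (Fin.last M)))
      (fun k => (starRingEnd ℂ) (Φ k) * chargeTerm X (Fin.last M) k)]
    refine integral_congr_ae ?_
    filter_upwards [hXa.chargeTerm_permConf (Equiv.swap i (Fin.last M)) (Fin.last M),
      hΦa (Equiv.swap i (Fin.last M))] with k e₁ e₂
    rw [e₁, e₂, Equiv.swap_apply_right, map_mul, map_intCast]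
    linear_combination (-(starRingEnd ℂ) (Φ k) * chargeTerm X i k) *
      sign_mul_self_complex (Equiv.swap i (Fin.last M))
  have h₂ : ∫ k, (starRingEnd ℂ) (Φ k) * chargeTerm X (Fin.last M) k =
      (-1) ^ M * ∫ k, (starRingEnd ℂ) (Φ k) * X (pairMap (Fin.last M) k) := by
    rw [← integral_const_mul]
    refine integral_congr_ae (Eventually.of_forall fun k => ?_)
    simp only [chargeTerm, Fin.val_last]
    ring
  refine ((HasInt.sum Finset.univ fun i _ => HasInt.of_integrable (h₀ i)).congr_val ?_).congr
    (Eventually.of_forall fun k => ?_)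
  · simp only [h₁, h₂, Finset.sum_const, Finset.card_univ, Fintype.card_fin, nsmul_eq_mul]
    push_cast
    rfl
  · simp only [chargeSum, Finset.mul_sum]

end

/-! ### Integrated tails, the boundary condition and the Hamiltonian in momentum space. -/

section

variable {M n : ℕ} {m μ : ℝ}

theorem contact_eq (ξ : L2 M) :
    contact m ξ = (M + 1) * (pairFactor m ^ 2)⁻¹ * ∫ w, ‖hat ξ w‖ ^ 2 := by
  rw [contact, integral_norm_sq_hat, pairFactor, ← inv_pow, inv_div]
  ring

/-- This is the moment condition of `hasInt_tail`: p is the mean of 2q for q = m/(m+1) times the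
pair momentum. -/
theorem momentumUp_moment (ξ : L2 M) :
    (2 * (m / (m + 1))) • ∫ w, ‖hat ξ w‖ ^ 2 • w 0 =
      (∫ w, ‖hat ξ w‖ ^ 2) • momentumUp m ξ := by
  have hint := integral_norm_sq_hat ξ
  -- For ξ = 0 the inverse in the definition is 0, and both sides vanish.
  by_cases h : ‖ξ‖ ^ 2 = 0
  · have h₀ : (∫ w, ‖hat ξ w‖ ^ 2) = 0 := hint.trans h
    have hae : (fun w => ‖hat ξ w‖ ^ 2) =ᵐ[volume] 0 :=
      (integral_eq_zero_iff_of_nonneg (fun w => sq_nonneg _)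
        ((memLp_two_iff_integrable_sq_norm (memLp_hat ξ).1).1 (memLp_hat ξ))).1 h₀
    have h₁ : ∫ w : Conf M, ‖hat ξ w‖ ^ 2 • w 0 = 0 := by
      refine integral_eq_zero_of_ae ?_
      filter_upwards [hae] with w hw
      rw [hw, Pi.zero_apply, zero_smul, Pi.zero_apply]
    rw [h₀, h₁, smul_zero, zero_smul]
  · rw [momentumUp, hint, smul_smul]
    congr 1
    rw [mul_left_comm, mul_inv_cancel₀ h, mul_one, mul_div_assoc]

theorem momentumDown_moment (hm : 0 < m) (ξ : L2 M) :
    (2 * (1 / (m + 1))) • ∫ w, ‖hat ξ w‖ ^ 2 • w 0 =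
      (∫ w, ‖hat ξ w‖ ^ 2) • momentumDown m ξ := by
  rw [momentumDown, smul_comm, ← momentumUp_moment, smul_smul]
  congr 1
  field_simp

/-- The contribution of a pair to the integrated tail, where `c` is the fraction of the total
momentum that the particle carries. -/
def tailWeight (m μ c : ℝ) (w : Conf M) : ℝ :=
  -3 * Real.pi ^ 2 * pairWidth m μ w + Real.pi ^ 2 * ‖c • w 0‖ ^ 2 / pairWidth m μ w

theorem hasInt_tailUp (hm : 0 < m) (hμ : 0 < μ) {ψ : L2 (M + 1)} {ξ : L2 M}
    (hX : Integrable fun w => (1 + ‖w‖ ^ 2) * ‖hat ξ w‖ ^ 2)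
    (h : Integrable (regularUp m μ (hat ξ) (hat ψ))) :
    HasInt (tailUp m ψ ξ) volume ((∫ k, regularUp m μ (hat ξ) (hat ψ) k) +
      (M + 1) * (pairFactor m ^ 2)⁻¹ *
        ∫ w, ‖hat ξ w‖ ^ 2 * tailWeight m μ (m / (m + 1)) w) := by
  have h₁ := ((HasInt.of_integrable h).comp (measurePreserving_pt (M + 1))
    measurableEmbedding_pt).marginal
  -- The constant bounding |q|² by the squared width is d = m, as (m/(m+1))² = m · m/(m+1)².
  have h₂ := (hasInt_tail (measurable_hat ξ) hX hm hμ hm.le (c := m / (m + 1))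
    (le_of_eq (by rw [div_pow, pow_two m, mul_div_assoc])) (momentumUp_moment ξ)).1.const_mul ((M + 1) * (pairFactor m ^ 2)⁻¹)
  refine (h₁.add h₂).congr ?_
  filter_upwards [density_up_eq (measurable_hat ξ) hX hm hμ h] with x hx
  have e : ‖x‖ ^ 2 * densityUp ψ x = _ := hx
  rw [tailUp, e, contact_eq, div_eq_mul_inv]
  ring

theorem hasInt_tailDown (hm : 0 < m) (hμ : 0 < μ) {ψ : L2 (M + 1)} {ξ : L2 M}
    (hX : Integrable fun w => (1 + ‖w‖ ^ 2) * ‖hat ξ w‖ ^ 2)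
    (h : Integrable (regularDown m μ (hat ξ) (hat ψ) 0)) :
    HasInt (tailDown m ψ ξ) volume ((M + 1) * (∫ k, regularDown m μ (hat ξ) (hat ψ) 0 k) +
      (M + 1) * (pairFactor m ^ 2)⁻¹ *
        ∫ w, ‖hat ξ w‖ ^ 2 * tailWeight m μ (1 / (m + 1)) w) := by
  have h₁ := ((HasInt.of_integrable h).comp measurePreserving_downPt
    measurableEmbedding_downPt).marginal.const_mul ((M : ℝ) + 1)
  -- Here d = 1/m, as 1/(m+1)² = (1/m) · m/(m+1)².
  have h₂ := (hasInt_tail (measurable_hat ξ) hX hm hμ (one_div_pos.2 hm).le (c := 1 / (m + 1))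
    (le_of_eq (by field_simp)) (momentumDown_moment hm ξ)).1.const_mul
      ((M + 1) * (pairFactor m ^ 2)⁻¹)
  refine (h₁.add h₂).congr ?_
  filter_upwards [density_down_eq (measurable_hat ξ) hX hm hμ h] with x hx
  have e : ‖x‖ ^ 2 * densityDown ψ x = (M + 1) * (‖x‖ ^ 2 *
      ∫ q : Fin (M + 1) → E3, ‖hat ψ (downPt x q)‖ ^ 2) := by
    rw [densityDown]
    simp only [downPt]
    ring
  rw [tailDown, e, hx, contact_eq, div_eq_mul_inv]
  ring

/-- Let a = 1/(2m) + 1/2. The tails give −3π²ab + π²|w₀|²/(2(m+1)b), and the spectator energy ab² −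
|w₀|²/(2(m+1)), times π²/b, cancels the pair momentum. There remains −2π²ab, which after division by
a² is −ℒ. -/
theorem tailWeight_identity (hm : 0 < m) (hμ : 0 < μ) (w : Conf M) :
    (pairFactor m ^ 2)⁻¹ * (1 / (2 * m) * tailWeight m μ (m / (m + 1)) w +
        1 / 2 * tailWeight m μ (1 / (m + 1)) w) +
      spectatorEnergy μ w * ((pairFactor m ^ 2)⁻¹ * (Real.pi ^ 2 / pairWidth m μ w)) =
      -diagSymbol m μ w := by
  have hb := pairWidth_pos hm hμ w
  have ha := pairFactor_pos hm
  have hs : spectatorEnergy μ w =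
      pairFactor m * pairWidth m μ w ^ 2 - ‖w 0‖ ^ 2 / (2 * (m + 1)) := by
    rw [pairWidth_sq hm hμ, pairRest, spectatorEnergy]
    ring
  rw [diagSymbol_eq hm, hs, tailWeight, tailWeight, norm_smul, norm_smul, mul_pow, mul_pow,
    Real.norm_eq_abs, Real.norm_eq_abs, sq_abs, sq_abs]
  generalize pairWidth m μ w = b at *
  generalize ‖w 0‖ ^ 2 = q
  rw [pairFactor]
  have : m + 1 ≠ 0 := by positivity
  field_simp
  ring

theorem memLp_sobolev_two {φ : L2 M} (h : InSobolev 2 φ) :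
    MemLp (fun k => ((1 + ‖k‖ ^ 2 : ℝ) : ℂ) * hat φ k) 2 := by
  have := memLp_hat_of_inSobolev zero_le_two h
  norm_num at this
  simpa using this

theorem integrable_sobolev_one {ξ : L2 M} (h : InSobolev 1 ξ) :
    Integrable fun w => (1 + ‖w‖ ^ 2) * ‖hat ξ w‖ ^ 2 := by
  have h₁ := memLp_hat_of_inSobolev zero_le_one h
  refine ((memLp_two_iff_integrable_sq_norm h₁.1).1 h₁).congr (Eventually.of_forall fun w => ?_)
  have hp : (0 : ℝ) ≤ 1 + ‖w‖ ^ 2 := by positivity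
  simp only [norm_mul, mul_pow, Complex.norm_real, Real.norm_eq_abs, sq_abs]
  rw [← Real.sqrt_eq_rpow, Real.sq_sqrt hp]

theorem AEAntisymm.add_green {X : Conf M → ℂ} (hX : AEAntisymm X) {Φ Ψ : Conf (M + 1) → ℂ}
    (hΦ : AEAntisymm Φ)
    (hΨ : Ψ =ᵐ[volume] fun k => Φ k + (greenSymbol m μ k : ℂ) * PointInteraction.chargeSum X k) :
    AEAntisymm Ψ := by
  intro σ
  filter_upwards [hΨ, (measurePreserving_permConf σ).quasiMeasurePreserving.ae hΨ, hΦ σ,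
    hX.chargeSum σ] with k h₁ h₂ h₃ h₄
  rw [h₂, h₁, h₃, h₄, greenSymbol_permConf]
  ring

/-- The boundary condition in momentum space. -/
theorem integral_conj_regular_mul_chargeSum {α : ℝ} (hm : 0 < m) (hμ : 0 < μ) {ψ φ : L2 (n + 2)}
    {ξ : L2 (n + 1)} (hψ : IsDomainDecomposition m α μ ψ φ ξ)
    (hX : Integrable fun w => (1 + ‖w‖ ^ 2) * ‖hat ξ w‖ ^ 2) :
    HasInt (fun k => (starRingEnd ℂ) (hat φ k) * chargeSum (hat ξ) k) volume
      (((n + 2) * (α / pairFactor m) * ‖ξ‖ ^ 2 +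
        ((n + 2) * (∫ w, ‖hat ξ w‖ ^ 2 * diagSymbol m μ w) -
          ∫ k : Conf (n + 2), greenSymbol m μ k * offSum (hat ξ) k) : ℝ) : ℂ) := by
  have hXa : AEAntisymm (hat ξ) := hat_antisymm hψ.charge_antisymm
  have hΦ := memLp_sobolev_two hψ.regular_sobolev
  have h₁ := integral_conj_mul_chargeSum hXa (hat_antisymm hψ.regular_antisymm) fun i =>
    integrable_conj_hat_mul_pairMap hm hμ (measurable_hat ξ) hX i hΦ
  refine h₁.congr_val ?_
  obtain ⟨η, hη, ht⟩ := hψ.boundary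
  have h₂ := inner_trace hm hμ hΦ ht hX
  rw [inner_smul_left, inner_add_left, inner_smul_left, inner_self_eq_norm_sq_to_K,
    inner_eq_integral η ξ] at h₂
  have h₃ : ∫ k, (starRingEnd ℂ) (hat η k) * hat ξ k =
      ∫ k, (starRingEnd ℂ) (gammaHat m μ ξ k) * hat ξ k := by
    refine integral_congr_ae ?_
    filter_upwards [hη] with k hk
    rw [hk]
  have h₄ := integral_conj_gammaHat_mul hm hμ hX hXa
  rw [h₃] at h₂
  generalize (∫ k, (starRingEnd ℂ) (hat φ k) * hat ξ (pairMap (Fin.last (n + 1)) k)) = J at *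
  generalize (∫ w, (starRingEnd ℂ) (gammaHat m μ ξ w) * hat ξ w) = I at *
  rw [Complex.ofReal_add, ← h₄]
  have hπ : (((2 * Real.pi) ^ (3 / 2 : ℝ) : ℝ) : ℂ) ≠ 0 :=
    Complex.ofReal_ne_zero.2 (by positivity)
  have hβ : 2 * m * α / (m + 1) = α / pairFactor m := by
    rw [pairFactor, div_div_eq_mul_div]
    ring
  rw [hβ, Complex.ofReal_inv, map_div₀, Complex.conj_ofReal, map_pow, map_neg, map_one,
    Complex.conj_ofReal] at h₂
  generalize (((2 * Real.pi) ^ (3 / 2 : ℝ) : ℝ) : ℂ) = P at *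
  have hJ : J = (-1) ^ (n + 2 + 1) * (((α / pairFactor m : ℝ) : ℂ) * (‖ξ‖ : ℂ) ^ 2 + I) := by
    field_simp at h₂
    exact h₂.symm
  -- The sign of the last charge term, with M = n + 1, cancels the sign (−1)^(N+1) of the boundary
  -- condition, with N = n + 2.
  have hs : ((-1 : ℂ) ^ (n + 1)) * (-1) ^ (n + 2 + 1) = 1 := by
    rw [← pow_add, show n + 1 + (n + 2 + 1) = 2 * (n + 2) by ring, pow_mul]
    norm_num
  rw [hJ]
  push_cast
  linear_combination ((n : ℂ) + 2) * ((α / pairFactor m : ℂ) * (‖ξ‖ : ℂ) ^ 2 + I) * hs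

/-- On the Fourier side (H+μ)ψ is (T+μ)Φ, and G(T+μ) = 1 turns its product with the conjugate of G S
into S̄Φ, the conjugate of the integrand in the boundary pairing. -/
theorem inner_hamiltonian {α : ℝ} (hm : 0 < m) (hμ : 0 < μ) {ψ φ : L2 (n + 2)}
    {ξ : L2 (n + 1)} (hψ : IsDomainDecomposition m α μ ψ φ ξ)
    (hX : Integrable fun w => (1 + ‖w‖ ^ 2) * ‖hat ξ w‖ ^ 2) :
    HasInt (fun k => (kinetic m k + μ) * ‖hat φ k‖ ^ 2 - μ * ‖hat ψ k‖ ^ 2) volume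
      (∫ k, ((kinetic m k + μ) * ‖hat φ k‖ ^ 2 - μ * ‖hat ψ k‖ ^ 2)) ∧
    inner ℂ ψ (hamiltonian hψ) =
      ((∫ k, ((kinetic m k + μ) * ‖hat φ k‖ ^ 2 - μ * ‖hat ψ k‖ ^ 2) : ℝ) : ℂ) +
        (starRingEnd ℂ) (∫ k, (starRingEnd ℂ) (hat φ k) * chargeSum (hat ξ) k) := by
  have hΦ := memLp_sobolev_two hψ.regular_sobolev
  have hsq : ∀ z : ℂ, (starRingEnd ℂ) z * z = ((‖z‖ ^ 2 : ℝ) : ℂ) := fun z => by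
    rw [mul_comm, Complex.mul_conj, Complex.normSq_eq_norm_sq]
  have hE : MemLp (fun k => ((kinetic m k + μ : ℝ) : ℂ) * hat φ k) 2 :=
    memLp_weight_energy hm hμ (measurable_hat φ) hΦ (continuous_kinetic.add_const μ).measurable
      zero_le_one fun k => by
        rw [one_mul, abs_of_nonneg (add_nonneg (kinetic_nonneg hm k) hμ.le)]
  have h₁ : Integrable fun k => (kinetic m k + μ) * ‖hat φ k‖ ^ 2 := by
    refine (integrable_conj_mul_of_memLp (memLp_hat φ) hE).re.congr
      (Eventually.of_forall fun k => ?_)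
    simp only [RCLike.re_eq_complex_re]
    rw [mul_left_comm, hsq, ← Complex.ofReal_mul, Complex.ofReal_re]
  have h₂ : Integrable fun k => μ * ‖hat ψ k‖ ^ 2 :=
    ((memLp_two_iff_integrable_sq_norm (memLp_hat ψ).1).1 (memLp_hat ψ)).const_mul μ
  have h₃ := HasInt.of_integrable (h₁.sub h₂)
  refine ⟨h₃, ?_⟩
  have h₄ := HasInt.of_integrable (integral_conj_regular_mul_chargeSum hm hμ hψ hX).1
  have h₅ : HasInt (fun k => (starRingEnd ℂ) ((starRingEnd ℂ) (hat φ k) * chargeSum (hat ξ) k))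
      volume ((starRingEnd ℂ) (∫ k, (starRingEnd ℂ) (hat φ k) * chargeSum (hat ξ) k)) :=
    ⟨(LinearIsometryEquiv.integrable_comp_iff Complex.conjLIE).2 h₄.1, integral_conj⟩
  have h₆ : HasInt (fun k => (((kinetic m k + μ) * ‖hat φ k‖ ^ 2 - μ * ‖hat ψ k‖ ^ 2 : ℝ) : ℂ))
      volume ((∫ k, ((kinetic m k + μ) * ‖hat φ k‖ ^ 2 - μ * ‖hat ψ k‖ ^ 2) : ℝ) : ℂ) :=
    ⟨h₃.1.ofReal, integral_complex_ofReal⟩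
  rw [inner_eq_integral, ← (h₆.add h₅).2]
  refine integral_congr_ae ?_
  filter_upwards [hψ.decomposition, hat_freeHamiltonianL2 m φ hψ.regular_sobolev,
    hat_add (freeHamiltonianL2 m φ hψ.regular_sobolev) ((μ : ℂ) • φ), hat_smul (μ : ℂ) φ,
    hat_smul (μ : ℂ) ψ, hat_sub (freeHamiltonianL2 m φ hψ.regular_sobolev + (μ : ℂ) • φ)
      ((μ : ℂ) • ψ)] with k e₁ e₂ e₃ e₄ e₅ e₆
  have hG : (greenSymbol m μ k : ℂ) * (kinetic m k + μ : ℂ) = 1 := by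
    rw [greenSymbol_eq_kinetic, ← Complex.ofReal_add, ← Complex.ofReal_mul,
      inv_mul_cancel₀ (add_pos_of_nonneg_of_pos (kinetic_nonneg hm k) hμ).ne', Complex.ofReal_one]
  have e₇ : hat ψ k = hat φ k + (greenSymbol m μ k : ℂ) * chargeSum (hat ξ) k := e₁
  rw [hamiltonian, e₆, e₃, e₄, e₅, e₂, Complex.ofReal_sub, Complex.ofReal_mul, Complex.ofReal_mul,
    ← hsq, ← hsq, e₇]
  simp only [map_add, map_mul, Complex.conj_ofReal, Complex.conj_conj, Complex.ofReal_add]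
  linear_combination ((starRingEnd ℂ) (chargeSum (hat ξ) k) * hat φ k) * hG

theorem integral_spectator (hm : 0 < m) (hμ : 0 < μ) {X : Conf M → ℂ} (hXm : Measurable X)
    (hX : Integrable fun w => (1 + ‖w‖ ^ 2) * ‖X w‖ ^ 2) (i : Fin (M + 1)) :
    HasInt (fun k : Conf (M + 1) =>
      spectatorEnergy μ (pairMap i k) * greenSymbol m μ k ^ 2 * ‖chargeTerm X i k‖ ^ 2) volume
      (∫ w, ‖X w‖ ^ 2 *
        (spectatorEnergy μ w * ((pairFactor m ^ 2)⁻¹ * (Real.pi ^ 2 / pairWidth m μ w)))) := by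
  refine hasInt_green_sq_chargeTerm hm hμ hXm hX (V := spectatorEnergy μ)
    (by unfold spectatorEnergy rest; fun_prop) (C := 1 + μ) (fun w => ?_) i
  have h : 0 ≤ ∑ j, ‖rest w j‖ ^ 2 := Finset.sum_nonneg fun j _ => sq_nonneg _
  rw [spectatorEnergy, abs_of_nonneg (by linarith), norm_sq_conf]
  nlinarith [sq_nonneg ‖w 0‖, mul_nonneg hμ.le h, mul_nonneg hμ.le (sq_nonneg ‖w 0‖)]

end

/-! ### Assembly of the energy formula. -/

section

variable {n : ℕ} {m μ : ℝ}

/-- The integral of the tails of the momentum densities. -/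
theorem hasInt_tails {α : ℝ} (hm : 0 < m) (hμ : 0 < μ) {ψ φ : L2 (n + 2)}
    {ξ : L2 (n + 1)} (hψ : IsDomainDecomposition m α μ ψ φ ξ)
    (hX : Integrable fun w => (1 + ‖w‖ ^ 2) * ‖hat ξ w‖ ^ 2) :
    Integrable (tailUp m ψ ξ) ∧ Integrable (tailDown m ψ ξ) ∧
      ∫ x, (1 / (2 * m) * tailUp m ψ ξ x + 1 / 2 * tailDown m ψ ξ x) =
        (∫ k, ((kinetic m k + μ) * ‖hat φ k‖ ^ 2 - μ * ‖hat ψ k‖ ^ 2)) +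
          2 * ((n + 2) * (α / pairFactor m) * ‖ξ‖ ^ 2 +
            ((n + 2) * (∫ w, ‖hat ξ w‖ ^ 2 * diagSymbol m μ w) -
              ∫ k : Conf (n + 2), greenSymbol m μ k * offSum (hat ξ) k)) +
          (∫ k : Conf (n + 2), greenSymbol m μ k * offSum (hat ξ) k) -
          (n + 2) * ∫ w, ‖hat ξ w‖ ^ 2 * diagSymbol m μ w := by
  have hXm := measurable_hat ξ
  have hXa : AEAntisymm (hat ξ) := hat_antisymm hψ.charge_antisymm
  have hΦm := measurable_hat φ
  have hΦ := memLp_sobolev_two hψ.regular_sobolev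
  have hΨ : hat ψ =ᵐ[volume] fun k => hat φ k + (greenSymbol m μ k : ℂ) * chargeSum (hat ξ) k :=
    hψ.decomposition
  have hΨa := hXa.add_green (hat_antisymm hψ.regular_antisymm) hΨ
  have hu := integrable_regularUp hm hμ hXm hX hΦm hΦ hΨ
  have hd := integrable_regularDown hm hμ hXm hX hΦm hΦ hΨ
  have ht := hasInt_tailUp hm hμ hX hu
  have hb := hasInt_tailDown hm hμ hX (hd 0)
  refine ⟨ht.1, hb.1, ?_⟩
  rw [((ht.const_mul (1 / (2 * m))).add (hb.const_mul (1 / 2))).2]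
  have h₁ := ((HasInt.of_integrable hu).const_mul (1 / (2 * m))).add
    ((HasInt.sum Finset.univ fun l _ => HasInt.of_integrable (hd l)).const_mul (1 / 2))
  have hre := integral_conj_regular_mul_chargeSum hm hμ hψ hX
  have hre' : HasInt (fun k => ((starRingEnd ℂ) (hat φ k) * chargeSum (hat ξ) k).re) volume
      ((n + 2) * (α / pairFactor m) * ‖ξ‖ ^ 2 +
        ((n + 2) * (∫ w, ‖hat ξ w‖ ^ 2 * diagSymbol m μ w) -
          ∫ k : Conf (n + 2), greenSymbol m μ k * offSum (hat ξ) k)) := by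
    refine ⟨hre.1.re, ?_⟩
    have e := integral_re hre.1
    rw [hre.2] at e
    exact e
  have h₂ := (((inner_hamiltonian hm hμ hψ hX).1.add (hre'.const_mul 2)).add
    (HasInt.of_integrable (integrable_green_offSum hm hμ hXm hX))).add
      (HasInt.sum Finset.univ fun i _ => integral_spectator hm hμ hXm hX i)
  -- Two evaluations of one integral, whose integrands agree by `energy_identity`.
  have h₃ := (h₁.congr (g := _) (by
    filter_upwards [hΨ] with k hk
    rw [energy_identity hm hμ (hat ξ) (hat φ) hk, add_sub_right_comm, add_sub_right_comm])).unique h₂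
  simp only [integral_regularDown_eq hXa hΨa, Finset.sum_const, Finset.card_univ, Fintype.card_fin,
    nsmul_eq_mul] at h₃
  have hw₁ := (hasInt_tail hXm hX hm hμ hm.le (c := m / (m + 1))
    (le_of_eq (by rw [div_pow, pow_two m, mul_div_assoc])) (momentumUp_moment ξ)).2
  have hw₂ := (hasInt_tail hXm hX hm hμ (one_div_pos.2 hm).le (c := 1 / (m + 1))
    (le_of_eq (by field_simp)) (momentumDown_moment hm ξ)).2
  have hw₃ : Integrable fun w => ‖hat ξ w‖ ^ 2 *
      (spectatorEnergy μ w * ((pairFactor m ^ 2)⁻¹ * (Real.pi ^ 2 / pairWidth m μ w))) := by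
    -- The other terms of `tailWeight_identity` are integrable against |X|², hence so is the
    -- spectator term.
    refine (((integrable_diagSymbol hm hμ hXm hX).const_mul (-1)).sub
      (((hw₁.const_mul (1 / (2 * m))).add (hw₂.const_mul (1 / 2))).const_mul
        (pairFactor m ^ 2)⁻¹)).congr (Eventually.of_forall fun w => ?_)
    have e := tailWeight_identity hm hμ w
    simp only [tailWeight] at e
    simp only [Pi.sub_apply, Pi.add_apply]
    linear_combination (-‖hat ξ w‖ ^ 2) * e
  have h₄ := (((((HasInt.of_integrable hw₁).const_mul (1 / (2 * m))).add
    ((HasInt.of_integrable hw₂).const_mul (1 / 2))).const_mul (pairFactor m ^ 2)⁻¹).add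
      (HasInt.of_integrable hw₃)).congr (g := fun w => -1 * (‖hat ξ w‖ ^ 2 * diagSymbol m μ w))
        (Eventually.of_forall fun w => by
          have e := tailWeight_identity hm hμ w
          simp only [tailWeight] at e
          linear_combination ‖hat ξ w‖ ^ 2 * e)
  have h₅ := h₄.unique ((HasInt.of_integrable (integrable_diagSymbol hm hμ hXm hX)).const_mul (-1))
  simp only [tailWeight]
  push_cast at h₃ h₅ ⊢
  -- The regular parts are given by `h₃`; the tail weights and spectator terms, once for each of the
  -- N = n + 2 pairs, by `h₅`.
  linear_combination h₃ + ((n : ℝ) + 2) * h₅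

end

end PointInteraction

end

theorem theorem3 (n : ℕ) (m α μ : ℝ) (hm : 0 < m) (hμ : 0 < μ)
    (ψ φ : PointInteraction.L2 (n + 2)) (ξ : PointInteraction.L2 (n + 1))
    (hψ : PointInteraction.IsDomainDecomposition m α μ ψ φ ξ)
    (hξ : PointInteraction.InSobolev 1 ξ) :
    Integrable (PointInteraction.tailUp m ψ ξ) volume ∧
    Integrable (PointInteraction.tailDown m ψ ξ) volume ∧
    inner ℂ ψ (PointInteraction.hamiltonian hψ) =
      (((∫ k : PointInteraction.E3,
          (1 / (2 * m) * PointInteraction.tailUp m ψ ξ k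
            + 1 / 2 * PointInteraction.tailDown m ψ ξ k))
        - (m + 1) / (2 * m) * PointInteraction.contact m ξ * α : ℝ) : ℂ) := by
  have hX := PointInteraction.integrable_sobolev_one hξ
  obtain ⟨h₁, h₂, h₃⟩ := PointInteraction.hasInt_tails hm hμ hψ hX
  refine ⟨h₁, h₂, ?_⟩
  -- The boundary pairing occurs once in the energy and twice in the tails. The second copy cancels
  -- the off-diagonal and ℒ terms up to N(α/a)‖ξ‖², a = (m+1)/(2m), which equals aCα because C =
  -- a⁻²N‖ξ‖².
  rw [(PointInteraction.inner_hamiltonian hm hμ hψ hX).2,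
    (PointInteraction.integral_conj_regular_mul_chargeSum hm hμ hψ hX).2, Complex.conj_ofReal,
    ← Complex.ofReal_add, h₃, PointInteraction.contact, PointInteraction.pairFactor]
  congr 1
  push_cast
  field_simp
  ring
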